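/- **Conventions.** Manifolds, forms and maps are smooth. Exterior differential systems have constant rank and are described by their fibres: ideals of the exterior algebras of the cotangent spaces. $\langle\cdots\rangle$ denotes the algebraically generated ideal. * A *class $s$ hyperbolic system* on an $(s+4)$-manifold is an exterior differential system (closed under $d$) $\mathcal I$ which is locally generated by $\theta^1,\dots,\theta^s,\ \hat\sigma^1\wedge\hat\sigma^2,\ \check\sigma^1\wedge\check\sigma^2$ for some coframe $(\theta^e,\hat\sigma^a,\check\sigma^a)$. Its singular Pfaffian systems are $\hat V=\mathrm{span}\{\theta^e,\hat\sigma^a\}$ and $\check V=\mathrm{span}\{\theta^e,\check\sigma^a\}$ (unique up to interchange). For a Pfaffian system $V$, $V^\infty_x$ is the span of the differentials at $x$ of the local functions $f$, defined near $x$, with $df\in V$. On an open set, $\mathcal I$ is *Darboux integrable* if there $\hat V^\infty,\check V^\infty$ have locally constant rank, $\hat V+\check V^\infty=\check V+\hat V^\infty=T^*$ and $\hat V^\infty\cap\check V^\infty=0$. * A *hyperbolic Monge–Ampère system* is a class $1$ hyperbolic system on a 5-manifold with $\theta^1$ a contact form ($\theta^1\wedge d\theta^1\wedge d\theta^1\neq0$).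 The *system of the wave equation $u_{xy}=0$* is the one that is, in suitable local coordinates $(x,y,u,p,q)$, equal to $\langle du-p\,dx-q\,dy,\ dp\wedge dx,\ dq\wedge dy\rangle$. * A submersion $\mathbf p:N\to M$ is an *integrable extension* $(\mathcal B,N)\to(\mathcal I,M)$ of differential systems if there is a smooth subbundle $J\subset T^*N$ such that $\mathrm{ann}(J)$ is a complement of $\ker \mathbf p_*$ and $\mathcal B=\langle J\cup \mathbf p^*\mathcal I\rangle$. A differential system $\mathcal B$ with two integrable extensions $\mathbf p_a:(\mathcal B,N)\to(\mathcal I_a,N_a)$, $a=1,2$, is a *Bäcklund transformation* between $\mathcal I_1$ and $\mathcal I_2$; it has *1-dimensional fibres* if all $\ker \mathbf p_{a*}$ are one-dimensional. * For a class $s$ hyperbolic system $\mathcal I$ on $N$, let $N^{[1]}$ be the space of pairs $(x,P)$, $P\subset T_xN$ a regular 2-dimensional integral element of $\mathcal I$; it is a smooth manifold of dimension $\dim N+2$ with projection $\pi(x,P)=x$. The *prolongation* $\mathcal I^{[1]}$ is the differential ideal on $N^{[1]}$ generated by the 1-forms which at each $(x,P)$ are the pull-back by $\pi$ of a covector at $x$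 vanishing on $P$. **Theorem.** Let $(\mathcal I_1,N_1)$ be the Monge–Ampère system of the wave equation on a 5-manifold, and let $(\mathcal I_2,N_2)$ be a hyperbolic Monge–Ampère system on a 5-manifold with $$\operatorname{rank}\hat V_2^\infty=\operatorname{rank}\check V_2^\infty=1,\qquad \operatorname{rank}\hat V_{2,[1]}^\infty=\operatorname{rank}\check V_{2,[1]}^\infty=2,$$ where $\hat V_2,\check V_2$ and $\hat V_{2,[1]},\check V_{2,[1]}$ are the singular systems of $\mathcal I_2$ and of $\mathcal I_2^{[1]}$. Let $\mathbf p_a:(\mathcal B,N)\to(\mathcal I_a,N_a)$, $a=1,2$, be a Bäcklund transformation with 1-dimensional fibres, where $N$ is a 6-manifold. Then $\mathcal B$ is a class $2$ hyperbolic system, so that $N^{[1]}$ (of dimension 8) and $N_1^{[1]},N_2^{[1]}$ (of dimension 7) are defined; $\mathcal B^{[1]}$ is a class $4$ and $\mathcal I_1^{[1]},\mathcal I_2^{[1]}$ are class $3$ hyperbolic systems; and the following hold. 1. The formula $\mathbf p_a^{[1]}(x,P)=(\mathbf p_a(x),\ \mathbf p_{a*}P)$ defines maps $\mathbf p_a^{[1]}:N^{[1]}\to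 N_a^{[1]}$; in particular $\pi_a\circ \mathbf p_a^{[1]}=\mathbf p_a\circ\pi$. 2. With the maps $\mathbf p_1^{[1]},\mathbf p_2^{[1]}$, $\mathcal B^{[1]}$ is a Bäcklund transformation with 1-dimensional fibres between $\mathcal I_1^{[1]}$ and $\mathcal I_2^{[1]}$. 3. $\mathcal I_1^{[1]}$ is Darboux integrable on $N_1^{[1]}$, and $\mathcal I_2^{[1]}$ is Darboux integrable on an open dense subset of $N_2^{[1]}$. -/

import Mathlib

open scoped Manifold ContDiff Topology

set_option linter.unusedSectionVars false

noncomputable section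

namespace EDS

/-! ### Linear algebra of exterior ideals

`V` plays the role of a tangent space, `V →L[ℝ] ℝ` of the cotangent space, and the exterior
algebra of the latter is the algebra of exterior forms at a point.  All ideals below are generated
by homogeneous elements, so that left ideals and two-sided ideals agree. -/

section Linear

variable {V W : Type*} [AddCommGroup V] [Module ℝ V] [TopologicalSpace V]
  [AddCommGroup W] [Module ℝ W] [TopologicalSpace W]

/-- Exterior forms (of all degrees) on `V`. -/
abbrev Ext (V : Type*) [AddCommGroup V] [Module ℝ V] [TopologicalSpace V] : Type _ :=
  ExteriorAlgebra ℝ (V →L[ℝ] ℝ)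

/-- A covector as an exterior form of degree one. -/
abbrev form1 (α : V →L[ℝ] ℝ) : Ext V := ExteriorAlgebra.ι ℝ α

/-- Pull-back of covectors. -/
def pullCov (L : V →L[ℝ] W) : (W →L[ℝ] ℝ) →ₗ[ℝ] (V →L[ℝ] ℝ) where
  toFun α := α.comp L
  map_add' _ _ := rfl
  map_smul' _ _ := rfl

/-- Pull-back of exterior forms along a linear map. -/
def pull (L : V →L[ℝ] W) : Ext W →ₐ[ℝ] Ext V := ExteriorAlgebra.map (pullCov L)

/-- Vectors annihilated by a space of covectors. -/
def annihilator (J : Submodule ℝ (V →L[ℝ] ℝ)) : Submodule ℝ V where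
  carrier := {v | ∀ α ∈ J, α v = 0}
  add_mem' ha hb α hα := by simp [ha α hα, hb α hα]
  zero_mem' α _ := by simp
  smul_mem' c v hv α hα := by simp [hv α hα]

/-- A subspace is an integral element if every form of the ideal restricts to zero on it. -/
def IsIntegral (K : Ideal (Ext V)) (P : Submodule ℝ V) : Prop :=
  ∀ η ∈ K, pull P.subtypeL η = 0

/-- The polar space of a vector `v`: all `w` such that `v, w` span an integral element. -/
def polar (K : Ideal (Ext V)) (v : V) : Submodule ℝ V :=
  Submodule.span ℝ {w | IsIntegral K (Submodule.span ℝ {v, w})}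

/-- Regular 2-dimensional integral elements: those which are the end of a regular flag
`0 ⊂ ⟨v⟩ ⊂ P`, that is, which contain a line whose polar space has the smallest dimension among
all one-dimensional integral elements. -/
structure IsRegularIntegralPlane (K : Ideal (Ext V)) (P : Submodule ℝ V) : Prop where
  integral : IsIntegral K P
  finrank_eq : Module.finrank ℝ P = 2
  regular : ∃ v ∈ P, v ≠ 0 ∧ ∀ u : V, u ≠ 0 → IsIntegral K (Submodule.span ℝ {u}) →
    Module.finrank ℝ (polar K v) ≤ Module.finrank ℝ (polar K u)

/-- An adapted coframe of a class `s` hyperbolic ideal at a point: covectors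
`θ¹, …, θˢ, σ̂¹, σ̂², σ̌¹, σ̌²` which form a basis of the dual space (equivalently, whose joint
evaluation map is bijective) such that the ideal is generated by the `θᵉ`, `σ̂¹ ∧ σ̂²` and
`σ̌¹ ∧ σ̌²`. -/
structure IsAdapted {s : ℕ} (K : Ideal (Ext V)) (θ : Fin s → (V →L[ℝ] ℝ))
    (σhat σchk : Fin 2 → (V →L[ℝ] ℝ)) : Prop where
  coframe : Function.Bijective
    (fun v : V => ((fun e => θ e v, fun a => σhat a v, fun a => σchk a v) :
      (Fin s → ℝ) × (Fin 2 → ℝ) × (Fin 2 → ℝ)))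
  generates : K = Ideal.span (Set.range (fun e => form1 (θ e)) ∪
    {form1 (σhat 0) * form1 (σhat 1), form1 (σchk 0) * form1 (σchk 1)})

lemma pull_form1 (L : V →L[ℝ] W) (α : W →L[ℝ] ℝ) : pull L (form1 α) = form1 (α.comp L) :=
  ExteriorAlgebra.map_apply_ι _ _

lemma IsIntegral.mono {K : Ideal (Ext V)} {P Q : Submodule ℝ V} (hPQ : P ≤ Q)
    (hQ : IsIntegral K Q) : IsIntegral K P := by
  intro η hη
  let i : P →L[ℝ] Q := P.subtypeL.codRestrict Q (fun v => hPQ v.2)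
  have : pull P.subtypeL = (pull i).comp (pull Q.subtypeL) := by
    apply ExteriorAlgebra.hom_ext
    ext α : 1
    simp only [LinearMap.comp_apply, AlgHom.toLinearMap_apply, AlgHom.comp_apply]
    erw [pull_form1, pull_form1, pull_form1]
    rfl
  rw [this, AlgHom.comp_apply, hQ η hη, map_zero]

/-- If `α ∧ β = 0` then all `2 × 2` minors of `(α, β)` vanish. -/
lemma minor_eq_zero {α β : V →L[ℝ] ℝ} (h : form1 α * form1 β = 0) (v w : V) :
    α v * β w - α w * β v = 0 := by
  let D : (V →L[ℝ] ℝ) [⋀^Fin 2]→ₗ[ℝ] ℝ :=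
    { toFun := fun m => m 0 v * m 1 w - m 0 w * m 1 v
      map_update_add' := by
        intro _ m i x y
        fin_cases i <;> simp <;> ring
      map_update_smul' := by
        intro _ m i c x
        fin_cases i <;> simp <;> ring
      map_eq_zero_of_eq' := by
        intro m i j hm hij
        fin_cases i <;> fin_cases j <;> simp_all <;> ring }
  let F : ∀ i : ℕ, (V →L[ℝ] ℝ) [⋀^Fin i]→ₗ[ℝ] ℝ := fun i =>
    match i with
    | 2 => D
    | _ => 0
  have h2 : form1 α * form1 β = ExteriorAlgebra.ιMulti ℝ 2 ![α, β] := by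
    simp [ExteriorAlgebra.ιMulti_apply]
  have h3 := ExteriorAlgebra.liftAlternating_apply_ιMulti F ![α, β]
  rw [← h2, h, map_zero] at h3
  simpa [F, D] using h3.symm

lemma wedge_eq_zero_of_minor {α β : V →L[ℝ] ℝ} {a b : ℝ} (hab : a ≠ 0 ∨ b ≠ 0)
    (h : ∀ v, b * α v = a * β v) : form1 α * form1 β = 0 := by
  rcases hab with ha | hb
  · have : β = (b / a) • α := by
      ext v
      have := h v
      simp only [smul_apply, smul_eq_mul]
      field_simp
      linarith
    rw [this, form1, form1, map_smul, mul_smul_comm, ExteriorAlgebra.ι_sq_zero, smul_zero]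
  · have : α = (a / b) • β := by
      ext v
      have := h v
      simp only [smul_apply, smul_eq_mul]
      field_simp
      linarith
    rw [this, form1, form1, map_smul, smul_mul_assoc, ExteriorAlgebra.ι_sq_zero, smul_zero]

namespace IsAdapted

variable {s : ℕ} {K : Ideal (Ext V)} {θ : Fin s → (V →L[ℝ] ℝ)} {σhat σchk : Fin 2 → (V →L[ℝ] ℝ)}

/-- Coordinates of vectors with respect to an adapted coframe. -/
def ev (h : IsAdapted K θ σhat σchk) :
    V ≃ₗ[ℝ] (Fin s → ℝ) × (Fin 2 → ℝ) × (Fin 2 → ℝ) :=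
  LinearEquiv.ofBijective
    { toFun := fun v => (fun e => θ e v, fun a => σhat a v, fun a => σchk a v)
      map_add' := fun v w => by ext <;> simp
      map_smul' := fun c v => by ext <;> simp } h.coframe

lemma ev_apply (h : IsAdapted K θ σhat σchk) (v : V) :
    h.ev v = (fun e => θ e v, fun a => σhat a v, fun a => σchk a v) := rfl

/-- The vector with the given coordinates in the coframe. -/
def vec (h : IsAdapted K θ σhat σchk) (m n : Fin 2 → ℝ) : V := h.ev.symm (0, m, n)

lemma ev_vec (h : IsAdapted K θ σhat σchk) (m n : Fin 2 → ℝ) : h.ev (h.vec m n) = (0, m, n) := by simp [vec]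

lemma θ_vec (h : IsAdapted K θ σhat σchk) (m n : Fin 2 → ℝ) (e : Fin s) : θ e (h.vec m n) = 0 :=
  congrFun (congrArg Prod.fst (h.ev_vec m n)) e

lemma σhat_vec (h : IsAdapted K θ σhat σchk) (m n : Fin 2 → ℝ) (a : Fin 2) : σhat a (h.vec m n) = m a :=
  congrFun (congrArg (fun p => p.2.1) (h.ev_vec m n)) a

lemma σchk_vec (h : IsAdapted K θ σhat σchk) (m n : Fin 2 → ℝ) (a : Fin 2) : σchk a (h.vec m n) = n a :=
  congrFun (congrArg (fun p => p.2.2) (h.ev_vec m n)) a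

lemma eq_vec (h : IsAdapted K θ σhat σchk) {v : V} {m n : Fin 2 → ℝ} (h0 : ∀ e, θ e v = 0) (h1 : ∀ a, σhat a v = m a)
    (h2 : ∀ a, σchk a v = n a) : v = h.vec m n := by
  apply h.ev.injective
  rw [ev_vec, ev_apply]
  ext <;> simp [h0, h1, h2]

/-- The plane on which all `θᵉ` vanish, `σ̂` is proportional to `m`, and `σ̌` is proportional
to `n`. -/
def plane (h : IsAdapted K θ σhat σchk) (m n : Fin 2 → ℝ) : Submodule ℝ V :=
  Submodule.span ℝ {h.vec m 0, h.vec 0 n}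

lemma comb_eq (h : IsAdapted K θ σhat σchk) (m n : Fin 2 → ℝ) (a b : ℝ) :
    a • h.vec m 0 + b • h.vec 0 n = h.vec (a • m) (b • n) := by
  apply h.ev.injective
  simp [ev_vec]

lemma mem_plane (h : IsAdapted K θ σhat σchk) {m n : Fin 2 → ℝ} {v : V} :
    v ∈ h.plane m n ↔ ∃ a b : ℝ, v = h.vec (a • m) (b • n) := by
  rw [plane, Submodule.mem_span_pair]
  simp only [comb_eq, eq_comm]

lemma finrank_plane (h : IsAdapted K θ σhat σchk) {m n : Fin 2 → ℝ} (hm : m ≠ 0) (hn : n ≠ 0) :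
    Module.finrank ℝ (h.plane m n) = 2 := by
  have hli : LinearIndependent ℝ ![h.vec m 0, h.vec 0 n] := by
    rw [LinearIndependent.pair_iff]
    intro a b hab
    rw [comb_eq] at hab
    have := congrArg h.ev hab
    simp only [ev_vec, map_zero, Prod.mk_eq_zero, true_and, smul_eq_zero] at this
    exact ⟨this.1.resolve_right hm, this.2.resolve_right hn⟩
  have := finrank_span_eq_card hli
  have hr : Set.range ![h.vec m 0, h.vec 0 n] = {h.vec m 0, h.vec 0 n} := by
    simp [Matrix.range_cons, Set.singleton_union, -Set.union_singleton]
  rw [hr] at this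
  exact this.trans (by simp)

lemma ne_zero_cases {m : Fin 2 → ℝ} (hm : m ≠ 0) : m 0 ≠ 0 ∨ m 1 ≠ 0 := by
  by_contra! hc
  exact hm (by ext i; fin_cases i <;> simp [hc])

lemma integral_iff (h : IsAdapted K θ σhat σchk) (P : Submodule ℝ V) : IsIntegral K P ↔
    (∀ e, ∀ v ∈ P, θ e v = 0) ∧
    form1 ((σhat 0).comp P.subtypeL) * form1 ((σhat 1).comp P.subtypeL) = 0 ∧
    form1 ((σchk 0).comp P.subtypeL) * form1 ((σchk 1).comp P.subtypeL) = 0 := by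
  constructor
  · intro hP
    have hmem : ∀ η ∈ (Set.range (fun e => form1 (θ e)) ∪
        {form1 (σhat 0) * form1 (σhat 1), form1 (σchk 0) * form1 (σchk 1)} : Set (Ext V)),
        pull P.subtypeL η = 0 := fun η hη => hP η (by
          rw [h.generates]; exact Ideal.subset_span hη)
    refine ⟨fun e v hv => ?_, ?_, ?_⟩
    · have := hmem (form1 (θ e)) (Or.inl ⟨e, rfl⟩)
      rw [pull_form1, form1, ExteriorAlgebra.ι_eq_zero_iff] at this
      exact congrArg (fun f : P →L[ℝ] ℝ => f ⟨v, hv⟩) this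
    · have := hmem (form1 (σhat 0) * form1 (σhat 1)) (Or.inr (Or.inl rfl))
      rwa [map_mul, pull_form1, pull_form1] at this
    · have := hmem (form1 (σchk 0) * form1 (σchk 1)) (Or.inr (Or.inr rfl))
      rwa [map_mul, pull_form1, pull_form1] at this
  · rintro ⟨h0, h1, h2⟩
    have hle : K ≤ RingHom.ker (pull P.subtypeL : Ext V →ₐ[ℝ] Ext P) := by
      rw [h.generates, Ideal.span_le]
      rintro η (⟨e, rfl⟩ | rfl | rfl)
      · show pull P.subtypeL (form1 (θ e)) = 0
        rw [pull_form1, form1, ExteriorAlgebra.ι_eq_zero_iff]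
        ext v
        exact h0 e v v.2
      · show pull P.subtypeL (form1 (σhat 0) * form1 (σhat 1)) = 0
        rwa [map_mul, pull_form1, pull_form1]
      · show pull P.subtypeL (form1 (σchk 0) * form1 (σchk 1)) = 0
        rwa [map_mul, pull_form1, pull_form1]
    intro η hη
    exact hle hη

lemma integral_plane (h : IsAdapted K θ σhat σchk) {m n : Fin 2 → ℝ} (hm : m ≠ 0) (hn : n ≠ 0) :
    IsIntegral K (h.plane m n) := by
  rw [h.integral_iff]
  refine ⟨?_, ?_, ?_⟩
  · intro e v hv
    obtain ⟨a, b, rfl⟩ := h.mem_plane.1 hv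
    exact h.θ_vec _ _ e
  · refine wedge_eq_zero_of_minor (a := m 0) (b := m 1) (ne_zero_cases hm) ?_
    rintro ⟨v, hv⟩
    obtain ⟨a, b, rfl⟩ := h.mem_plane.1 hv
    simp [h.σhat_vec]
    ring
  · refine wedge_eq_zero_of_minor (a := n 0) (b := n 1) (ne_zero_cases hn) ?_
    rintro ⟨v, hv⟩
    obtain ⟨a, b, rfl⟩ := h.mem_plane.1 hv
    simp [h.σchk_vec]
    ring

/-- Proportionality of two pairs of reals with vanishing minor. -/
lemma exists_smul {m k : Fin 2 → ℝ} (hm : m ≠ 0) (hk : m 0 * k 1 - k 0 * m 1 = 0) :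
    ∃ a : ℝ, k = a • m := by
  rcases ne_zero_cases hm with h0 | h1
  · refine ⟨k 0 / m 0, ?_⟩
    ext i
    fin_cases i
    · simp; field_simp
    · simp; field_simp; linarith
  · refine ⟨k 1 / m 1, ?_⟩
    ext i
    fin_cases i
    · simp; field_simp; linarith
    · simp; field_simp

lemma integral_minor (h : IsAdapted K θ σhat σchk) {P : Submodule ℝ V} (hP : IsIntegral K P) {v w : V} (hv : v ∈ P)
    (hw : w ∈ P) : (∀ e, θ e v = 0) ∧ (σhat 0 v * σhat 1 w - σhat 0 w * σhat 1 v = 0) ∧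
      (σchk 0 v * σchk 1 w - σchk 0 w * σchk 1 v = 0) := by
  obtain ⟨h0, h1, h2⟩ := (h.integral_iff P).1 hP
  exact ⟨fun e => h0 e v hv, minor_eq_zero h1 ⟨v, hv⟩ ⟨w, hw⟩, minor_eq_zero h2 ⟨v, hv⟩ ⟨w, hw⟩⟩

lemma exists_ne_zero_of_finrank {P : Submodule ℝ V} (hP : Module.finrank ℝ P = 2)
    (τ τ' : Fin 2 → (V →L[ℝ] ℝ))
    (hinj : ∀ v ∈ P, (∀ a, τ a v = 0) → (∀ a, τ' a v = 0) → v = 0)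
    (hmin : ∀ v ∈ P, ∀ w ∈ P, τ' 0 v * τ' 1 w - τ' 0 w * τ' 1 v = 0) :
    ∃ v ∈ P, (fun a => τ a v) ≠ 0 := by
  by_contra! hc
  let T : P →ₗ[ℝ] (Fin 2 → ℝ) :=
    { toFun := fun v a => τ' a v
      map_add' := fun v w => by ext; simp
      map_smul' := fun c v => by ext; simp }
  have : FiniteDimensional ℝ P := Module.finite_of_finrank_pos (by omega)
  have hTi : Function.Injective T := by
    rw [injective_iff_map_eq_zero]
    intro v hv
    exact Subtype.ext (hinj v v.2 (fun a => congrFun (hc v v.2) a) (fun a => congrFun hv a))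
  have hTs : Function.Surjective T :=
    (LinearMap.injective_iff_surjective_of_finrank_eq_finrank (by simp [hP])).1 hTi
  obtain ⟨v, hv⟩ := hTs ![1, 0]
  obtain ⟨w, hw⟩ := hTs ![0, 1]
  have := hmin v v.2 w w.2
  have e1 : τ' 0 v = 1 := congrFun hv 0
  have e2 : τ' 1 v = 0 := congrFun hv 1
  have e3 : τ' 1 w = 1 := congrFun hw 1
  rw [e1, e2, e3] at this
  simp at this

lemma eq_zero_of_coords (h : IsAdapted K θ σhat σchk) {v : V} (h0 : ∀ e, θ e v = 0) (h1 : ∀ a, σhat a v = 0)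
    (h2 : ∀ a, σchk a v = 0) : v = 0 := by
  have := h.eq_vec (m := 0) (n := 0) h0 h1 h2
  rw [this]
  exact h.ev.injective (by rw [ev_vec, map_zero]; rfl)

/-- Every 2-dimensional integral element is one of the planes above. -/
lemma exists_plane (h : IsAdapted K θ σhat σchk) {P : Submodule ℝ V} (hP : IsIntegral K P) (h2 : Module.finrank ℝ P = 2) :
    ∃ m n : Fin 2 → ℝ, m ≠ 0 ∧ n ≠ 0 ∧ P = h.plane m n := by
  obtain ⟨v, hv, hm⟩ := exists_ne_zero_of_finrank h2 σhat σchk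
    (fun v hv a b => h.eq_zero_of_coords (h.integral_minor hP hv hv).1 a b)
    (fun v hv w hw => (h.integral_minor hP hv hw).2.2)
  obtain ⟨w, hw, hn⟩ := exists_ne_zero_of_finrank h2 σchk σhat
    (fun v hv a b => h.eq_zero_of_coords (h.integral_minor hP hv hv).1 b a)
    (fun v hv w hw => (h.integral_minor hP hv hw).2.1)
  refine ⟨_, _, hm, hn, ?_⟩
  have hle : P ≤ h.plane (fun a => σhat a v) (fun a => σchk a w) := by
    intro u hu
    obtain ⟨a, ha⟩ := exists_smul (k := fun a => σhat a u) hm (h.integral_minor hP hv hu).2.1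
    obtain ⟨b, hb⟩ := exists_smul (k := fun a => σchk a u) hn (h.integral_minor hP hw hu).2.2
    exact h.mem_plane.2 ⟨a, b, h.eq_vec (h.integral_minor hP hu hu).1
      (fun i => congrFun ha i) (fun i => congrFun hb i)⟩
  have : FiniteDimensional ℝ (h.plane (fun a => σhat a v) (fun a => σchk a w)) :=
    Module.finite_of_finrank_pos (by rw [h.finrank_plane hm hn]; omega)
  exact Submodule.eq_of_le_of_finrank_eq hle (by rw [h2, h.finrank_plane hm hn])

lemma two_le_finrank_polar [FiniteDimensional ℝ V] (h : IsAdapted K θ σhat σchk) {u : V}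
    (hu : IsIntegral K (Submodule.span ℝ {u})) : 2 ≤ Module.finrank ℝ (polar K u) := by
  have hθ := (h.integral_minor hu (Submodule.mem_span_singleton_self u)
    (Submodule.mem_span_singleton_self u)).1
  have key : ∀ k : Fin 2 → ℝ, ∃ m : Fin 2 → ℝ, m ≠ 0 ∧ ∃ a : ℝ, k = a • m := by
    intro k
    by_cases hk : k = 0
    · exact ⟨fun _ => 1, fun hc => one_ne_zero (congrFun hc 0), 0, by simp [hk]⟩
    · exact ⟨k, hk, 1, by simp⟩
  obtain ⟨m, hm, a, ha⟩ := key (fun i => σhat i u)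
  obtain ⟨n, hn, b, hb⟩ := key (fun i => σchk i u)
  have hmem : u ∈ h.plane m n := h.mem_plane.2 ⟨a, b, h.eq_vec hθ
    (fun i => congrFun ha i) (fun i => congrFun hb i)⟩
  have hle : h.plane m n ≤ polar K u := by
    intro w hw
    refine Submodule.subset_span ?_
    refine (h.integral_plane hm hn).mono ?_
    rw [Submodule.span_le]
    rintro x (rfl | rfl)
    · exact hmem
    · exact hw
  rw [← h.finrank_plane hm hn]
  exact Submodule.finrank_mono hle

/-- For a hyperbolic ideal the planes above (hence all 2-dimensional integral elements) are
regular. -/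
lemma regular_plane [FiniteDimensional ℝ V] (h : IsAdapted K θ σhat σchk) {m n : Fin 2 → ℝ} (hm : m ≠ 0) (hn : n ≠ 0) :
    IsRegularIntegralPlane K (h.plane m n) := by
  refine ⟨h.integral_plane hm hn, h.finrank_plane hm hn, h.vec m n,
    h.mem_plane.2 ⟨1, 1, by simp⟩, ?_, ?_⟩
  · intro hc
    have := h.σhat_vec m n
    rw [hc] at this
    exact hm (by ext i; simpa using (this i).symm)
  · intro u _ hu
    refine le_trans ?_ (h.two_le_finrank_polar hu)
    rw [← h.finrank_plane hm hn]
    refine Submodule.finrank_mono ?_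
    rw [polar, Submodule.span_le]
    intro w hw
    have hv' : h.vec m n ∈ Submodule.span ℝ {h.vec m n, w} := Submodule.subset_span (by simp)
    have hw' : w ∈ Submodule.span ℝ {h.vec m n, w} := Submodule.subset_span (by simp)
    have h1 := h.integral_minor hw hv' hw'
    simp only [h.σhat_vec, h.σchk_vec] at h1
    obtain ⟨a, ha⟩ := exists_smul (k := fun a => σhat a w) hm h1.2.1
    obtain ⟨b, hb⟩ := exists_smul (k := fun a => σchk a w) hn h1.2.2
    exact h.mem_plane.2 ⟨a, b, h.eq_vec (h.integral_minor hw hw' hw').1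
      (fun i => congrFun ha i) (fun i => congrFun hb i)⟩

end IsAdapted

end Linear


/-! ### Exterior ideals on manifolds

Manifolds are modelled on a finite-dimensional normed space `E` and are smooth. -/

section Manifold

variable {E : Type*} [NormedAddCommGroup E] [NormedSpace ℝ E]
  {N : Type*} [TopologicalSpace N] [ChartedSpace E N]

/-- Tangent spaces. -/
abbrev Tan (E : Type*) [NormedAddCommGroup E] [NormedSpace ℝ E] {N : Type*} [TopologicalSpace N]
    [ChartedSpace E N] (x : N) : Type _ := TangentSpace 𝓘(ℝ, E) x

/-- Cotangent spaces. -/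
abbrev Cot (E : Type*) [NormedAddCommGroup E] [NormedSpace ℝ E] {N : Type*} [TopologicalSpace N]
    [ChartedSpace E N] (x : N) : Type _ := Tan E x →L[ℝ] ℝ

/-- (Not necessarily smooth) differential 1-forms. -/
abbrev OneForm (E N : Type*) [NormedAddCommGroup E] [NormedSpace ℝ E] [TopologicalSpace N]
    [ChartedSpace E N] : Type _ := ∀ x : N, Cot E x

/-- A constant rank exterior ideal on `N`, given by its fibres: the homogeneous ideal `I x` of the
exterior algebra of the cotangent space at each point `x`; the ideal in `Ω^*(N)` consists of the
smooth forms whose value at each `x` lies in `I x`. -/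
abbrev FormIdeal (E N : Type*) [NormedAddCommGroup E] [NormedSpace ℝ E] [TopologicalSpace N]
    [ChartedSpace E N] : Type _ := ∀ x : N, Ideal (Ext (Tan E x))

/-- The expression of a 1-form in a chart. -/
def localRep (θ : OneForm E N) (c : OpenPartialHomeomorph N E) (y : E) : E →L[ℝ] ℝ :=
  (θ (c.symm y)).comp (mfderiv 𝓘(ℝ, E) 𝓘(ℝ, E) c.symm y)

/-- A 1-form is smooth on an open set if its expressions in the charts of the atlas are. -/
def SmoothOn (θ : OneForm E N) (U : Set N) : Prop :=
  ∀ c ∈ atlas E N, ContDiffOn ℝ ∞ (localRep θ c) (c.target ∩ c.symm ⁻¹' U)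

/-- The linear coordinates `xⁱ` of `E` in a basis. -/
def coordCov [FiniteDimensional ℝ E] (i : Fin (Module.finrank ℝ E)) : E →L[ℝ] ℝ :=
  LinearMap.toContinuousLinearMap ((Module.finBasis ℝ E).coord i)

/-- The exterior derivative of a 1-form at `x`, computed in the chart at `x`:
`dθ = ∑ᵢ dxⁱ ∧ ∂θ/∂xⁱ`.  (The tangent space at `x` is identified with `E` by that chart.) -/
def extD [FiniteDimensional ℝ E] (θ : OneForm E N) (x : N) : Ext (Tan E x) :=
  ∑ i, form1 (V := Tan E x) (coordCov i : E →L[ℝ] ℝ) *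
    form1 (V := Tan E x)
      (fderiv ℝ (localRep θ (chartAt E x)) (chartAt E x x) (Module.finBasis ℝ E i))

/-- The differential of a function. -/
def diff (f : N → ℝ) (x : N) : Cot E x := mfderiv 𝓘(ℝ, E) 𝓘(ℝ, ℝ) f x

/-- The ideal is closed under exterior differentiation of its 1-forms.  For the ideals in this
file this is the same as being a differential ideal: they are generated in degrees one and two, and
contain every form of degree at least three. -/
def IsDClosed [FiniteDimensional ℝ E] (I : FormIdeal E N) : Prop :=
  ∀ U : Set N, IsOpen U → ∀ θ : OneForm E N, SmoothOn θ U →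
    (∀ x ∈ U, form1 (θ x) ∈ I x) → ∀ x ∈ U, extD θ x ∈ I x

/-- An adapted local coframe on `U` of a class `s` hyperbolic system. -/
structure AdaptedCoframe (s : ℕ) (I : FormIdeal E N) (U : Set N) where
  θ : Fin s → OneForm E N
  σhat : Fin 2 → OneForm E N
  σchk : Fin 2 → OneForm E N
  smooth_θ : ∀ e, SmoothOn (θ e) U
  smooth_σhat : ∀ a, SmoothOn (σhat a) U
  smooth_σchk : ∀ a, SmoothOn (σchk a) U
  adapted : ∀ x ∈ U, IsAdapted (I x) (fun e => θ e x) (fun a => σhat a x) (fun a => σchk a x)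

/-- Class `s` hyperbolic exterior differential systems (on an `(s+4)`-manifold). -/
structure IsHyperbolic [FiniteDimensional ℝ E] (s : ℕ) (I : FormIdeal E N) : Prop where
  closed : IsDClosed I
  exists_coframe : ∀ x : N, ∃ U : Set N, IsOpen U ∧ x ∈ U ∧ Nonempty (AdaptedCoframe s I U)

/-- Hyperbolic Monge-Ampère systems: hyperbolic systems of class one (on a 5-manifold) whose
1-form `θ` is a contact form, `θ ∧ dθ ∧ dθ ≠ 0`. -/
structure IsHyperbolicMongeAmpere [FiniteDimensional ℝ E] (I : FormIdeal E N) : Prop where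
  hyperbolic : IsHyperbolic 1 I
  contact : ∀ U : Set N, IsOpen U → ∀ θ : OneForm E N, SmoothOn θ U →
    (∀ x ∈ U, form1 (θ x) ∈ I x ∧ θ x ≠ 0) → ∀ x ∈ U, form1 (θ x) * extD θ x * extD θ x ≠ 0

/-- The standard Monge-Ampère system of the wave equation `u_xy = 0`: locally there are
coordinates `x, y, u, p, q` such that the ideal is generated by `du - p dx - q dy`, `dp ∧ dx` and
`dq ∧ dy`. -/
def IsWaveSystem (I : FormIdeal E N) : Prop :=
  ∀ z₀ : N, ∃ U : Set N, IsOpen U ∧ z₀ ∈ U ∧ ∃ x y u p q : N → ℝ,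
    (∀ f ∈ ({x, y, u, p, q} : Set (N → ℝ)), ContMDiffOn 𝓘(ℝ, E) 𝓘(ℝ, ℝ) ∞ f U) ∧
    ∀ z ∈ U,
      Function.Bijective (fun v : Tan E z =>
        (![diff x z v, diff y z v, diff u z v, diff p z v, diff q z v] : Fin 5 → ℝ)) ∧
      I z = Ideal.span {form1 (diff u z - p z • diff x z - q z • diff y z),
        form1 (diff p z) * form1 (diff x z), form1 (diff q z) * form1 (diff y z)}

/-! ### Singular systems and Darboux integrability -/

/-- The singular Pfaffian system `V̂ = span {θᵉ, σ̂ᵃ}`. -/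
def AdaptedCoframe.hatV {s : ℕ} {I : FormIdeal E N} {U : Set N} (c : AdaptedCoframe s I U)
    (x : N) : Submodule ℝ (Cot E x) :=
  Submodule.span ℝ (Set.range (fun e => c.θ e x) ∪ Set.range (fun a => c.σhat a x))

/-- The singular Pfaffian system `V̌ = span {θᵉ, σ̌ᵃ}`. -/
def AdaptedCoframe.chkV {s : ℕ} {I : FormIdeal E N} {U : Set N} (c : AdaptedCoframe s I U)
    (x : N) : Submodule ℝ (Cot E x) :=
  Submodule.span ℝ (Set.range (fun e => c.θ e x) ∪ Set.range (fun a => c.σchk a x))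

/-- For a Pfaffian system `V` on `U`, the space `V^∞` at `x` spanned by the differentials of the
smooth local first integrals defined about `x`. -/
def firstIntegrals (U : Set N) (V : ∀ x : N, Submodule ℝ (Cot E x)) (x : N) :
    Submodule ℝ (Cot E x) :=
  Submodule.span ℝ {α | ∃ (O : Set N) (f : N → ℝ), IsOpen O ∧ x ∈ O ∧ O ⊆ U ∧
    ContMDiffOn 𝓘(ℝ, E) 𝓘(ℝ, ℝ) ∞ f O ∧ (∀ y ∈ O, diff f y ∈ V y) ∧ α = diff f x}

/-- Both bundles of first integrals `V̂^∞` and `V̌^∞` of a class `s` hyperbolic system have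
rank `k`. -/
def HasFirstIntegralRank (s : ℕ) (I : FormIdeal E N) (k : ℕ) : Prop :=
  ∀ U : Set N, IsOpen U → ∀ c : AdaptedCoframe s I U, ∀ x ∈ U,
    Module.finrank ℝ (firstIntegrals U c.hatV x) = k ∧
    Module.finrank ℝ (firstIntegrals U c.chkV x) = k

/-- Darboux integrability, on the open set `O`, of a class `s` hyperbolic system: the bundles
`V̂^∞`, `V̌^∞` have (locally) constant rank, `V̂ + V̌^∞ = T^*N`, `V̌ + V̂^∞ = T^*N` and
`V̂^∞ ∩ V̌^∞ = 0`.  (The singular systems are unique up to interchange, so that the conditions do not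
depend on the adapted coframe.) -/
structure IsDarbouxIntegrableOn [FiniteDimensional ℝ E] (s : ℕ) (I : FormIdeal E N)
    (O : Set N) : Prop where
  hyperbolic : IsHyperbolic s I
  rank : ∀ U : Set N, IsOpen U → ∀ c : AdaptedCoframe s I U, ∀ x ∈ U ∩ O, ∀ᶠ y in 𝓝 x,
    Module.finrank ℝ (firstIntegrals U c.hatV y) = Module.finrank ℝ (firstIntegrals U c.hatV x) ∧
    Module.finrank ℝ (firstIntegrals U c.chkV y) = Module.finrank ℝ (firstIntegrals U c.chkV x)
  sum_eq_top : ∀ U : Set N, IsOpen U → ∀ c : AdaptedCoframe s I U, ∀ x ∈ U ∩ O,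
    c.hatV x ⊔ firstIntegrals U c.chkV x = ⊤ ∧ c.chkV x ⊔ firstIntegrals U c.hatV x = ⊤
  inf_eq_bot : ∀ U : Set N, IsOpen U → ∀ c : AdaptedCoframe s I U, ∀ x ∈ U ∩ O,
    firstIntegrals U c.hatV x ⊓ firstIntegrals U c.chkV x = ⊥

/-! ### Integrable extensions and Bäcklund transformations -/

section Extension

variable {E₁ : Type*} [NormedAddCommGroup E₁] [NormedSpace ℝ E₁]
  {M : Type*} [TopologicalSpace M] [ChartedSpace E₁ M]
  {E₂ : Type*} [NormedAddCommGroup E₂] [NormedSpace ℝ E₂]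
  {M' : Type*} [TopologicalSpace M'] [ChartedSpace E₂ M']

/-- The differential of a map. -/
def dmap (E E₁ : Type*) [NormedAddCommGroup E] [NormedSpace ℝ E] [NormedAddCommGroup E₁]
    [NormedSpace ℝ E₁] {N M : Type*} [TopologicalSpace N] [ChartedSpace E N]
    [TopologicalSpace M] [ChartedSpace E₁ M] (p : N → M) (x : N) : Tan E x →L[ℝ] Tan E₁ (p x) :=
  mfderiv 𝓘(ℝ, E) 𝓘(ℝ, E₁) p x

/-- Smooth constant rank subbundles of the cotangent bundle. -/
def IsSmoothSubbundle (J : ∀ x : N, Submodule ℝ (Cot E x)) : Prop :=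
  ∃ r : ℕ, ∀ x : N, ∃ U : Set N, IsOpen U ∧ x ∈ U ∧ ∃ ξ : Fin r → OneForm E N,
    (∀ i, SmoothOn (ξ i) U) ∧ ∀ y ∈ U,
      LinearIndependent ℝ (fun i => ξ i y) ∧ Submodule.span ℝ (Set.range fun i => ξ i y) = J y

/-- `p : (A, N) → (I, M)` is an integrable extension: `p` is a smooth submersion and there is a
subbundle `J` of `T^*N` such that `ann J` is a complement of the tangent spaces of the fibres and
`A` is generated algebraically by `J` and the pull-back of `I`. -/
def IsIntegrableExtension (A : FormIdeal E N) (I : FormIdeal E₁ M) (p : N → M) : Prop :=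
  ContMDiff 𝓘(ℝ, E) 𝓘(ℝ, E₁) ∞ p ∧
  (∀ x, Function.Surjective (dmap E E₁ p x)) ∧
  ∃ J : ∀ x : N, Submodule ℝ (Cot E x), IsSmoothSubbundle J ∧
    (∀ x, IsCompl (annihilator (J x)) (dmap E E₁ p x).ker) ∧
    ∀ x, A x = Ideal.span ((form1 '' (J x : Set (Cot E x))) ∪
      (pull (dmap E E₁ p x) '' (I (p x) : Set (Ext (Tan E₁ (p x))))))

/-- A differential system `B` on `N` and maps `p₁`, `p₂` form a Bäcklund transformation with
1-dimensional fibres between `I₁` and `I₂`. -/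
structure IsBacklund [FiniteDimensional ℝ E] (B : FormIdeal E N) (I₁ : FormIdeal E₁ M)
    (I₂ : FormIdeal E₂ M') (p₁ : N → M) (p₂ : N → M') : Prop where
  closed : IsDClosed B
  extension₁ : IsIntegrableExtension B I₁ p₁
  extension₂ : IsIntegrableExtension B I₂ p₂
  fibre₁ : ∀ x, Module.finrank ℝ (dmap E E₁ p₁ x).ker = 1
  fibre₂ : ∀ x, Module.finrank ℝ (dmap E E₂ p₂ x).ker = 1

end Extension


/-! ### Prolongation -/

section Prolongation

variable [FiniteDimensional ℝ E] {s : ℕ} {I : FormIdeal E N}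

/-- The prolongation space `N^{[1]}` of a hyperbolic system: the regular 2-dimensional integral
elements `(x, P)`. -/
def Prolongation (_h : IsHyperbolic s I) : Type _ :=
  {q : Σ x : N, Submodule ℝ (Tan E x) // IsRegularIntegralPlane (I q.1) q.2}

/-- `slope P α β` is the number `a` with `β = a α` on `P`. -/
def slope {V : Type*} [AddCommGroup V] [Module ℝ V] [TopologicalSpace V] (P : Submodule ℝ V)
    (α β : V →L[ℝ] ℝ) : ℝ :=
  open Classical in if h : ∃ v ∈ P, α v ≠ 0 then β h.choose / α h.choose else 0

lemma slope_spec {V : Type*} [AddCommGroup V] [Module ℝ V] [TopologicalSpace V]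
    {P : Submodule ℝ V} {α β : V →L[ℝ] ℝ} (h : ∃ v ∈ P, α v ≠ 0) :
    ∃ v ∈ P, α v ≠ 0 ∧ slope P α β = β v / α v :=
  ⟨h.choose, h.choose_spec.1, h.choose_spec.2, by rw [slope, dif_pos h]⟩

/-- The homogeneous coordinates `(1, a)` (if `i = 0`) or `(a, 1)` (if `i = 1`). -/
def dir (i : Fin 2) (a : ℝ) : Fin 2 → ℝ := fun k => if k = i then 1 else a

lemma dir_ne_zero (i : Fin 2) (a : ℝ) : dir i a ≠ 0 := fun hc => by
  simpa [dir] using congrFun hc i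

lemma dir_rev (i : Fin 2) (a : ℝ) : dir i a i.rev = a := by
  fin_cases i <;> simp [dir, Fin.rev]

lemma dir_self (i : Fin 2) (a : ℝ) : dir i a i = 1 := by simp [dir]

lemma eq_dir {i : Fin 2} {m : Fin 2 → ℝ} (h : m i ≠ 0) : m = m i • dir i (m i.rev / m i) := by
  ext k
  fin_cases i <;> fin_cases k <;> simp_all [dir, Fin.rev] <;> field_simp

namespace Prolongation

variable (h : IsHyperbolic s I)

/-- The base point of an integral element; this is the projection `π : N^{[1]} → N`. -/
def base (q : Prolongation h) : N := q.1.1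

/-- The plane of an integral element. -/
def plane (q : Prolongation h) : Submodule ℝ (Tan E (q.base h)) := q.1.2

/-- The data on which a chart of the prolongation space depends: an adapted coframe `c` on an open
set `U`, the choice of two of its members `σ̂ⁱ`, `σ̌ʲ`, and a point (which selects a chart of `N`). -/
structure ChartData where
  U : Set N
  isOpen : IsOpen U
  c : AdaptedCoframe s I U
  i : Fin 2
  j : Fin 2
  q₀ : Prolongation h

variable {h}

namespace ChartData

variable (d : ChartData h)

/-- The chart of `N` used. -/
def φ : OpenPartialHomeomorph N E := chartAt E d.q₀.1.1

/-- The integral element over `x ∈ U` with coordinates `a, b`. -/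
def elt {x : N} (hx : x ∈ d.U) (a b : ℝ) : Prolongation h :=
  ⟨⟨x, (d.c.adapted x hx).plane (dir d.i a) (dir d.j b)⟩,
    have : FiniteDimensional ℝ (Tan E x) := inferInstanceAs (FiniteDimensional ℝ E)
    (d.c.adapted x hx).regular_plane (dir_ne_zero _ _) (dir_ne_zero _ _)⟩

/-- The inverse of the chart below. -/
def inv (p : E × ℝ × ℝ) : Prolongation h :=
  open Classical in if hx : d.φ.symm p.1 ∈ d.U then d.elt hx p.2.1 p.2.2 else d.q₀

lemma inv_eq {p : E × ℝ × ℝ} (hx : d.φ.symm p.1 ∈ d.U) : d.inv p = d.elt hx p.2.1 p.2.2 :=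
  dif_pos hx

lemma inv_eq_of_eq {p : E × ℝ × ℝ} {x : N} (hx : x ∈ d.U) (he : d.φ.symm p.1 = x) :
    d.inv p = d.elt hx p.2.1 p.2.2 := by
  subst he
  exact d.inv_eq hx

/-- The coordinate `a` of `(x, P)`. -/
def hatSlope (q : Prolongation h) : ℝ :=
  slope q.1.2 (d.c.σhat d.i q.1.1) (d.c.σhat d.i.rev q.1.1)

/-- The coordinate `b` of `(x, P)`. -/
def chkSlope (q : Prolongation h) : ℝ :=
  slope q.1.2 (d.c.σchk d.j q.1.1) (d.c.σchk d.j.rev q.1.1)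

/-- The integral elements on which `σ̂ⁱ` and `σ̌ʲ` do not vanish. -/
def Good (q : Prolongation h) : Prop :=
  (∃ v ∈ q.1.2, d.c.σhat d.i q.1.1 v ≠ 0) ∧ (∃ v ∈ q.1.2, d.c.σchk d.j q.1.1 v ≠ 0)

lemma good_elt {x : N} (hx : x ∈ d.U) (a b : ℝ) : d.Good (d.elt hx a b) := by
  refine ⟨⟨(d.c.adapted x hx).vec (dir d.i a) 0,
      Submodule.subset_span (R := ℝ) (M := Tan E x) (Or.inl rfl), ?_⟩,
    ⟨(d.c.adapted x hx).vec 0 (dir d.j b),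
      Submodule.subset_span (R := ℝ) (M := Tan E x) (Or.inr rfl), ?_⟩⟩
  · exact ne_of_eq_of_ne ((d.c.adapted x hx).σhat_vec _ _ d.i)
      (by rw [dir_self]; exact one_ne_zero)
  · exact ne_of_eq_of_ne ((d.c.adapted x hx).σchk_vec _ _ d.j)
      (by rw [dir_self]; exact one_ne_zero)

lemma rel_elt {x : N} (hx : x ∈ d.U) (a b : ℝ) :
    ∀ v ∈ (d.c.adapted x hx).plane (dir d.i a) (dir d.j b),
      d.c.σhat d.i.rev x v = a * d.c.σhat d.i x v ∧
      d.c.σchk d.j.rev x v = b * d.c.σchk d.j x v := by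
  intro v hv
  obtain ⟨r, t, rfl⟩ := (d.c.adapted x hx).mem_plane.1 hv
  have h1 := fun k => (d.c.adapted x hx).σhat_vec (r • dir d.i a) (t • dir d.j b) k
  have h2 := fun k => (d.c.adapted x hx).σchk_vec (r • dir d.i a) (t • dir d.j b) k
  beta_reduce at h1 h2
  rw [h1, h1, h2, h2]
  simp only [Pi.smul_apply, smul_eq_mul, dir_self, dir_rev]
  constructor <;> ring

lemma slope_eq {V : Type*} [AddCommGroup V] [Module ℝ V] [TopologicalSpace V]
    {P : Submodule ℝ V} {α β : V →L[ℝ] ℝ} {a : ℝ} (h1 : ∀ v ∈ P, β v = a * α v)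
    (h2 : ∃ v ∈ P, α v ≠ 0) : slope P α β = a := by
  obtain ⟨v, hv, hv0, hs⟩ := slope_spec (β := β) h2
  rw [hs, h1 v hv]
  field_simp

lemma hatSlope_elt {x : N} (hx : x ∈ d.U) (a b : ℝ) : d.hatSlope (d.elt hx a b) = a :=
  slope_eq (fun v hv => (d.rel_elt hx a b v hv).1) (d.good_elt hx a b).1

lemma chkSlope_elt {x : N} (hx : x ∈ d.U) (a b : ℝ) : d.chkSlope (d.elt hx a b) = b :=
  slope_eq (fun v hv => (d.rel_elt hx a b v hv).2) (d.good_elt hx a b).2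

lemma eq_elt {q : Prolongation h} (hx : q.1.1 ∈ d.U) (hq : d.Good q) :
    q = d.elt hx (d.hatSlope q) (d.chkSlope q) := by
  have key : ∃ a b, q = d.elt hx a b := by
    obtain ⟨⟨x, P⟩, hP⟩ := q
    obtain ⟨m, n, hm, hn, hPe⟩ := (d.c.adapted x hx).exists_plane hP.integral hP.finrank_eq
    obtain ⟨⟨v, hv, hv0⟩, ⟨w, hw, hw0⟩⟩ := hq
    dsimp only at hx hv hv0 hw hw0 hPe
    subst hPe
    obtain ⟨r, t, rfl⟩ := (d.c.adapted x hx).mem_plane.1 hv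
    obtain ⟨r', t', rfl⟩ := (d.c.adapted x hx).mem_plane.1 hw
    have e1 := (d.c.adapted x hx).σhat_vec (r • m) (t • n) d.i
    have e2 := (d.c.adapted x hx).σchk_vec (r' • m) (t' • n) d.j
    beta_reduce at e1 e2
    rw [e1] at hv0
    rw [e2] at hw0
    have hmi : m d.i ≠ 0 := right_ne_zero_of_mul hv0
    have hnj : n d.j ≠ 0 := right_ne_zero_of_mul hw0
    refine ⟨m d.i.rev / m d.i, n d.j.rev / n d.j, ?_⟩
    apply Subtype.ext
    show (⟨x, _⟩ : Σ x : N, Submodule ℝ (Tan E x)) = ⟨x, _⟩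
    congr 1
    symm
    have hle : (d.c.adapted x hx).plane (dir d.i (m d.i.rev / m d.i))
        (dir d.j (n d.j.rev / n d.j)) ≤ (d.c.adapted x hx).plane m n := by
      intro u hu
      obtain ⟨r, t, rfl⟩ := (d.c.adapted x hx).mem_plane.1 hu
      refine (d.c.adapted x hx).mem_plane.2 ⟨r / m d.i, t / n d.j, ?_⟩
      have e3 : ∀ {c r : ℝ} {m' l : Fin 2 → ℝ}, c ≠ 0 → m' = c • l → r • l = (r / c) • m' := by
        intro c r m' l hc hl
        rw [hl, smul_smul, div_mul_cancel₀ _ hc]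
      rw [← e3 hmi (eq_dir hmi), ← e3 hnj (eq_dir hnj)]
    have : FiniteDimensional ℝ ((d.c.adapted x hx).plane m n) :=
      Module.finite_of_finrank_pos (by rw [(d.c.adapted x hx).finrank_plane hm hn]; omega)
    exact Submodule.eq_of_le_of_finrank_eq hle (by
      rw [(d.c.adapted x hx).finrank_plane hm hn,
        (d.c.adapted x hx).finrank_plane (dir_ne_zero _ _) (dir_ne_zero _ _)])
  obtain ⟨a, b, he⟩ := key
  have h1 : d.hatSlope q = a := by rw [he]; exact d.hatSlope_elt hx a b
  have h2 : d.chkSlope q = b := by rw [he]; exact d.chkSlope_elt hx a b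
  rw [h1, h2]
  exact he

/-- The chart `(x, P) ↦ (φ x, a, b)` of the prolongation space, defined where `σ̂ⁱ`, `σ̌ʲ` do not
vanish on `P`; here `φ` is a chart of `N`, and `a`, `b` are the numbers with `σ̂ⁱ' = a σ̂ⁱ` and
`σ̌ʲ' = b σ̌ʲ` on `P`, where `{i, i'} = {j, j'} = {1, 2}`. -/
def chart : PartialEquiv (Prolongation h) (E × ℝ × ℝ) where
  toFun q := (d.φ q.1.1, d.hatSlope q, d.chkSlope q)
  invFun := d.inv
  source := {q | q.1.1 ∈ d.φ.source ∧ q.1.1 ∈ d.U ∧ d.Good q}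
  target := {p | p.1 ∈ d.φ.target ∧ d.φ.symm p.1 ∈ d.U}
  map_source' := by
    rintro q ⟨h1, h2, -⟩
    refine ⟨d.φ.map_source h1, ?_⟩
    show d.φ.symm (d.φ q.1.1) ∈ d.U
    rwa [d.φ.left_inv h1]
  map_target' := by
    rintro ⟨y, a, b⟩ ⟨h1, h2⟩
    rw [d.inv_eq h2]
    exact ⟨d.φ.map_target h1, h2, d.good_elt h2 a b⟩
  left_inv' := by
    rintro q ⟨h1, h2, h3⟩
    rw [d.inv_eq_of_eq h2 (d.φ.left_inv h1)]
    exact (d.eq_elt h2 h3).symm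
  right_inv' := by
    rintro ⟨y, a, b⟩ ⟨h1, h2⟩
    rw [d.inv_eq h2, d.hatSlope_elt, d.chkSlope_elt]
    show (d.φ (d.φ.symm y), a, b) = (y, a, b)
    rw [d.φ.right_inv h1]

lemma φ_mem : d.φ ∈ atlas E N := chart_mem_atlas E _

/-- The coframe in the chart `φ`. -/
def frame (y : E) : E →L[ℝ] (Fin s → ℝ) × (Fin 2 → ℝ) × (Fin 2 → ℝ) :=
  (ContinuousLinearMap.pi fun e => localRep (d.c.θ e) d.φ y).prod
    ((ContinuousLinearMap.pi fun a => localRep (d.c.σhat a) d.φ y).prod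
      (ContinuousLinearMap.pi fun a => localRep (d.c.σchk a) d.φ y))

lemma contDiffAt_localRep {θ : OneForm E N} {U : Set N} (hU : IsOpen U) (hθ : SmoothOn θ U)
    {y : E} (hy : y ∈ d.φ.target) (hyU : d.φ.symm y ∈ U) :
    ContDiffAt ℝ ∞ (localRep θ d.φ) y :=
  (hθ d.φ d.φ_mem).contDiffAt ((d.φ.isOpen_inter_preimage_symm hU).mem_nhds ⟨hy, hyU⟩)

lemma contDiffAt_frame {y : E} (hy : y ∈ d.φ.target) (hyU : d.φ.symm y ∈ d.U) :
    ContDiffAt ℝ ∞ d.frame y := by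
  have hO := d.φ.isOpen_inter_preimage_symm d.isOpen
  have key : ∀ {k : ℕ} (τ : Fin k → OneForm E N), (∀ e, SmoothOn (τ e) d.U) → ∀ w : E,
      ContDiffOn ℝ ∞ (fun y e => localRep (τ e) d.φ y w) (d.φ.target ∩ d.φ.symm ⁻¹' d.U) :=
    fun τ hτ w => contDiffOn_pi.2 fun e => (hτ e d.φ d.φ_mem).clm_apply contDiffOn_const
  have h1 : ∀ w : E, ContDiffOn ℝ ∞ (fun y => d.frame y w)
      (d.φ.target ∩ d.φ.symm ⁻¹' d.U) := fun w =>
    (key _ d.c.smooth_θ w).prodMk ((key _ d.c.smooth_σhat w).prodMk (key _ d.c.smooth_σchk w))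
  exact (contDiffOn_clm_apply.2 h1).contDiffAt (hO.mem_nhds ⟨hy, hyU⟩)

variable [IsManifold 𝓘(ℝ, E) ∞ N]

/-- The differential of the inverse chart. -/
def dφ (y : E) : E →L[ℝ] Tan E (d.φ.symm y) := mfderiv 𝓘(ℝ, E) 𝓘(ℝ, E) d.φ.symm y

lemma dφ_bijective {y : E} (hy : y ∈ d.φ.target) : Function.Bijective (d.dφ y) := by
  have : IsManifold 𝓘(ℝ, E) 1 N := IsManifold.of_le (n := ∞) (by norm_num)
  exact (mdifferentiable_of_mem_atlas (I := 𝓘(ℝ, E)) d.φ_mem).symm.mfderiv_bijective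
    (x := y) hy

lemma frame_invertible {y : E} (hy : y ∈ d.φ.target) (hyU : d.φ.symm y ∈ d.U) :
    (d.frame y).IsInvertible := by
  have hb : Function.Bijective (d.frame y) :=
    (d.c.adapted _ hyU).coframe.comp (d.dφ_bijective hy)
  exact ⟨(LinearEquiv.ofBijective (d.frame y : E →ₗ[ℝ] _) hb).toContinuousLinearEquiv, by
    ext1 v; rfl⟩

/-- Coordinates of the vector with given components in the coframe. -/
def vecRep (y : E) (m n : Fin 2 → ℝ) : E := (d.frame y).inverse (0, m, n)

lemma dφ_vecRep {y : E} (hy : y ∈ d.φ.target) (hyU : d.φ.symm y ∈ d.U) (m n : Fin 2 → ℝ) :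
    d.dφ y (d.vecRep y m n) = (d.c.adapted _ hyU).vec m n := by
  apply (d.c.adapted _ hyU).ev.injective
  rw [IsAdapted.ev_vec]
  exact (d.frame_invertible hy hyU).self_apply_inverse (0, m, n)

/-- The value of a 1-form on a vector with given components in the coframe. -/
def val (α : OneForm E N) (y : E) (m n : Fin 2 → ℝ) : ℝ := localRep α d.φ y (d.vecRep y m n)

lemma val_eq (α : OneForm E N) {y : E} (hy : y ∈ d.φ.target) (hyU : d.φ.symm y ∈ d.U)
    (m n : Fin 2 → ℝ) : d.val α y m n = α (d.φ.symm y) ((d.c.adapted _ hyU).vec m n) := by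
  rw [← d.dφ_vecRep hy hyU]
  rfl

lemma contDiffAt_dir (i : Fin 2) {f : E × ℝ × ℝ → ℝ} {p : E × ℝ × ℝ} (hf : ContDiffAt ℝ ∞ f p) :
    ContDiffAt ℝ ∞ (fun p => dir i (f p)) p := by
  refine contDiffAt_pi.2 fun k => ?_
  by_cases hk : k = i
  · simpa [dir, hk] using contDiffAt_const
  · simpa [dir, hk] using hf

lemma contDiffAt_val {α : OneForm E N} {U : Set N} (hU : IsOpen U) (hα : SmoothOn α U)
    {p : E × ℝ × ℝ} (hy : p.1 ∈ d.φ.target) (hyU : d.φ.symm p.1 ∈ d.U)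
    (hyU' : d.φ.symm p.1 ∈ U) {m n : E × ℝ × ℝ → Fin 2 → ℝ} (hm : ContDiffAt ℝ ∞ m p)
    (hn : ContDiffAt ℝ ∞ n p) : ContDiffAt ℝ ∞ (fun p => d.val α p.1 (m p) (n p)) p := by
  have h1 : ContDiffAt ℝ ∞ (fun p : E × ℝ × ℝ => localRep α d.φ p.1) p :=
    (d.contDiffAt_localRep hU hα hy hyU').comp p contDiffAt_fst
  have h2 : ContDiffAt ℝ ∞ (fun p : E × ℝ × ℝ => d.frame p.1) p :=
    (d.contDiffAt_frame hy hyU).comp p contDiffAt_fst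
  have : CompleteSpace E := FiniteDimensional.complete ℝ E
  have h3 : ContDiffAt ℝ ∞ (fun p : E × ℝ × ℝ => (d.frame p.1).inverse) p :=
    ContDiffAt.comp (g := ContinuousLinearMap.inverse) p
      (d.frame_invertible hy hyU).contDiffAt_map_inverse h2
  exact h1.clm_apply (h3.clm_apply (contDiffAt_const.prodMk (hm.prodMk hn)))

/-- A 1-form does not vanish on the plane with coordinates `p`. -/
lemma exists_ne_iff (α : OneForm E N) {p : E × ℝ × ℝ} (hy : p.1 ∈ d.φ.target)
    (hyU : d.φ.symm p.1 ∈ d.U) :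
    (∃ v ∈ (d.inv p).1.2, α (d.inv p).1.1 v ≠ 0) ↔
      d.val α p.1 (dir d.i p.2.1) 0 ≠ 0 ∨ d.val α p.1 0 (dir d.j p.2.2) ≠ 0 := by
  rw [d.inv_eq hyU, d.val_eq α hy hyU, d.val_eq α hy hyU]
  have aux : ∀ v : Tan E (d.φ.symm p.1),
      v ∈ (d.c.adapted _ hyU).plane (dir d.i p.2.1) (dir d.j p.2.2) →
      α (d.φ.symm p.1) v ≠ 0 →
      α (d.φ.symm p.1) ((d.c.adapted _ hyU).vec (dir d.i p.2.1) 0) ≠ 0 ∨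
      α (d.φ.symm p.1) ((d.c.adapted _ hyU).vec 0 (dir d.j p.2.2)) ≠ 0 := by
    intro v hv hne
    by_contra! hc
    apply hne
    obtain ⟨a, b, hab⟩ := Submodule.mem_span_pair.1 hv
    rw [← hab, map_add, map_smul, map_smul, hc.1, hc.2]
    simp
  constructor
  · rintro ⟨v, hv, hne⟩
    exact aux v hv hne
  · rintro (hv | hv)
    · exact ⟨_, Submodule.subset_span (R := ℝ) (M := Tan E (d.φ.symm p.1)) (Or.inl rfl), hv⟩
    · exact ⟨_, Submodule.subset_span (R := ℝ) (M := Tan E (d.φ.symm p.1)) (Or.inr rfl), hv⟩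

lemma isOpen_target : IsOpen {p : E × ℝ × ℝ | p.1 ∈ d.φ.target ∧ d.φ.symm p.1 ∈ d.U} :=
  (d.φ.isOpen_inter_preimage_symm d.isOpen).preimage continuous_fst

lemma base_inv {p : E × ℝ × ℝ} (hyU : d.φ.symm p.1 ∈ d.U) : (d.inv p).1.1 = d.φ.symm p.1 := by
  rw [d.inv_eq hyU]
  rfl

lemma isOpen_ne (α : OneForm E N) {U : Set N} (hU : IsOpen U) (hα : SmoothOn α U) :
    ∀ p : E × ℝ × ℝ, p.1 ∈ d.φ.target → d.φ.symm p.1 ∈ d.U → d.φ.symm p.1 ∈ U →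
      (∃ v ∈ (d.inv p).1.2, α (d.inv p).1.1 v ≠ 0) →
      ∀ᶠ p' in 𝓝 p, ∃ v ∈ (d.inv p').1.2, α (d.inv p').1.1 v ≠ 0 := by
  intro p hy hyU hyU' hne
  have hev := d.isOpen_target.mem_nhds (x := p) ⟨hy, hyU⟩
  rw [d.exists_ne_iff α hy hyU] at hne
  have hc1 := (d.contDiffAt_val hU hα hy hyU hyU'
    (contDiffAt_dir d.i (contDiffAt_fst.comp p contDiffAt_snd))
    (contDiffAt_const (c := (0 : Fin 2 → ℝ)))).continuousAt
  have hc2 := (d.contDiffAt_val hU hα hy hyU hyU' (contDiffAt_const (c := (0 : Fin 2 → ℝ)))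
    (contDiffAt_dir d.j (contDiffAt_snd.comp p contDiffAt_snd))).continuousAt
  rcases hne with h1 | h2
  · filter_upwards [hev, hc1.eventually_ne h1] with p' hp' h'
    exact (d.exists_ne_iff α hp'.1 hp'.2).2 (Or.inl h')
  · filter_upwards [hev, hc2.eventually_ne h2] with p' hp' h'
    exact (d.exists_ne_iff α hp'.1 hp'.2).2 (Or.inr h')

lemma mem_trans_source (d' : ChartData h) (p : E × ℝ × ℝ) :
    p ∈ (d.chart.symm.trans d'.chart).source ↔
      (p.1 ∈ d.φ.target ∧ d.φ.symm p.1 ∈ d.U) ∧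
      (d.inv p).1.1 ∈ d'.φ.source ∧ (d.inv p).1.1 ∈ d'.U ∧ d'.Good (d.inv p) := Iff.rfl

lemma isOpen_trans_source (d' : ChartData h) : IsOpen (d.chart.symm.trans d'.chart).source := by
  rw [isOpen_iff_mem_nhds]
  intro p hp
  rw [mem_trans_source] at hp
  obtain ⟨⟨hy, hyU⟩, h1, h2, h3, h4⟩ := hp
  rw [d.base_inv hyU] at h1 h2
  have e1 := d.isOpen_target.mem_nhds (x := p) ⟨hy, hyU⟩
  have e2 : ∀ᶠ p' : E × ℝ × ℝ in 𝓝 p, d.φ.symm p'.1 ∈ d'.φ.source ∩ d'.U := by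
    have hc : ContinuousAt (fun p' : E × ℝ × ℝ => d.φ.symm p'.1) p :=
      ContinuousAt.comp (g := d.φ.symm) (d.φ.continuousAt_symm hy) continuousAt_fst
    exact hc ((d'.φ.open_source.inter d'.isOpen).mem_nhds ⟨h1, h2⟩)
  filter_upwards [e1, e2, d.isOpen_ne _ d'.isOpen (d'.c.smooth_σhat d'.i) p hy hyU h2 h3,
    d.isOpen_ne _ d'.isOpen (d'.c.smooth_σchk d'.j) p hy hyU h2 h4] with p' f1 f2 f3 f4
  rw [mem_trans_source, d.base_inv f1.2]
  exact ⟨f1, f2.1, f2.2, f3, f4⟩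

/-- Smoothness of a slope in a chart. -/
lemma contDiffAt_slope (α β : OneForm E N) {U : Set N} (hU : IsOpen U) (hα : SmoothOn α U)
    (hβ : SmoothOn β U) (S : Set (E × ℝ × ℝ)) (hS : IsOpen S) {p : E × ℝ × ℝ} (hp : p ∈ S)
    (hS1 : ∀ p ∈ S, p.1 ∈ d.φ.target ∧ d.φ.symm p.1 ∈ d.U ∧ d.φ.symm p.1 ∈ U)
    (hS2 : ∀ p ∈ S, ∃ v ∈ (d.inv p).1.2, α (d.inv p).1.1 v ≠ 0)
    (hS3 : ∀ p ∈ S, ∃ a : ℝ, ∀ v ∈ (d.inv p).1.2, β (d.inv p).1.1 v = a * α (d.inv p).1.1 v) :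
    ContDiffAt ℝ ∞ (fun p => slope (d.inv p).1.2 (α (d.inv p).1.1) (β (d.inv p).1.1)) p := by
  obtain ⟨hy, hyU, hyU'⟩ := hS1 p hp
  have key : ∀ (m n : E × ℝ × ℝ → Fin 2 → ℝ), ContDiffAt ℝ ∞ m p → ContDiffAt ℝ ∞ n p →
      (∀ p' (hp' : p' ∈ S), (d.c.adapted _ (hS1 p' hp').2.1).vec (m p') (n p') ∈
        (d.c.adapted _ (hS1 p' hp').2.1).plane (dir d.i p'.2.1) (dir d.j p'.2.2)) →
      d.val α p.1 (m p) (n p) ≠ 0 →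
      ContDiffAt ℝ ∞ (fun p => slope (d.inv p).1.2 (α (d.inv p).1.1) (β (d.inv p).1.1)) p := by
    intro m n hm hn hmem hne
    have c1 := d.contDiffAt_val hU hα hy hyU hyU' hm hn
    have c2 := d.contDiffAt_val hU hβ hy hyU hyU' hm hn
    refine (c2.div c1 hne).congr_of_eventuallyEq ?_
    filter_upwards [hS.mem_nhds hp, c1.continuousAt.eventually_ne hne] with p' hp' hne'
    obtain ⟨a, ha⟩ := hS3 p' hp'
    rw [slope_eq ha (hS2 p' hp')]
    have hmem' := hmem p' hp'
    obtain ⟨hy1, hy2, -⟩ := hS1 p' hp'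
    rw [d.inv_eq hy2] at ha
    have := ha _ hmem'
    show a = d.val β p'.1 (m p') (n p') / d.val α p'.1 (m p') (n p')
    rw [eq_div_iff hne', d.val_eq α hy1 hy2, d.val_eq β hy1 hy2]
    exact this.symm
  rcases (d.exists_ne_iff α hy hyU).1 (hS2 p hp) with h1 | h2
  · exact key (fun p => dir d.i p.2.1) (fun _ => 0)
      (contDiffAt_dir d.i (contDiffAt_fst.comp p contDiffAt_snd)) contDiffAt_const
      (fun p' hp' => Submodule.subset_span (R := ℝ) (M := Tan E (d.φ.symm p'.1)) (Or.inl rfl)) h1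
  · exact key (fun _ => 0) (fun p => dir d.j p.2.2) contDiffAt_const
      (contDiffAt_dir d.j (contDiffAt_snd.comp p contDiffAt_snd))
      (fun p' hp' => Submodule.subset_span (R := ℝ) (M := Tan E (d.φ.symm p'.1)) (Or.inr rfl)) h2

lemma rel_of_good {q : Prolongation h} (hx : q.1.1 ∈ d.U) (hq : d.Good q) :
    (∃ a : ℝ, ∀ v ∈ q.1.2, d.c.σhat d.i.rev q.1.1 v = a * d.c.σhat d.i q.1.1 v) ∧
    (∃ b : ℝ, ∀ v ∈ q.1.2, d.c.σchk d.j.rev q.1.1 v = b * d.c.σchk d.j q.1.1 v) := by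
  have he := d.eq_elt hx hq
  generalize d.hatSlope q = a at he
  generalize d.chkSlope q = b at he
  generalize hx' : q.1.1 = x at hx he
  have hx0 : x ∈ d.U := hx
  rw [he]
  exact ⟨⟨a, fun v hv => (d.rel_elt hx0 a b v hv).1⟩, ⟨b, fun v hv => (d.rel_elt hx0 a b v hv).2⟩⟩

/-- The transition maps between the charts of the prolongation space are smooth. -/
lemma contDiffOn_trans (d' : ChartData h) :
    ContDiffOn ℝ ∞ (d.chart.symm.trans d'.chart) (d.chart.symm.trans d'.chart).source := by
  intro p hp
  refine ContDiffAt.contDiffWithinAt ?_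
  have hS := d.isOpen_trans_source d'
  have hmem := fun p' => (d.mem_trans_source d' p').1
  have hS1 : ∀ p' ∈ (d.chart.symm.trans d'.chart).source,
      p'.1 ∈ d.φ.target ∧ d.φ.symm p'.1 ∈ d.U ∧ d.φ.symm p'.1 ∈ d'.U := by
    intro p' hp'
    have h1 := hmem p' hp'
    exact ⟨h1.1.1, h1.1.2, by rw [← d.base_inv h1.1.2]; exact h1.2.2.1⟩
  have t1 : ContDiffAt ℝ ∞ (fun p : E × ℝ × ℝ => d'.φ (d.inv p).1.1) p := by
    have h1 := hmem p hp
    have hd : (d.φ.symm.trans d'.φ) ∈ contDiffGroupoid ∞ 𝓘(ℝ, E) :=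
      (contDiffGroupoid ∞ 𝓘(ℝ, E)).compatible d.φ_mem d'.φ_mem
    rw [contDiffGroupoid, mem_groupoid_of_pregroupoid] at hd
    have hd1 : ContDiffOn ℝ ∞ (d.φ.symm.trans d'.φ) (d.φ.symm.trans d'.φ).source := by
      simpa [contDiffPregroupoid] using hd.1
    have hps : p.1 ∈ (d.φ.symm.trans d'.φ).source :=
      ⟨h1.1.1, by
        show d.φ.symm p.1 ∈ d'.φ.source
        rw [← d.base_inv h1.1.2]; exact h1.2.1⟩
    have hd2 : ContDiffAt ℝ ∞ (fun p : E × ℝ × ℝ => d'.φ (d.φ.symm p.1)) p :=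
      (hd1.contDiffAt ((d.φ.symm.trans d'.φ).open_source.mem_nhds hps)).comp p contDiffAt_fst
    refine hd2.congr_of_eventuallyEq ?_
    filter_upwards [d.isOpen_target.mem_nhds h1.1] with p' hp'
    rw [d.base_inv hp'.2]
  have t2 : ContDiffAt ℝ ∞ (fun p : E × ℝ × ℝ => d'.hatSlope (d.inv p)) p :=
    d.contDiffAt_slope _ _ d'.isOpen (d'.c.smooth_σhat d'.i) (d'.c.smooth_σhat d'.i.rev) _ hS hp
      hS1 (fun p' hp' => (hmem p' hp').2.2.2.1)
      (fun p' hp' => (d'.rel_of_good (hmem p' hp').2.2.1 (hmem p' hp').2.2.2).1)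
  have t3 : ContDiffAt ℝ ∞ (fun p : E × ℝ × ℝ => d'.chkSlope (d.inv p)) p :=
    d.contDiffAt_slope _ _ d'.isOpen (d'.c.smooth_σchk d'.j) (d'.c.smooth_σchk d'.j.rev) _ hS hp
      hS1 (fun p' hp' => (hmem p' hp').2.2.2.2)
      (fun p' hp' => (d'.rel_of_good (hmem p' hp').2.2.1 (hmem p' hp').2.2.2).2)
  exact t1.prodMk (t2.prodMk t3)

end ChartData

/-- Every integral element lies in the domain of a chart. -/
lemma exists_chartData (q : Prolongation h) : ∃ d : ChartData h, q ∈ d.chart.source := by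
  obtain ⟨U, hU, hx, ⟨c⟩⟩ := h.exists_coframe q.1.1
  obtain ⟨m, n, hm, hn, hP⟩ := (c.adapted _ hx).exists_plane q.2.integral q.2.finrank_eq
  have key : ∀ {m : Fin 2 → ℝ}, m ≠ 0 → ∃ i, m i ≠ 0 := fun hm => by
    rcases IsAdapted.ne_zero_cases hm with h0 | h1
    exacts [⟨0, h0⟩, ⟨1, h1⟩]
  obtain ⟨i, hi⟩ := key hm
  obtain ⟨j, hj⟩ := key hn
  refine ⟨⟨U, hU, c, i, j, q⟩, mem_chart_source E q.1.1, hx,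
    ⟨(c.adapted _ hx).vec m 0, ?_, ?_⟩, ⟨(c.adapted _ hx).vec 0 n, ?_, ?_⟩⟩
  · rw [hP]; exact Submodule.subset_span (Or.inl rfl)
  · exact ne_of_eq_of_ne ((c.adapted _ hx).σhat_vec m 0 i) hi
  · rw [hP]; exact Submodule.subset_span (Or.inr rfl)
  · exact ne_of_eq_of_ne ((c.adapted _ hx).σchk_vec 0 n j) hj

variable [IsManifold 𝓘(ℝ, E) ∞ N]

variable (h) in
/-- The atlas of the prolongation space consisting of all the charts above. -/
def core : ChartedSpaceCore (E × ℝ × ℝ) (Prolongation h) where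
  atlas := Set.range ChartData.chart
  chartAt q := (exists_chartData q).choose.chart
  mem_chart_source q := (exists_chartData q).choose_spec
  chart_mem_atlas q := ⟨_, rfl⟩
  open_source := by
    rintro _ _ ⟨d, rfl⟩ ⟨d', rfl⟩
    exact d.isOpen_trans_source d'
  continuousOn_toFun := by
    rintro _ _ ⟨d, rfl⟩ ⟨d', rfl⟩
    exact (d.contDiffOn_trans d').continuousOn

instance : TopologicalSpace (Prolongation h) := (core h).toTopologicalSpace

instance : ChartedSpace (E × ℝ × ℝ) (Prolongation h) := (core h).toChartedSpace

/-- The prolongation space is a smooth manifold, of dimension `dim N + 2`. -/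
instance : IsManifold 𝓘(ℝ, E × ℝ × ℝ) ∞ (Prolongation h) := by
  refine isManifold_of_contDiffOn _ _ _ ?_
  intro e e' he he'
  have key : ∀ e ∈ atlas (E × ℝ × ℝ) (Prolongation h), ∃ (d : ChartData h)
      (hd : d.chart ∈ (core h).atlas), e = (core h).openPartialHomeomorph d.chart hd := by
    intro e he
    have he' : e ∈ ⋃ (e : PartialEquiv (Prolongation h) (E × ℝ × ℝ)) (he : e ∈ (core h).atlas),
      {(core h).openPartialHomeomorph e he} := he
    rw [Set.mem_iUnion₂] at he'
    obtain ⟨e₀, he₀, he₁⟩ := he'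
    obtain ⟨d, rfl⟩ := id he₀
    exact ⟨d, he₀, he₁⟩
  obtain ⟨d, hd, rfl⟩ := key e he
  obtain ⟨d', hd', rfl⟩ := key e' he'
  have := d.contDiffOn_trans d'
  simp only [modelWithCornersSelf_coe, modelWithCornersSelf_coe_symm, Set.range_id,
    Set.inter_univ, Set.preimage_id, Function.comp_id, Function.id_comp]
  exact this

/-- The canonical contact Pfaffian system on the prolongation space: at `q = (x, P)` it consists of
the pull-backs by the projection of the covectors at `x` which vanish on `P`. -/
def contact (q : Prolongation h) : Submodule ℝ (Cot (E × ℝ × ℝ) q) :=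
  Submodule.map (pullCov (dmap (E × ℝ × ℝ) E (base h) q))
    ({ carrier := {α | ∀ v ∈ q.plane h, α v = 0}
       add_mem' := fun ha hb v hv => by simp [ha v hv, hb v hv]
       zero_mem' := fun v _ => by simp
       smul_mem' := fun c α hα v hv => by simp [hα v hv] } : Submodule ℝ (Cot E (q.base h)))

variable (h) in
/-- The prolongation `I^{[1]}`: the differential ideal generated by the (smooth sections of the)
contact system. -/
def system : FormIdeal (E × ℝ × ℝ) (Prolongation h) := fun q =>
  Ideal.span ((form1 '' (contact q : Set (Cot (E × ℝ × ℝ) q))) ∪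
    {η | ∃ (O : Set (Prolongation h)) (θ : OneForm (E × ℝ × ℝ) (Prolongation h)),
      IsOpen O ∧ q ∈ O ∧ SmoothOn θ O ∧ (∀ q' ∈ O, θ q' ∈ contact q') ∧ η = extD θ q})

end Prolongation

end Prolongation

end Manifold

end EDS

end

noncomputable section

namespace EDS

/-! ### Exterior algebra at a point: evaluation of 2-forms and ideals generated by covectors. -/

section LinearAlgebra

variable {V W : Type*} [AddCommGroup V] [Module ℝ V] [TopologicalSpace V]
  [AddCommGroup W] [Module ℝ W] [TopologicalSpace W]

/-! Everything rests on the normal form of 2-dimensional integral elements of a hyperbolic ideal: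
such a plane is spanned by one vector on which `θ` and `σ̌` vanish and one on which `θ` and `σ̂`
vanish. Over an adapted coframe it is therefore described by two slopes `a`, `b`, with `σ̂ⁱ' = a
σ̂ⁱ` and `σ̌ʲ' = b σ̌ʲ` on `P`, and `(x, a, b)` are coordinates on the prolongation space.

Structure of the prolongation. The contact forms are the `θᵉ`, `σ̂ⁱ' - a σ̂ⁱ` and `σ̌ʲ' - b σ̌ʲ`.
Modulo these, every 2-form pulled back from the base is a multiple of `σ̂ⁱ ∧ σ̌ʲ`. Hence `d(σ̂ⁱ' - a
σ̂ⁱ) ≡ σ̂ⁱ ∧ (da + T σ̌ʲ)`, symmetrically for `σ̌`, and `dθᵉ ≡ 0` because `P` is an integral element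
(`extD_con_sub_mem`, `pull_mem_contactIdeal`). This exhibits an adapted coframe, so the prolongation
of class `s` is of class `s + 2` (`system_eq_alg`, `isHyperbolic_system`).

Extensions. The bundle `J` of an integrable extension with 1-dimensional fibres is a line bundle,
since it restricts faithfully to the kernel line. An adapted coframe downstairs pulls back and,
completed by a generator of `J`, is adapted upstairs (`IsAdapted.pullback`); thus `B` has class 2.
In such matching coframes the map `(x, P) ↦ (p x, p_* P)` leaves both slopes unchanged. It is
therefore a smooth submersion whose kernel projects isomorphically onto that of `dp`, the bundle
`π^* J` complements it, and the contact forms together with their differentials upstairs come from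
`π^* J` and from downstairs (`isIntegrableExtension_prolongMap`).

Wave equation. Here `σ̂ = (dp, dx)` and `σ̌ = (dq, dy)` are exact, so `T = 0`. Testing `d(df) = 0`
on characteristic vectors shows that the first integrals of the prolonged hat system are spanned by
`dp`, `dx`, `da` (`firstIntegrals_wave`), and Darboux integrability is linear algebra.

The second equation. On the 7-dimensional prolongation the singular systems have rank 5 and meet in
the contact system. If the rank 2 bundles of first integrals meet the contact system trivially, then
`5 + 2 = 7` gives both sum conditions, and the two bundles meet trivially as well. That this holds
on an open dense set is `exists_isOpen_inf_contact`. A nonconstant first integral `f` of the base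
has a nonzero `σ̂ⁱ` component on a nonempty open part of any given open set, for otherwise `df`
would locally be a closed multiple of the contact form. On that part some first integral must vary
along the fibres of `π`: if none did, all would descend to first integrals of the base, where only
multiples of `df` are available, against rank 2. Then `df` and the new differential are independent
modulo contact forms on an open set. -/

lemma form1_add (α β : V →L[ℝ] ℝ) : form1 (α + β) = form1 α + form1 β := map_add _ _ _

lemma form1_sub (α β : V →L[ℝ] ℝ) : form1 (α - β) = form1 α - form1 β := map_sub _ _ _

lemma form1_smul (c : ℝ) (α : V →L[ℝ] ℝ) : form1 (c • α) = c • form1 α := map_smul _ _ _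

lemma form1_zero : form1 (0 : V →L[ℝ] ℝ) = 0 := map_zero _

lemma form1_sum {ι : Type*} (t : Finset ι) (α : ι → V →L[ℝ] ℝ) :
    form1 (∑ i ∈ t, α i) = ∑ i ∈ t, form1 (α i) := map_sum _ _ _

lemma form1_mul_self (α : V →L[ℝ] ℝ) : form1 α * form1 α = 0 := ExteriorAlgebra.ι_sq_zero _

lemma form1_mul_swap (α β : V →L[ℝ] ℝ) : form1 α * form1 β = -(form1 β * form1 α) :=
  eq_neg_of_add_eq_zero_left (ExteriorAlgebra.ι_add_mul_swap _ _)

lemma pull_smul (L : V →L[ℝ] W) (c : ℝ) (η : Ext W) : pull L (c • η) = c • pull L η :=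
  map_smul _ _ _

/-- The value of the degree two component of a form on a pair of vectors. -/
def ev2 (v w : V) : Ext V →ₗ[ℝ] ℝ :=
  ExteriorAlgebra.liftAlternating (R := ℝ) (fun i : ℕ => match i with
    | 2 => { toFun := fun m : Fin 2 → (V →L[ℝ] ℝ) => m 0 v * m 1 w - m 0 w * m 1 v
             map_update_add' := by
               intro _ m i x y
               fin_cases i <;> simp <;> ring
             map_update_smul' := by
               intro _ m i c x
               fin_cases i <;> simp <;> ring
             map_eq_zero_of_eq' := by
               intro m i j hm hij
               fin_cases i <;> fin_cases j <;> simp_all <;> ring }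
    | _ => 0)

lemma ev2_form1_mul (v w : V) (α β : V →L[ℝ] ℝ) :
    ev2 v w (form1 α * form1 β) = α v * β w - α w * β v := by
  have h2 : form1 α * form1 β = ExteriorAlgebra.ιMulti ℝ 2 ![α, β] := by
    simp [ExteriorAlgebra.ιMulti_apply]
  rw [h2, ev2, ExteriorAlgebra.liftAlternating_apply_ιMulti]
  simp

/-- The exterior ideal generated by covectors. -/
def covIdeal (S : Set (V →L[ℝ] ℝ)) : Ideal (Ext V) := Ideal.span (form1 '' S)

lemma form1_mem_covIdeal {S : Set (V →L[ℝ] ℝ)} {α : V →L[ℝ] ℝ}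
    (hα : α ∈ Submodule.span ℝ S) : form1 α ∈ covIdeal S := by
  induction hα using Submodule.span_induction with
  | mem x hx => exact Ideal.subset_span ⟨x, hx, rfl⟩
  | zero => rw [form1_zero]; exact zero_mem _
  | add x y _ _ hx hy => rw [form1_add]; exact add_mem hx hy
  | smul c x _ hx =>
    rw [form1_smul]
    exact Submodule.smul_of_tower_mem (S := ℝ) _ c hx

lemma smul_mem_ideal {K : Ideal (Ext V)} {η : Ext V} (c : ℝ) (h : η ∈ K) : c • η ∈ K :=
  Submodule.smul_of_tower_mem (S := ℝ) _ c h

/-- `Ideal` means left ideal here; anticommutation of covectors supplies the multiplication on the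
other side. -/
lemma mul_form1_mem {K : Ideal (Ext V)} {α : V →L[ℝ] ℝ} (β : V →L[ℝ] ℝ) (h : form1 α ∈ K) :
    form1 α * form1 β ∈ K := by
  rw [form1_mul_swap]
  exact neg_mem (Ideal.mul_mem_left _ _ h)

/-- Modulo the covectors vanishing on a plane spanned by vectors dual to `ω₁`, `ω₂`, the product
of two covectors is a multiple of `ω₁ ∧ ω₂`. -/
lemma form1_mul_sub_mem {K : Ideal (Ext V)} {ω₁ ω₂ : V →L[ℝ] ℝ} {e f : V}
    (h11 : ω₁ e = 1) (h12 : ω₁ f = 0) (h21 : ω₂ e = 0) (h22 : ω₂ f = 1)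
    (hK : ∀ α : V →L[ℝ] ℝ, α e = 0 → α f = 0 → form1 α ∈ K) (α β : V →L[ℝ] ℝ) :
    form1 α * form1 β - ev2 e f (form1 α * form1 β) • (form1 ω₁ * form1 ω₂) ∈ K := by
  -- Removing from a covector its components along `ω₁`, `ω₂` leaves one that vanishes on `e` and
  -- `f`. Modulo such covectors only the minor in front of `ω₁ ∧ ω₂` survives.
  have key : ∀ γ : V →L[ℝ] ℝ, form1 (γ - γ e • ω₁ - γ f • ω₂) ∈ K := fun γ =>
    hK _ (by simp [h11, h21]) (by simp [h12, h22])
  have hd : ∀ γ : V →L[ℝ] ℝ, form1 γ = form1 (γ - γ e • ω₁ - γ f • ω₂) +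
      (γ e • form1 ω₁ + γ f • form1 ω₂) := fun γ => by
    rw [form1_sub, form1_sub, form1_smul, form1_smul]; abel
  have h1 := mul_form1_mem β (key α)
  have h2 := Ideal.mul_mem_left K (α e • form1 ω₁ + α f • form1 ω₂) (key β)
  have h3 := add_mem h1 h2
  convert! h3 using 1
  rw [ev2_form1_mul]
  conv_lhs => rw [hd α, hd β]
  conv_rhs => rw [hd β]
  generalize form1 (α - α e • ω₁ - α f • ω₂) = A
  generalize form1 (β - β e • ω₁ - β f • ω₂) = B
  have e1 := form1_mul_swap ω₂ ω₁
  simp only [mul_add, add_mul, smul_mul_smul_comm, form1_mul_self, e1, smul_zero, smul_neg]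
  module

end LinearAlgebra

/-! ### Alternation of bilinear forms. -/

section Alternation

variable {E F : Type*} [NormedAddCommGroup E] [NormedSpace ℝ E] [FiniteDimensional ℝ E]
  [NormedAddCommGroup F] [NormedSpace ℝ F] [FiniteDimensional ℝ F]

/-- The 2-form obtained by alternating a bilinear form. -/
def alt (b : E →L[ℝ] E →L[ℝ] ℝ) : Ext E :=
  ∑ i, form1 (coordCov i : E →L[ℝ] ℝ) * form1 (b (Module.finBasis ℝ E i))

lemma sum_coordCov (v : E) : ∑ i, (coordCov i : E →L[ℝ] ℝ) v • Module.finBasis ℝ E i = v :=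
  (Module.finBasis ℝ E).sum_repr v

lemma cov_eq_sum (α : E →L[ℝ] ℝ) :
    α = ∑ i, α (Module.finBasis ℝ E i) • (coordCov i : E →L[ℝ] ℝ) := by
  ext v
  conv_lhs => rw [← sum_coordCov v]
  simp [mul_comm]

lemma alt_add (b b' : E →L[ℝ] E →L[ℝ] ℝ) : alt (b + b') = alt b + alt b' := by
  simp only [alt, add_apply, form1_add, mul_add, Finset.sum_add_distrib]

lemma alt_smul (c : ℝ) (b : E →L[ℝ] E →L[ℝ] ℝ) : alt (c • b) = c • alt b := by
  simp only [alt, smul_apply, form1_smul, mul_smul_comm, Finset.smul_sum]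

lemma alt_smulRight (α β : E →L[ℝ] ℝ) : alt (α.smulRight β) = form1 α * form1 β := by
  conv_rhs => rw [cov_eq_sum α]
  simp only [alt, ContinuousLinearMap.smulRight_apply, form1_smul, form1_sum, Finset.sum_mul,
    mul_smul_comm, smul_mul_assoc]

/-- Exchanging the two summation indices changes the sign of each wedge product but not its
coefficient, so the sum equals its own negative. This removes second derivatives from `extD_pb`. -/
lemma alt_eq_zero_of_symm {b : E →L[ℝ] E →L[ℝ] ℝ} (h : ∀ v w, b v w = b w v) : alt b = 0 := by
  have h1 : alt b = ∑ i, ∑ j, b (Module.finBasis ℝ E i) (Module.finBasis ℝ E j) •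
      (form1 (coordCov i : E →L[ℝ] ℝ) * form1 (coordCov j : E →L[ℝ] ℝ)) := by
    rw [alt]
    refine Finset.sum_congr rfl fun i _ => ?_
    conv_lhs => rw [cov_eq_sum (b (Module.finBasis ℝ E i))]
    simp only [form1_sum, form1_smul, Finset.mul_sum, mul_smul_comm]
  have h2 : alt b = -alt b := by
    conv_lhs => rw [h1, Finset.sum_comm]
    rw [h1, ← Finset.sum_neg_distrib]
    refine Finset.sum_congr rfl fun i _ => ?_
    rw [← Finset.sum_neg_distrib]
    refine Finset.sum_congr rfl fun j _ => ?_
    rw [h, form1_mul_swap, smul_neg]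
  have h3 : (2 : ℝ) • alt b = 0 := by
    rw [two_smul]
    exact add_eq_zero_iff_eq_neg.2 h2
  exact (smul_eq_zero.1 h3).resolve_left two_ne_zero

/-- The pulled-back form `b'` is prescribed by its values, so that the bilinear map produced by the
chain rule can be inserted in the shape in which it arises. -/
lemma pull_alt (L : E →L[ℝ] F) (b : F →L[ℝ] F →L[ℝ] ℝ) {b' : E →L[ℝ] E →L[ℝ] ℝ}
    (h : ∀ v w, b' v w = b (L v) (L w)) : pull L (alt b) = alt b' := by
  have hb : ∀ v, b' v = (b (L v)).comp L := fun v => by ext w; exact h v w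
  simp only [alt, map_sum, map_mul, pull_form1]
  have h1 : ∀ i, (coordCov i : F →L[ℝ] ℝ).comp L =
      ∑ k, (coordCov i : F →L[ℝ] ℝ) (L (Module.finBasis ℝ E k)) • (coordCov k : E →L[ℝ] ℝ) :=
    fun i => cov_eq_sum _
  simp only [h1, form1_sum, form1_smul, Finset.sum_mul, smul_mul_assoc]
  rw [Finset.sum_comm]
  refine Finset.sum_congr rfl fun k _ => ?_
  rw [hb]
  conv_rhs => rw [← sum_coordCov (L (Module.finBasis ℝ E k))]
  simp only [map_sum, map_smul, ContinuousLinearMap.finsetSum_comp,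
    ContinuousLinearMap.smul_comp, Finset.mul_sum, mul_smul_comm]

lemma ev2_alt (b : E →L[ℝ] E →L[ℝ] ℝ) (v w : E) : ev2 v w (alt b) = b v w - b w v := by
  simp only [alt, map_sum, ev2_form1_mul, Finset.sum_sub_distrib]
  have h : ∀ v w, ∑ i, (coordCov i : E →L[ℝ] ℝ) v * b (Module.finBasis ℝ E i) w = b v w := by
    intro v w
    conv_rhs => rw [← sum_coordCov v]
    simp only [map_sum, map_smul, sum_apply, smul_apply, smul_eq_mul]
  rw [h, h]

end Alternation

/-! ### Linear algebra of adapted coframes and uniqueness of the singular systems. -/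

section AdaptedAlgebra

variable {V : Type*} [AddCommGroup V] [Module ℝ V] [TopologicalSpace V]

/-- Duality for finitely many functionals: one that vanishes on their common kernel is a combination
of them. Membership in Pfaffian systems is tested on vectors by means of it. -/
lemma mem_span_range_iff {ι : Type*} [Finite ι] {τ : ι → (V →L[ℝ] ℝ)} {α : V →L[ℝ] ℝ} :
    α ∈ Submodule.span ℝ (Set.range τ) ↔ ∀ v, (∀ i, τ i v = 0) → α v = 0 := by
  constructor
  · intro h v hv
    induction h using Submodule.span_induction with
    | mem x hx => obtain ⟨i, rfl⟩ := hx; exact hv i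
    | zero => rfl
    | add x y _ _ hx hy => rw [add_apply, hx, hy, add_zero]
    | smul c x _ hx => rw [smul_apply, hx, smul_zero]
  · intro h
    have h1 : (α : V →ₗ[ℝ] ℝ) ∈ Submodule.span ℝ (Set.range fun i => (τ i : V →ₗ[ℝ] ℝ)) := by
      apply mem_span_of_iInf_ker_le_ker
      intro v hv
      simp only [Submodule.mem_iInf, LinearMap.mem_ker] at hv
      exact h v hv
    have : Fintype ι := Fintype.ofFinite ι
    obtain ⟨c, hc⟩ := (Submodule.mem_span_range_iff_exists_fun ℝ).1 h1
    refine (Submodule.mem_span_range_iff_exists_fun ℝ).2 ⟨c, ?_⟩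
    ext v
    have := LinearMap.congr_fun hc v
    simpa using this

lemma linearIndependent_of_dual {ι : Type*} [DecidableEq ι] {τ : ι → (V →L[ℝ] ℝ)} {v : ι → V}
    (h : ∀ i j, τ i (v j) = if i = j then 1 else 0) : LinearIndependent ℝ τ := by
  rw [linearIndependent_iff']
  intro s g hg i hi
  have h1 := congrArg (fun α : V →L[ℝ] ℝ => α (v i)) hg
  simpa [h, hi] using h1

namespace IsAdapted

variable {s : ℕ} {K : Ideal (Ext V)} {θ : Fin s → (V →L[ℝ] ℝ)} {σ τ : Fin 2 → (V →L[ℝ] ℝ)}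
  {θ' : Fin s → (V →L[ℝ] ℝ)} {σ' τ' : Fin 2 → (V →L[ℝ] ℝ)}

lemma swap (h : IsAdapted K θ σ τ) : IsAdapted K θ τ σ where
  coframe := by
    have e : Function.Bijective (Prod.map id Prod.swap :
        (Fin s → ℝ) × (Fin 2 → ℝ) × (Fin 2 → ℝ) → _) :=
      Function.bijective_id.prodMap Prod.swap_bijective
    exact e.comp h.coframe
  generates := by rw [h.generates, Set.pair_comm]

/-- All the covectors of an adapted coframe. -/
abbrev all (_h : IsAdapted K θ σ τ) : Fin s ⊕ Fin 2 ⊕ Fin 2 → (V →L[ℝ] ℝ) :=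
  Sum.elim θ (Sum.elim σ τ)

lemma all_bijective (h : IsAdapted K θ σ τ) : Function.Bijective (fun v i => h.all i v) := by
  have e : Function.Bijective (fun p : (Fin s → ℝ) × (Fin 2 → ℝ) × (Fin 2 → ℝ) =>
      (Sum.elim p.1 (Sum.elim p.2.1 p.2.2) : Fin s ⊕ Fin 2 ⊕ Fin 2 → ℝ)) := by
    constructor
    · intro p q hpq
      ext1
      · ext i; exact congrFun hpq (Sum.inl i)
      · ext1
        · ext i; exact congrFun hpq (Sum.inr (Sum.inl i))
        · ext i; exact congrFun hpq (Sum.inr (Sum.inr i))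
    · intro f
      refine ⟨(fun i => f (Sum.inl i), fun i => f (Sum.inr (Sum.inl i)),
        fun i => f (Sum.inr (Sum.inr i))), ?_⟩
      ext i
      rcases i with i | i | i <;> rfl
  convert e.comp h.coframe using 1
  ext v i
  rcases i with i | i | i <;> rfl

lemma all_linearIndependent (h : IsAdapted K θ σ τ) : LinearIndependent ℝ h.all := by
  choose v hv using fun j : Fin s ⊕ Fin 2 ⊕ Fin 2 =>
    h.all_bijective.2 (fun i => if i = j then (1 : ℝ) else 0)
  exact linearIndependent_of_dual (v := v) fun i j => congrFun (hv j) i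

/-- The span of the `θᵉ` and `σ̂ᵃ`. -/
abbrev hat (_h : IsAdapted K θ σ τ) : Submodule ℝ (V →L[ℝ] ℝ) :=
  Submodule.span ℝ (Set.range θ ∪ Set.range σ)

/-- The vectors `vec 0 n` are the characteristic vectors of the hat system, that is, the common
kernel of the `θᵉ` and `σ̂ᵃ`. -/
lemma mem_hat (h : IsAdapted K θ σ τ) {α : V →L[ℝ] ℝ} :
    α ∈ h.hat ↔ ∀ n, α (h.vec 0 n) = 0 := by
  rw [hat, ← Set.Sum.elim_range, mem_span_range_iff]
  constructor
  · intro H n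
    refine H _ ?_
    rintro (i | i)
    · exact h.θ_vec _ _ i
    · exact h.σhat_vec _ _ i
  · intro H v hv
    rw [h.eq_vec (v := v) (m := 0) (n := fun a => τ a v) (fun e => hv (Sum.inl e))
      (fun a => hv (Sum.inr a)) (fun a => rfl)]
    exact H _

lemma mem_span_θ (h : IsAdapted K θ σ τ) {α : V →L[ℝ] ℝ} :
    α ∈ Submodule.span ℝ (Set.range θ) ↔ ∀ m n, α (h.vec m n) = 0 := by
  rw [mem_span_range_iff]
  constructor
  · intro H m n
    exact H _ fun i => h.θ_vec _ _ i
  · intro H v hv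
    rw [h.eq_vec (v := v) (m := fun a => σ a v) (n := fun a => τ a v) hv
      (fun a => rfl) (fun a => rfl)]
    exact H _ _

lemma vec_add (h : IsAdapted K θ σ τ) (m n m' n' : Fin 2 → ℝ) :
    h.vec m n + h.vec m' n' = h.vec (m + m') (n + n') := by
  apply h.ev.injective
  simp [ev_vec]

lemma vec_smul (h : IsAdapted K θ σ τ) (c : ℝ) (m n : Fin 2 → ℝ) :
    c • h.vec m n = h.vec (c • m) (c • n) := by
  apply h.ev.injective
  simp [ev_vec]

lemma vec_eq_add (h : IsAdapted K θ σ τ) (m n : Fin 2 → ℝ) :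
    h.vec m n = h.vec m 0 + h.vec 0 n := by simp [vec_add]

lemma vec_swap (h : IsAdapted K θ σ τ) (m n : Fin 2 → ℝ) : h.swap.vec m n = h.vec n m :=
  h.eq_vec (h.swap.θ_vec m n) (h.swap.σchk_vec m n) (h.swap.σhat_vec m n)

/-- A vector killed by all `θᵉ` is the sum of a characteristic vector of each system. For a
prolongation this identifies the intersection of the singular systems with the contact system. -/
lemma hat_inf_chk (h : IsAdapted K θ σ τ) :
    h.hat ⊓ h.swap.hat = Submodule.span ℝ (Set.range θ) := by
  ext α
  rw [Submodule.mem_inf, mem_hat, mem_hat, mem_span_θ h]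
  simp only [h.vec_swap]
  constructor
  · rintro ⟨h1, h2⟩ m n
    rw [vec_eq_add, map_add, h1, h2, add_zero]
  · exact fun H => ⟨fun n => H _ _, fun n => H _ _⟩

lemma finrank_hat (h : IsAdapted K θ σ τ) : Module.finrank ℝ h.hat = s + 2 := by
  have h1 : LinearIndependent ℝ (Sum.elim θ σ) := by
    have := h.all_linearIndependent.comp (Sum.map id Sum.inl : Fin s ⊕ Fin 2 → _)
      (Sum.map_injective.2 ⟨Function.injective_id, Sum.inl_injective⟩)
    convert! this using 1
    ext i : 1
    rcases i with i | i <;> rfl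
  have h2 := finrank_span_eq_card h1
  rw [Set.Sum.elim_range] at h2
  simpa using h2

/-- Unlike in `integral_plane`, `m` and `n` may vanish: each is a multiple of some nonzero pair, and
a subspace of an integral element is integral. -/
lemma integral_span_pair (h : IsAdapted K θ σ τ) (m n : Fin 2 → ℝ) :
    IsIntegral K (Submodule.span ℝ {h.vec m 0, h.vec 0 n}) := by
  have key : ∀ k : Fin 2 → ℝ, ∃ m : Fin 2 → ℝ, m ≠ 0 ∧ ∃ a : ℝ, k = a • m := by
    intro k
    by_cases hk : k = 0
    · exact ⟨fun _ => 1, fun hc => one_ne_zero (congrFun hc 0), 0, by simp [hk]⟩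
    · exact ⟨k, hk, 1, by simp⟩
  obtain ⟨m', hm, a, rfl⟩ := key m
  obtain ⟨n', hn, b, rfl⟩ := key n
  refine (h.integral_plane hm hn).mono ?_
  rw [Submodule.span_le]
  rintro x (rfl | rfl)
  · exact h.mem_plane.2 ⟨a, 0, by simp⟩
  · exact h.mem_plane.2 ⟨0, b, by simp⟩

/-- A covector of the ideal vanishes on every integral element, and the integral elements of the
form above fill the common kernel of the `θᵉ`. -/
lemma form1_mem (h : IsAdapted K θ σ τ) {α : V →L[ℝ] ℝ} :
    form1 α ∈ K ↔ α ∈ Submodule.span ℝ (Set.range θ) := by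
  constructor
  · intro hα
    rw [h.mem_span_θ]
    intro m n
    have key : ∀ m n : Fin 2 → ℝ, ∀ v ∈ Submodule.span ℝ ({h.vec m 0, h.vec 0 n} : Set V),
        α v = 0 := by
      intro m n v hv
      have := h.integral_span_pair m n _ hα
      rw [pull_form1, form1, ExteriorAlgebra.ι_eq_zero_iff] at this
      exact DFunLike.congr_fun this ⟨v, hv⟩
    refine key m n _ ?_
    rw [h.vec_eq_add m n]
    exact Submodule.add_mem _ (Submodule.mem_span_of_mem (by simp))
      (Submodule.mem_span_of_mem (by simp))
  · intro hα
    rw [h.generates]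
    refine Ideal.span_mono Set.subset_union_left ?_
    have := form1_mem_covIdeal hα
    rwa [covIdeal, ← Set.range_comp] at this

/-- Both coframes have the same common kernel of the `θ`. On it the form `H = σ'⁰ ∧ σ'¹` vanishes on
mixed pairs, since these span integral elements, so `H` is block diagonal with respect to the first
coframe, with one scalar for each block. A nonzero scalar forces the vectors `h'.vec 0 n`, which lie
in the kernel of `H`, to have no component in that block. -/
lemma exists_zero_imp (h : IsAdapted K θ σ τ) (h' : IsAdapted K θ' σ' τ') :
    h.hat ≤ h'.hat ∨ h.swap.hat ≤ h'.hat := by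
  have hθ : ∀ m n, ∀ e, θ e (h'.vec m n) = 0 := by
    intro m n e
    have h1 : θ e ∈ Submodule.span ℝ (Set.range θ') := by
      rw [← h'.form1_mem, h.form1_mem]; exact Submodule.subset_span ⟨e, rfl⟩
    exact (h'.mem_span_θ.1 h1) m n
  have hθ' : ∀ m n, ∀ e, θ' e (h.vec m n) = 0 := by
    intro m n e
    have h1 : θ' e ∈ Submodule.span ℝ (Set.range θ) := by
      rw [← h.form1_mem, h'.form1_mem]; exact Submodule.subset_span ⟨e, rfl⟩
    exact (h.mem_span_θ.1 h1) m n
  set H : V → V → ℝ := fun v w => σ' 0 v * σ' 1 w - σ' 0 w * σ' 1 v with hH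
  have hmix : ∀ m n, H (h.vec m 0) (h.vec 0 n) = 0 := fun m n =>
    (h'.integral_minor (h.integral_span_pair m n) (Submodule.subset_span (Or.inl rfl))
      (Submodule.subset_span (Or.inr rfl))).2.1
  have hd : ∀ k : Fin 2 → ℝ, k = k 0 • ![1, 0] + k 1 • ![0, 1] := by
    intro k; ext i; fin_cases i <;> simp
  have dhat : ∀ m : Fin 2 → ℝ, h.vec m 0 = m 0 • h.vec ![1, 0] 0 + m 1 • h.vec ![0, 1] 0 := by
    intro m; rw [vec_smul, vec_smul, vec_add]; simp only [smul_zero, add_zero, ← hd]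
  have dchk : ∀ m : Fin 2 → ℝ, h.vec 0 m = m 0 • h.vec 0 ![1, 0] + m 1 • h.vec 0 ![0, 1] := by
    intro m; rw [vec_smul, vec_smul, vec_add]; simp only [smul_zero, add_zero, ← hd]
  have e1 : ∀ m m' : Fin 2 → ℝ, H (h.vec m 0) (h.vec m' 0) =
      (m 0 * m' 1 - m' 0 * m 1) * H (h.vec ![1, 0] 0) (h.vec ![0, 1] 0) := by
    intro m m'
    rw [dhat m, dhat m']
    simp only [hH, map_add, map_smul, smul_eq_mul]
    ring
  have e2 : ∀ m m' : Fin 2 → ℝ, H (h.vec 0 m) (h.vec 0 m') =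
      (m 0 * m' 1 - m' 0 * m 1) * H (h.vec 0 ![1, 0]) (h.vec 0 ![0, 1]) := by
    intro m m'
    rw [dchk m, dchk m']
    simp only [hH, map_add, map_smul, smul_eq_mul]
    ring
  have hv : ∀ n, h'.vec 0 n =
      h.vec (fun a => σ a (h'.vec 0 n)) 0 + h.vec 0 (fun a => τ a (h'.vec 0 n)) := by
    intro n
    rw [← vec_eq_add]
    exact h.eq_vec (hθ 0 n) (fun a => rfl) (fun a => rfl)
  have hz : ∀ n w, H (h'.vec 0 n) w = 0 := by
    intro n w
    simp only [hH, h'.σhat_vec]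
    simp
  have hm : ∀ n m', H (h'.vec 0 n) (h.vec m' 0) =
      H (h.vec (fun a => σ a (h'.vec 0 n)) 0) (h.vec m' 0) := by
    intro n m'
    have h1 := hmix m' (fun a => τ a (h'.vec 0 n))
    have h2 := fun k => congrArg (σ' k) (hv n)
    simp only [map_add] at h2
    simp only [hH] at h1 ⊢
    rw [h2 0, h2 1]
    linarith
  have hn : ∀ n m', H (h'.vec 0 n) (h.vec 0 m') =
      H (h.vec 0 (fun a => τ a (h'.vec 0 n))) (h.vec 0 m') := by
    intro n m'
    have h1 := hmix (fun a => σ a (h'.vec 0 n)) m'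
    have h2 := fun k => congrArg (σ' k) (hv n)
    simp only [map_add] at h2
    simp only [hH] at h1 ⊢
    rw [h2 0, h2 1]
    linarith
  have zero_of : ∀ (k : Fin 2 → ℝ) (c : ℝ), c ≠ 0 →
      (∀ m' : Fin 2 → ℝ, (k 0 * m' 1 - m' 0 * k 1) * c = 0) → ∀ a, k a = 0 := by
    intro k c hc hk
    have h1 := hk ![1, 0]
    have h2 := hk ![0, 1]
    simp [hc] at h1 h2
    intro a; fin_cases a <;> simpa
  by_cases hl : H (h.vec ![1, 0] 0) (h.vec ![0, 1] 0) = 0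
  · by_cases hmu : H (h.vec 0 ![1, 0]) (h.vec 0 ![0, 1]) = 0
    -- If both scalars vanish, `H` is zero on the common kernel of the `θ`, although it equals 1 on
    -- the vectors dual to `σ'⁰`, `σ'¹`.
    · exfalso
      have h1 : H (h'.vec ![1, 0] 0) (h'.vec ![0, 1] 0) = 1 := by
        simp only [hH, h'.σhat_vec]; simp
      have hv2 : ∀ m n, h'.vec m n =
          h.vec (fun a => σ a (h'.vec m n)) 0 + h.vec 0 (fun a => τ a (h'.vec m n)) := by
        intro m n
        rw [← vec_eq_add]
        exact h.eq_vec (hθ m n) (fun a => rfl) (fun a => rfl)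
      rw [hv2 ![1, 0] 0, hv2 ![0, 1] 0] at h1
      generalize (fun a => σ a (h'.vec ![1, 0] 0)) = m1 at h1
      generalize (fun a => τ a (h'.vec ![1, 0] 0)) = n1 at h1
      generalize (fun a => σ a (h'.vec ![0, 1] 0)) = m2 at h1
      generalize (fun a => τ a (h'.vec ![0, 1] 0)) = n2 at h1
      have f1 := hmix m1 n2
      have f2 := hmix m2 n1
      have f3 := e1 m1 m2
      have f4 := e2 n1 n2
      rw [hl, mul_zero] at f3
      rw [hmu, mul_zero] at f4
      simp only [hH, map_add] at h1 f1 f2 f3 f4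
      linarith
    · right
      intro α hα
      rw [mem_hat] at hα ⊢
      intro n
      have h1 := zero_of (fun a => τ a (h'.vec 0 n)) _ hmu (fun m' =>
        (e2 _ _).symm.trans ((hn _ _).symm.trans (hz _ _)))
      rw [hv n, show (fun a => τ a (h'.vec 0 n)) = 0 from funext h1, map_add]
      rw [← h.vec_swap, hα, ← h.vec_swap, hα, add_zero]
  · left
    intro α hα
    rw [mem_hat] at hα ⊢
    intro n
    have h1 := zero_of (fun a => σ a (h'.vec 0 n)) _ hl (fun m' =>
      (e1 _ _).symm.trans ((hm _ _).symm.trans (hz _ _)))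
    rw [hv n, show (fun a => σ a (h'.vec 0 n)) = 0 from funext h1, map_add, hα, hα, add_zero]

lemma hat_ne_chk (h : IsAdapted K θ σ τ) : h.hat ≠ h.swap.hat := by
  intro he
  have h1 : σ 0 ∈ h.swap.hat := he ▸ Submodule.subset_span (Or.inr ⟨0, rfl⟩)
  have h2 := h.swap.mem_hat.1 h1 ![1, 0]
  rw [h.vec_swap, h.σhat_vec] at h2
  simp at h2

/-- The singular systems are unique up to interchange. -/
lemma hat_chk_unique (h : IsAdapted K θ σ τ) (h' : IsAdapted K θ' σ' τ') :
    (h'.hat = h.hat ∧ h'.swap.hat = h.swap.hat) ∨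
      (h'.hat = h.swap.hat ∧ h'.swap.hat = h.hat) := by
  have key : ∀ {σ' τ'} (h' : IsAdapted K θ' σ' τ'), h'.hat = h.hat ∨ h'.hat = h.swap.hat := by
    intro σ' τ' h'
    have fd : FiniteDimensional ℝ h'.hat := 
      FiniteDimensional.span_of_finite ℝ (Set.toFinite _)
    rcases h.exists_zero_imp h' with hle | hle
    · exact Or.inl (Submodule.eq_of_le_of_finrank_eq hle (by rw [finrank_hat, finrank_hat])).symm
    · exact Or.inr (Submodule.eq_of_le_of_finrank_eq hle (by rw [finrank_hat, finrank_hat])).symm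
  have hne := h'.hat_ne_chk
  rcases key h' with h1 | h1 <;> rcases key h'.swap with h2 | h2
  · exact absurd (h1.trans h2.symm) hne
  · exact Or.inl ⟨h1, h2⟩
  · exact Or.inr ⟨h1, h2⟩
  · exact absurd (h1.trans h2.symm) hne

end IsAdapted

end AdaptedAlgebra

/-! ### Smooth 1-forms and their pull-backs in charts. -/

section Calculus

variable {E : Type*} [NormedAddCommGroup E] [NormedSpace ℝ E]
  {N : Type*} [TopologicalSpace N] [ChartedSpace E N]
  {E₁ : Type*} [NormedAddCommGroup E₁] [NormedSpace ℝ E₁]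
  {M : Type*} [TopologicalSpace M] [ChartedSpace E₁ M]
  {E₂ : Type*} [NormedAddCommGroup E₂] [NormedSpace ℝ E₂]
  {M₂ : Type*} [TopologicalSpace M₂] [ChartedSpace E₂ M₂]

/-- The pull-back of a 1-form. -/
def pb (p : N → M) (θ : OneForm E₁ M) : OneForm E N := fun x => (θ (p x)).comp (dmap E E₁ p x)

/-- All tangent spaces are the model space `E`, so values at equal base points can be compared on
the same vector without any transport. -/
lemma oneForm_congr (θ : OneForm E N) {x x' : N} (h : x = x') (v : E) :
    (θ x : E →L[ℝ] ℝ) v = (θ x' : E →L[ℝ] ℝ) v := by subst h; rfl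

lemma localRep_congr {θ θ' : OneForm E N} {c : OpenPartialHomeomorph N E} {y : E}
    (h : θ (c.symm y) = θ' (c.symm y)) : localRep θ c y = localRep θ' c y := by
  rw [localRep, localRep, h]

lemma localRep_add (θ θ' : OneForm E N) (c : OpenPartialHomeomorph N E) :
    localRep (fun x => θ x + θ' x) c = fun y => localRep θ c y + localRep θ' c y := rfl

lemma localRep_smul (f : N → ℝ) (θ : OneForm E N) (c : OpenPartialHomeomorph N E) :
    localRep (fun x => f x • θ x) c = fun y => f (c.symm y) • localRep θ c y := rfl

lemma smoothOn_iff {θ : OneForm E N} {U : Set N} (hU : IsOpen U) : SmoothOn θ U ↔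
    ∀ c ∈ atlas E N, ∀ y ∈ c.target, c.symm y ∈ U → ContDiffAt ℝ ∞ (localRep θ c) y := by
  constructor
  · intro h c hc y hy hyU
    exact (h c hc).contDiffAt ((c.isOpen_inter_preimage_symm hU).mem_nhds ⟨hy, hyU⟩)
  · intro h c hc y hy
    exact (h c hc y hy.1 hy.2).contDiffWithinAt

lemma SmoothOn.mono {θ : OneForm E N} {U U' : Set N} (h : SmoothOn θ U) (hU : U' ⊆ U) :
    SmoothOn θ U' := fun c hc => (h c hc).mono fun _ hy => ⟨hy.1, hU hy.2⟩

lemma SmoothOn.add {θ θ' : OneForm E N} {U : Set N} (h : SmoothOn θ U) (h' : SmoothOn θ' U) :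
    SmoothOn (fun x => θ x + θ' x) U := fun c hc => (h c hc).add (h' c hc)

section Charts

variable [IsManifold 𝓘(ℝ, E) ∞ N] [IsManifold 𝓘(ℝ, E₁) ∞ M] [IsManifold 𝓘(ℝ, E₂) ∞ M₂]

lemma contMDiffAt_chart {c : OpenPartialHomeomorph N E} (hc : c ∈ atlas E N) {x : N}
    (hx : x ∈ c.source) : ContMDiffAt 𝓘(ℝ, E) 𝓘(ℝ, E) ∞ c x :=
  (contMDiffOn_of_mem_maximalAtlas (IsManifold.subset_maximalAtlas hc)).contMDiffAt
    (c.open_source.mem_nhds hx)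

lemma contMDiffAt_chart_symm {c : OpenPartialHomeomorph N E} (hc : c ∈ atlas E N) {y : E}
    (hy : y ∈ c.target) : ContMDiffAt 𝓘(ℝ, E) 𝓘(ℝ, E) ∞ c.symm y :=
  (contMDiffOn_symm_of_mem_maximalAtlas (IsManifold.subset_maximalAtlas hc)).contMDiffAt
    (c.open_target.mem_nhds hy)

lemma SmoothOn.smul {f : N → ℝ} {θ : OneForm E N} {U : Set N}
    (hf : ContMDiffOn 𝓘(ℝ, E) 𝓘(ℝ, ℝ) ∞ f U) (h : SmoothOn θ U) :
    SmoothOn (fun x => f x • θ x) U := by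
  intro c hc
  have h1 : ContDiffOn ℝ ∞ (fun y => f (c.symm y)) (c.target ∩ c.symm ⁻¹' U) := by
    rw [← contMDiffOn_iff_contDiffOn]
    exact hf.comp ((contMDiffOn_symm_of_mem_maximalAtlas
      (IsManifold.subset_maximalAtlas hc)).mono Set.inter_subset_left) fun y hy => hy.2
  exact h1.smul (h c hc)

lemma SmoothOn.neg {θ : OneForm E N} {U : Set N} (h : SmoothOn θ U) :
    SmoothOn (fun x => -θ x) U := fun c hc => (h c hc).neg

lemma SmoothOn.sub {θ θ' : OneForm E N} {U : Set N} (h : SmoothOn θ U) (h' : SmoothOn θ' U) :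
    SmoothOn (fun x => θ x - θ' x) U := fun c hc => (h c hc).sub (h' c hc)

lemma smoothOn_sum {ι : Type*} (t : Finset ι) {θ : ι → OneForm E N} {U : Set N}
    (h : ∀ i ∈ t, SmoothOn (θ i) U) : SmoothOn (fun x => ∑ i ∈ t, θ i x) U := by
  classical
  induction t using Finset.induction_on with
  | empty =>
    intro c hc
    simp only [Finset.sum_empty]
    exact (contDiffOn_const (c := (0 : E →L[ℝ] ℝ)))
  | insert a t ha ih =>
    simp only [Finset.sum_insert ha]
    exact (h a (by simp)).add (ih fun i hi => h i (by simp [hi]))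

lemma contDiffAt_rep {p : N → M} {c : OpenPartialHomeomorph N E} {c' : OpenPartialHomeomorph M E₁}
    (hc : c ∈ atlas E N) (hc' : c' ∈ atlas E₁ M) {y : E} (hy : y ∈ c.target)
    (hy' : p (c.symm y) ∈ c'.source) (hp : ContMDiffAt 𝓘(ℝ, E) 𝓘(ℝ, E₁) ∞ p (c.symm y)) :
    ContDiffAt ℝ ∞ (c' ∘ p ∘ c.symm) y := by
  rw [← contMDiffAt_iff_contDiffAt]
  exact (contMDiffAt_chart hc' hy').comp y (hp.comp y (contMDiffAt_chart_symm hc hy))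

/-- The chain rule applied to both factorisations of the germ of `p ∘ c.symm` at `y`, one of them
through `c'.symm ∘ c'`. This local formula gives both the smoothness of pull-backs and the
naturality of `extD`. -/
lemma localRep_pb {p : N → M} {c : OpenPartialHomeomorph N E} {c' : OpenPartialHomeomorph M E₁}
    (hc : c ∈ atlas E N) (hc' : c' ∈ atlas E₁ M) {y : E} (hy : y ∈ c.target)
    (hy' : p (c.symm y) ∈ c'.source) (hp : ContMDiffAt 𝓘(ℝ, E) 𝓘(ℝ, E₁) ∞ p (c.symm y))
    (θ : OneForm E₁ M) :
    localRep (pb p θ) c y =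
      (localRep θ c' (c' (p (c.symm y)))).comp (fderiv ℝ (c' ∘ p ∘ c.symm) y) := by
  have hn : (∞ : WithTop ℕ∞) ≠ 0 := by simp
  have hF := contDiffAt_rep hc hc' hy hy' hp
  have hF' : MDifferentiableAt 𝓘(ℝ, E) 𝓘(ℝ, E₁) (c' ∘ p ∘ c.symm) y :=
    (hF.differentiableAt hn).mdifferentiableAt
  have hs := (contMDiffAt_chart_symm hc hy).mdifferentiableAt hn
  have hp' := hp.mdifferentiableAt hn
  have hs' := (contMDiffAt_chart_symm hc' (c'.map_source hy')).mdifferentiableAt hn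
  have e1 : mfderiv 𝓘(ℝ, E) 𝓘(ℝ, E₁) (p ∘ c.symm) y =
      (mfderiv 𝓘(ℝ, E) 𝓘(ℝ, E₁) p (c.symm y)).comp (mfderiv 𝓘(ℝ, E) 𝓘(ℝ, E) c.symm y) :=
    mfderiv_comp y hp' hs
  have e2 : mfderiv 𝓘(ℝ, E) 𝓘(ℝ, E₁) (c'.symm ∘ (c' ∘ p ∘ c.symm)) y =
      (mfderiv 𝓘(ℝ, E₁) 𝓘(ℝ, E₁) c'.symm (c' (p (c.symm y)))).comp
        (mfderiv 𝓘(ℝ, E) 𝓘(ℝ, E₁) (c' ∘ p ∘ c.symm) y) := mfderiv_comp y hs' hF'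
  have hev : (c'.symm ∘ (c' ∘ p ∘ c.symm)) =ᶠ[𝓝 y] p ∘ c.symm := by
    have hcont : ContinuousAt (p ∘ c.symm) y :=
      ContinuousAt.comp (hp.continuousAt) (c.continuousAt_symm hy)
    filter_upwards [hcont (c'.open_source.mem_nhds hy')] with z hz
    exact c'.left_inv hz
  have e3 : ∀ v : E, (mfderiv 𝓘(ℝ, E) 𝓘(ℝ, E₁) (c'.symm ∘ (c' ∘ p ∘ c.symm)) y v : E₁) =
      (mfderiv 𝓘(ℝ, E) 𝓘(ℝ, E₁) (p ∘ c.symm) y v : E₁) := fun v => by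
    have := hev.mfderiv_eq (I := 𝓘(ℝ, E)) (I' := 𝓘(ℝ, E₁))
    exact DFunLike.congr_fun this v
  ext v
  have e4 := e3 v
  rw [e1, e2, mfderiv_eq_fderiv] at e4
  have e5 := oneForm_congr θ (c'.left_inv hy')
    ((mfderiv 𝓘(ℝ, E₁) 𝓘(ℝ, E₁) c'.symm (c' (p (c.symm y)))).comp
        (fderiv ℝ (c' ∘ p ∘ c.symm) y) v : E₁)
  refine Eq.trans ?_ e5.symm
  exact congrArg (θ (p (c.symm y)) : E₁ →L[ℝ] ℝ) e4.symm

lemma SmoothOn.pb {p : N → M} {θ : OneForm E₁ M} {O : Set N} {U : Set M} (hO : IsOpen O)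
    (hU : IsOpen U) (hp : ContMDiffOn 𝓘(ℝ, E) 𝓘(ℝ, E₁) ∞ p O) (hθ : SmoothOn θ U)
    (hOU : ∀ x ∈ O, p x ∈ U) : SmoothOn (EDS.pb (E := E) p θ) O := by
  rw [smoothOn_iff hO]
  intro c hc y hy hyO
  set c' := chartAt E₁ (p (c.symm y)) with hc'
  have hpa := hp.contMDiffAt (hO.mem_nhds hyO)
  have hy' : p (c.symm y) ∈ c'.source := mem_chart_source _ _
  have hF := contDiffAt_rep hc (chart_mem_atlas _ _) hy hy' hpa
  have h1 : ContDiffAt ℝ ∞ (fun z => localRep θ c' ((c' ∘ p ∘ c.symm) z)) y := by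
    refine ContDiffAt.comp (g := localRep θ c') y ?_ hF
    refine (smoothOn_iff hU).1 hθ c' (chart_mem_atlas _ _) _ (c'.map_source hy') ?_
    rw [Function.comp_apply, Function.comp_apply, c'.left_inv hy']
    exact hOU _ hyO
  have h2 : ContDiffAt ℝ ∞ (fun z => fderiv ℝ (c' ∘ p ∘ c.symm) z) y :=
    hF.fderiv_right (m := ∞) (by simp)
  refine (h1.clm_comp h2).congr_of_eventuallyEq ?_
  have hcont : ContinuousAt (p ∘ c.symm) y :=
    ContinuousAt.comp (hpa.continuousAt) (c.continuousAt_symm hy)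
  filter_upwards [hcont (c'.open_source.mem_nhds hy'), c.open_target.mem_nhds hy,
    (c.continuousAt_symm hy) (hO.mem_nhds hyO)] with z hz hz1 hz2
  exact localRep_pb hc (chart_mem_atlas _ _) hz1 hz (hp.contMDiffAt (hO.mem_nhds hz2)) θ

lemma dmap_eq_fderiv {p : N → M} {x : N} (hp : ContMDiffAt 𝓘(ℝ, E) 𝓘(ℝ, E₁) ∞ p x) :
    (dmap E E₁ p x : E →L[ℝ] E₁) =
      fderiv ℝ (chartAt E₁ (p x) ∘ p ∘ (chartAt E x).symm) (chartAt E x x) := by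
  have h := (hp.mdifferentiableAt (by simp)).mfderiv
  rw [modelWithCornersSelf_coe, Set.range_id, fderivWithin_univ] at h
  exact h

/-- The chart at `x` identifies the tangent space at `x` with the model space. -/
lemma localRep_self (θ : OneForm E N) (x : N) :
    localRep θ (chartAt E x) (chartAt E x x) = (θ x : E →L[ℝ] ℝ) := by
  have hx := mem_chart_source E x
  have h1 := localRep_pb (p := (id : N → N)) (chart_mem_atlas E x) (chart_mem_atlas E x)
    ((chartAt E x).map_source hx) (by rw [(chartAt E x).left_inv hx]; exact hx) contMDiffAt_id θ
  have h2 : mfderiv 𝓘(ℝ, E) 𝓘(ℝ, E) (chartAt E x).symm (chartAt E x x) =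
      ContinuousLinearMap.id ℝ E := by
    have hs := (contMDiffAt_chart_symm (chart_mem_atlas E x)
      ((chartAt E x).map_source hx)).mdifferentiableAt (by simp)
    have h3 := hs.mfderiv
    rw [modelWithCornersSelf_coe, Set.range_id, fderivWithin_univ] at h3
    rw [h3]
    have : (writtenInExtChartAt 𝓘(ℝ, E) 𝓘(ℝ, E) (chartAt E x x) (chartAt E x).symm) =ᶠ[𝓝
        ((extChartAt 𝓘(ℝ, E) (chartAt E x x)) (chartAt E x x))] id := by
      filter_upwards [(chartAt E x).open_target.mem_nhds ((chartAt E x).map_source hx)] with z hz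
      simp only [writtenInExtChartAt, Function.comp_apply, extChartAt, chartAt_self_eq,
        mfld_simps]
      exact (chartAt E x).right_inv hz
    rw [this.fderiv_eq]
    exact fderiv_id
  ext v
  rw [localRep]
  refine Eq.trans ?_ (oneForm_congr θ ((chartAt E x).left_inv hx) v)
  exact congrArg (θ _ : E →L[ℝ] ℝ) (DFunLike.congr_fun h2 v)

end Charts

end Calculus

/-! ### Naturality and product rule for the exterior derivative. -/

section ExteriorDerivative

variable {E : Type*} [NormedAddCommGroup E] [NormedSpace ℝ E]
  {N : Type*} [TopologicalSpace N] [ChartedSpace E N]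
  {E₁ : Type*} [NormedAddCommGroup E₁] [NormedSpace ℝ E₁]
  {M : Type*} [TopologicalSpace M] [ChartedSpace E₁ M]
  {E₂ : Type*} [NormedAddCommGroup E₂] [NormedSpace ℝ E₂]
  {M₂ : Type*} [TopologicalSpace M₂] [ChartedSpace E₂ M₂]
  [IsManifold 𝓘(ℝ, E) ∞ N] [IsManifold 𝓘(ℝ, E₁) ∞ M] [IsManifold 𝓘(ℝ, E₂) ∞ M₂]

/-- The tautological 1-form `dt` on the real line. -/
def dt : OneForm ℝ ℝ := fun _ => ContinuousLinearMap.id ℝ ℝ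

lemma diff_eq_pb (f : N → ℝ) : (diff f : OneForm E N) = pb f dt := rfl

lemma localRep_dt {c : OpenPartialHomeomorph ℝ ℝ} (hc : c ∈ atlas ℝ ℝ) :
    localRep dt c = fun _ => ContinuousLinearMap.id ℝ ℝ := by
  rw [chartedSpaceSelf_atlas] at hc
  subst hc
  ext y : 1
  rw [localRep]
  have : (mfderiv 𝓘(ℝ, ℝ) 𝓘(ℝ, ℝ) (OpenPartialHomeomorph.refl ℝ).symm y) =
      ContinuousLinearMap.id ℝ ℝ := mfderiv_id
  rw [this]
  rfl

lemma smoothOn_dt : SmoothOn dt Set.univ := by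
  intro c hc
  rw [localRep_dt hc]
  exact contDiffOn_const

lemma smoothOn_diff {f : N → ℝ} {U : Set N} (hU : IsOpen U)
    (hf : ContMDiffOn 𝓘(ℝ, E) 𝓘(ℝ, ℝ) ∞ f U) : SmoothOn (diff f : OneForm E N) U :=
  SmoothOn.pb hU isOpen_univ hf smoothOn_dt fun _ _ => trivial

lemma diff_congr {f g : N → ℝ} {x : N} (h : f =ᶠ[𝓝 x] g) : (diff f x : Cot E x) = diff g x := by
  ext v
  have := h.mfderiv_eq (I := 𝓘(ℝ, E)) (I' := 𝓘(ℝ, ℝ))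
  exact DFunLike.congr_fun this v

lemma dmap_comp {p : N → M} {g : M → M₂} {x : N} (hp : ContMDiffAt 𝓘(ℝ, E) 𝓘(ℝ, E₁) ∞ p x)
    (hg : ContMDiffAt 𝓘(ℝ, E₁) 𝓘(ℝ, E₂) ∞ g (p x)) :
    dmap E E₂ (g ∘ p) x = (dmap E₁ E₂ g (p x)).comp (dmap E E₁ p x) :=
  mfderiv_comp x (hg.mdifferentiableAt (by simp)) (hp.mdifferentiableAt (by simp))

lemma pb_diff {p : N → M} {f : M → ℝ} {x : N} (hp : ContMDiffAt 𝓘(ℝ, E) 𝓘(ℝ, E₁) ∞ p x)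
    (hf : ContMDiffAt 𝓘(ℝ, E₁) 𝓘(ℝ, ℝ) ∞ f (p x)) :
    pb (E := E) (E₁ := E₁) p (diff f) x = diff (f ∘ p) x := (dmap_comp hp hf).symm

lemma diff_const (c : ℝ) (x : N) : (diff (fun _ => c) x : Cot E x) = 0 := by
  have := mfderiv_const (I := 𝓘(ℝ, E)) (I' := 𝓘(ℝ, ℝ)) (x := x) (c := c)
  exact this

variable [FiniteDimensional ℝ E] [FiniteDimensional ℝ E₁]

lemma extD_eq_alt (θ : OneForm E N) (x : N) :
    extD θ x = alt (fderiv ℝ (localRep θ (chartAt E x)) (chartAt E x x)) := rfl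

lemma extD_congr {θ θ' : OneForm E N} {U : Set N} (hU : IsOpen U) {x : N} (hx : x ∈ U)
    (h : ∀ y ∈ U, θ y = θ' y) : extD θ x = extD θ' x := by
  rw [extD_eq_alt, extD_eq_alt]
  have : localRep θ (chartAt E x) =ᶠ[𝓝 (chartAt E x x)] localRep θ' (chartAt E x) := by
    have hs := (chartAt E x).continuousAt_symm ((chartAt E x).map_source (mem_chart_source E x))
    have := hs (hU.mem_nhds (by rwa [(chartAt E x).left_inv (mem_chart_source E x)]))
    filter_upwards [this] with y hy
    exact localRep_congr (h _ hy)
  rw [this.fderiv_eq]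

lemma SmoothOn.contDiffAt_chart {θ : OneForm E N} {U : Set N} (hU : IsOpen U) (h : SmoothOn θ U)
    {x : N} (hx : x ∈ U) : ContDiffAt ℝ ∞ (localRep θ (chartAt E x)) (chartAt E x x) :=
  (smoothOn_iff hU).1 h _ (chart_mem_atlas E x) _ ((chartAt E x).map_source (mem_chart_source E x))
    (by rwa [(chartAt E x).left_inv (mem_chart_source E x)])

/-- Naturality of the exterior derivative. -/
lemma extD_pb {p : N → M} {θ : OneForm E₁ M} {O : Set N} {U : Set M} (hO : IsOpen O)
    (hU : IsOpen U) (hp : ContMDiffOn 𝓘(ℝ, E) 𝓘(ℝ, E₁) ∞ p O) (hθ : SmoothOn θ U) {x : N}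
    (hx : x ∈ O) (hxU : p x ∈ U) :
    extD (pb p θ : OneForm E N) x = pull (dmap E E₁ p x) (extD θ (p x)) := by
  set c := chartAt E x with hc
  set c' := chartAt E₁ (p x) with hc'
  set F := c' ∘ p ∘ c.symm with hFdef
  have hcx : c.symm (c x) = x := c.left_inv (mem_chart_source E x)
  have hpx := hp.contMDiffAt (hO.mem_nhds hx)
  have hpx' : ContMDiffAt 𝓘(ℝ, E) 𝓘(ℝ, E₁) ∞ p (c.symm (c x)) := by rwa [hcx]
  have hy : c x ∈ c.target := c.map_source (mem_chart_source E x)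
  have hy' : p (c.symm (c x)) ∈ c'.source := by rw [hcx]; exact mem_chart_source E₁ _
  have hF : ContDiffAt ℝ ∞ F (c x) :=
    contDiffAt_rep (chart_mem_atlas E x) (chart_mem_atlas E₁ _) hy hy' hpx'
  have hFx : F (c x) = c' (p x) := by rw [hFdef]; simp only [Function.comp_apply, hcx]
  have hL : ContDiffAt ℝ ∞ (localRep θ c') (F (c x)) := by
    rw [hFx]; exact hθ.contDiffAt_chart hU hxU
  have hev : localRep (pb p θ : OneForm E N) c =ᶠ[𝓝 (c x)]
      fun z => (localRep θ c' (F z)).comp (fderiv ℝ F z) := by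
    have hcont : ContinuousAt (p ∘ c.symm) (c x) :=
      ContinuousAt.comp hpx'.continuousAt (c.continuousAt_symm hy)
    filter_upwards [hcont (c'.open_source.mem_nhds hy'), c.open_target.mem_nhds hy,
      (c.continuousAt_symm hy) (hO.mem_nhds (by rwa [hcx]))] with z hz hz1 hz2
    exact localRep_pb (chart_mem_atlas _ _) (chart_mem_atlas _ _) hz1 hz
      (hp.contMDiffAt (hO.mem_nhds hz2)) θ
  have hn : (∞ : WithTop ℕ∞) ≠ 0 := by simp
  have hF1 : HasFDerivAt F (fderiv ℝ F (c x)) (c x) := (hF.differentiableAt hn).hasFDerivAt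
  have hF2 : HasFDerivAt (fderiv ℝ F) (fderiv ℝ (fderiv ℝ F) (c x)) (c x) :=
    ((hF.fderiv_right (m := ∞) (by simp)).differentiableAt hn).hasFDerivAt
  have hL1 : HasFDerivAt (localRep θ c') (fderiv ℝ (localRep θ c') (F (c x))) (F (c x)) :=
    (hL.differentiableAt hn).hasFDerivAt
  have hD := (hL1.comp (c x) hF1).clm_comp hF2
  have hD' : fderiv ℝ (localRep (pb p θ : OneForm E N) c) (c x) = _ := hev.fderiv_eq.trans hD.fderiv
  have hdm := dmap_eq_fderiv hpx
  -- The derivative of the local representative has two terms. One contains the second derivative of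
  -- `F`; it is symmetric and disappears under alternation. The other is the pull-back of the
  -- derivative of `θ`.
  have hsym : IsSymmSndFDerivAt ℝ F (c x) :=
    hF.isSymmSndFDerivAt (by
      simpa using (WithTop.coe_le_coe.2 (le_top (a := (2 : ℕ∞)))))
  have hz : ∀ b : E →L[ℝ] E →L[ℝ] ℝ, (∀ v w, b v w =
      (localRep θ c' (F (c x))) (fderiv ℝ (fderiv ℝ F) (c x) v w)) → alt b = 0 := by
    intro b hb
    apply alt_eq_zero_of_symm
    intro v w
    rw [hb, hb, hsym.eq]
  have h1 := hz ((ContinuousLinearMap.compL ℝ E E₁ ℝ (localRep θ c' (F (c x)))).comp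
    (fderiv ℝ (fderiv ℝ F) (c x))) (fun v w => rfl)
  have h2 := pull_alt (fderiv ℝ F (c x)) (fderiv ℝ (localRep θ c') (c' (p x)))
    (b' := ((ContinuousLinearMap.compL ℝ E E₁ ℝ).flip (fderiv ℝ F (c x))).comp
      ((fderiv ℝ (localRep θ c') (F (c x))).comp (fderiv ℝ F (c x))))
      (fun v w => by rw [hFx]; rfl)
  have key : alt ((ContinuousLinearMap.compL ℝ E E₁ ℝ (localRep θ c' (F (c x)))).comp
      (fderiv ℝ (fderiv ℝ F) (c x)) + ((ContinuousLinearMap.compL ℝ E E₁ ℝ).flip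
        (fderiv ℝ F (c x))).comp ((fderiv ℝ (localRep θ c') (F (c x))).comp
          (fderiv ℝ F (c x)))) =
      pull (fderiv ℝ F (c x)) (alt (fderiv ℝ (localRep θ c') (c' (p x)))) := by
    rw [alt_add, h1, zero_add, h2]
  exact (congrArg alt hD').trans (key.trans (congrArg
    (fun L : E →L[ℝ] E₁ => pull L (alt (fderiv ℝ (localRep θ c') (c' (p x))))) hdm.symm))

lemma extD_add {θ θ' : OneForm E N} {U : Set N} (hU : IsOpen U) (h : SmoothOn θ U)
    (h' : SmoothOn θ' U) {x : N} (hx : x ∈ U) :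
    extD (fun y => θ y + θ' y) x = extD θ x + extD θ' x := by
  have hn : (∞ : WithTop ℕ∞) ≠ 0 := by simp
  have h1 := ((h.contDiffAt_chart hU hx).differentiableAt hn)
  have h2 := ((h'.contDiffAt_chart hU hx).differentiableAt hn)
  rw [extD_eq_alt, extD_eq_alt, extD_eq_alt, localRep_add, fderiv_fun_add h1 h2]
  exact alt_add _ _

lemma extD_smul {f : N → ℝ} {θ : OneForm E N} {U : Set N} (hU : IsOpen U)
    (hf : ContMDiffOn 𝓘(ℝ, E) 𝓘(ℝ, ℝ) ∞ f U) (h : SmoothOn θ U) {x : N} (hx : x ∈ U) :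
    extD (fun y => f y • θ y) x =
      form1 (diff f x : Cot E x) * form1 (θ x) + f x • extD θ x := by
  have hn : (∞ : WithTop ℕ∞) ≠ 0 := by simp
  have h1 := ((h.contDiffAt_chart hU hx).differentiableAt hn)
  have hcx : (chartAt E x).symm (chartAt E x x) = x :=
    (chartAt E x).left_inv (mem_chart_source E x)
  have hfx := hf.contMDiffAt (hU.mem_nhds hx)
  have h2 : DifferentiableAt ℝ (fun y => f ((chartAt E x).symm y)) (chartAt E x x) := by
    have : ContMDiffAt 𝓘(ℝ, E) 𝓘(ℝ, ℝ) ∞ (f ∘ (chartAt E x).symm) (chartAt E x x) := by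
      refine ContMDiffAt.comp _ ?_ (contMDiffAt_chart_symm (chart_mem_atlas E x)
        ((chartAt E x).map_source (mem_chart_source E x)))
      rwa [hcx]
    exact (contMDiffAt_iff_contDiffAt.1 this).differentiableAt hn
  have h3 : (diff f x : E →L[ℝ] ℝ) = fderiv ℝ (fun y => f ((chartAt E x).symm y)) (chartAt E x x) :=
    dmap_eq_fderiv hfx
  obtain ⟨α, hα⟩ : ∃ α : E →L[ℝ] ℝ, α = diff f x := ⟨_, rfl⟩
  obtain ⟨β, hβ⟩ : ∃ β : E →L[ℝ] ℝ, β = θ x := ⟨_, rfl⟩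
  have h4 : fderiv ℝ (localRep (fun y => f y • θ y) (chartAt E x)) (chartAt E x x) =
      f x • fderiv ℝ (localRep θ (chartAt E x)) (chartAt E x x) + α.smulRight β := by
    rw [localRep_smul, fderiv_fun_smul h2 h1, hcx, ← h3, localRep_self, hα, hβ]
  have key : alt (f x • fderiv ℝ (localRep θ (chartAt E x)) (chartAt E x x) + α.smulRight β) =
      form1 α * form1 β + f x • alt (fderiv ℝ (localRep θ (chartAt E x)) (chartAt E x x)) := by
    rw [alt_add, alt_smul, alt_smulRight, add_comm]
  rw [hα, hβ] at key
  exact (congrArg alt h4).trans (by rw [hα, hβ]; exact key)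

/-- `df` is the pull-back of `dt`, whose coefficient is constant, so naturality reduces `d(df) = 0`
to the real line. -/
lemma extD_diff {f : N → ℝ} {U : Set N} (hU : IsOpen U)
    (hf : ContMDiffOn 𝓘(ℝ, E) 𝓘(ℝ, ℝ) ∞ f U) {x : N} (hx : x ∈ U) :
    extD (diff f : OneForm E N) x = 0 := by
  have h0 : extD dt (f x) = 0 := by
    have : fderiv ℝ (localRep dt (chartAt ℝ (f x))) (chartAt ℝ (f x) (f x)) = 0 := by
      rw [localRep_dt (chart_mem_atlas ℝ _)]
      simp
    exact (congrArg alt this).trans (alt_eq_zero_of_symm fun v w => rfl)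
  rw [diff_eq_pb, extD_pb hU isOpen_univ hf smoothOn_dt hx trivial, h0]
  exact map_zero (pull (dmap E ℝ f x))

lemma extD_neg {θ : OneForm E N} {U : Set N} (hU : IsOpen U) (h : SmoothOn θ U)
    {x : N} (hx : x ∈ U) : extD (fun y => -θ y) x = -extD θ x := by
  have h1 := extD_smul hU (contMDiffOn_const (c := (-1 : ℝ))) h hx
  rw [diff_const, form1_zero, zero_mul, zero_add, neg_one_smul] at h1
  rw [← h1]
  exact extD_congr hU hx fun y _ => (neg_one_smul ℝ (θ y)).symm

lemma extD_sub {θ θ' : OneForm E N} {U : Set N} (hU : IsOpen U) (h : SmoothOn θ U)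
    (h' : SmoothOn θ' U) {x : N} (hx : x ∈ U) :
    extD (fun y => θ y - θ' y) x = extD θ x - extD θ' x := by
  simp only [sub_eq_add_neg]
  rw [extD_add hU h h'.neg hx, extD_neg hU h' hx]

lemma extD_sum {ι : Type*} (t : Finset ι) {θ : ι → OneForm E N} {U : Set N} (hU : IsOpen U)
    (h : ∀ i ∈ t, SmoothOn (θ i) U) {x : N} (hx : x ∈ U) :
    extD (fun y => ∑ i ∈ t, θ i y) x = ∑ i ∈ t, extD (θ i) x := by
  classical
  induction t using Finset.induction_on with
  | empty =>
    have h1 := extD_diff (E := E) (x := x) isOpen_univ (contMDiffOn_const (c := (0 : ℝ))) trivial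
    simp only [Finset.sum_empty]
    rw [← h1]
    exact extD_congr isOpen_univ trivial fun y _ => (diff_const 0 y).symm
  | insert a t ha ih =>
    simp only [Finset.sum_insert ha]
    rw [extD_add hU (h a (by simp)) (smoothOn_sum t fun i hi => h i (by simp [hi])) hx,
      ih fun i hi => h i (by simp [hi])]

lemma extD_sum_smul {ι : Type*} (t : Finset ι) {f : ι → N → ℝ} {θ : ι → OneForm E N} {U : Set N}
    (hU : IsOpen U) (hf : ∀ i, ContMDiffOn 𝓘(ℝ, E) 𝓘(ℝ, ℝ) ∞ (f i) U)
    (h : ∀ i, SmoothOn (θ i) U) {x : N} (hx : x ∈ U) :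
    extD (fun y => ∑ i ∈ t, f i y • θ i y) x =
      ∑ i ∈ t, (form1 (diff (f i) x : Cot E x) * form1 (θ i x) + f i x • extD (θ i) x) := by
  rw [extD_sum t (θ := fun i y => f i y • θ i y) hU (fun i _ => (h i).smul (hf i)) hx]
  exact Finset.sum_congr rfl fun i _ => extD_smul hU (hf i) (h i) hx

end ExteriorDerivative

/-! ### Smooth coefficients, first integrals, and independence of the coframe. -/

section Coframes

variable {E : Type*} [NormedAddCommGroup E] [NormedSpace ℝ E]
  {N : Type*} [TopologicalSpace N] [ChartedSpace E N]
  [IsManifold 𝓘(ℝ, E) ∞ N] [FiniteDimensional ℝ E]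

lemma mfderiv_chart_symm_bijective {c : OpenPartialHomeomorph N E} (hc : c ∈ atlas E N) {y : E}
    (hy : y ∈ c.target) : Function.Bijective (mfderiv 𝓘(ℝ, E) 𝓘(ℝ, E) c.symm y) := by
  have : IsManifold 𝓘(ℝ, E) 1 N := IsManifold.of_le (n := ∞) (by norm_num)
  exact (mdifferentiable_of_mem_atlas (I := 𝓘(ℝ, E)) hc).symm.mfderiv_bijective (x := y) hy

/-- A smooth 1-form has smooth coefficients in a smooth coframe. -/
lemma exists_coeff {ι : Type*} [Fintype ι] {τ : ι → OneForm E N} {U : Set N} (hU : IsOpen U)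
    (hτ : ∀ i, SmoothOn (τ i) U)
    (hb : ∀ x ∈ U, Function.Bijective (fun (v : Tan E x) i => τ i x v))
    {θ : OneForm E N} (hθ : SmoothOn θ U) :
    ∃ f : ι → N → ℝ, (∀ i, ContMDiffOn 𝓘(ℝ, E) 𝓘(ℝ, ℝ) ∞ (f i) U) ∧
      ∀ x ∈ U, θ x = ∑ i, f i x • τ i x := by
  classical
  have hw : ∀ x : N, ∃ w : ι → Tan E x, x ∈ U → ∀ i j, τ i x (w j) = if i = j then 1 else 0 := by
    intro x
    by_cases hx : x ∈ U
    · choose w hw using fun j : ι => (hb x hx).2 (fun i => if i = j then 1 else 0)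
      exact ⟨w, fun _ i j => congrFun (hw j) i⟩
    · exact ⟨fun _ => 0, fun h => absurd h hx⟩
  choose w hw using hw
  -- The coefficients are the values on the dual frame `w`. In a chart `w` is the inverse of the
  -- coframe matrix applied to unit vectors, and inversion is smooth.
  refine ⟨fun i x => θ x (w x i), ?_, ?_⟩
  · intro i x₀ hx₀
    refine ContMDiffAt.contMDiffWithinAt ?_
    set c := chartAt E x₀ with hc
    have hcs := mem_chart_source E x₀
    have hcx : c.symm (c x₀) = x₀ := c.left_inv hcs
    let frame : E → (E →L[ℝ] (ι → ℝ)) := fun y =>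
      ContinuousLinearMap.pi fun i => localRep (τ i) c y
    have hframe : ContDiffAt ℝ ∞ frame (c x₀) := by
      have h1 : ContDiffOn ℝ ∞ frame (c.target ∩ c.symm ⁻¹' U) :=
        contDiffOn_clm_apply.2 fun v => contDiffOn_pi.2 fun i =>
          ((hτ i) c (chart_mem_atlas E x₀)).clm_apply contDiffOn_const
      exact h1.contDiffAt ((c.isOpen_inter_preimage_symm hU).mem_nhds
        ⟨c.map_source hcs, by rwa [Set.mem_preimage, hcx]⟩)
    have hinv : ∀ y ∈ c.target, c.symm y ∈ U → Function.Bijective (frame y) := fun y hy hyU =>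
      (hb _ hyU).comp (mfderiv_chart_symm_bijective (chart_mem_atlas E x₀) hy)
    have hinv' : ∀ y ∈ c.target, c.symm y ∈ U → (frame y).IsInvertible := fun y hy hyU =>
      ⟨(LinearEquiv.ofBijective (frame y : E →ₗ[ℝ] _) (hinv y hy hyU)).toContinuousLinearEquiv, by
        ext1 v; rfl⟩
    have hmem : c.symm (c x₀) ∈ U := by rwa [hcx]
    have : CompleteSpace E := FiniteDimensional.complete ℝ E
    have h3 : ContDiffAt ℝ ∞ (fun y => (frame y).inverse) (c x₀) :=
      ContDiffAt.comp (g := ContinuousLinearMap.inverse) (c x₀)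
        (hinv' _ (c.map_source hcs) hmem).contDiffAt_map_inverse hframe
    have h4 : ContDiffAt ℝ ∞ (fun y => localRep θ c y ((frame y).inverse (Pi.single i 1))) (c x₀) :=
      (hθ.contDiffAt_chart hU hx₀).clm_apply (h3.clm_apply contDiffAt_const)
    have h5 : ContMDiffAt 𝓘(ℝ, E) 𝓘(ℝ, ℝ) ∞
        ((fun y => localRep θ c y ((frame y).inverse (Pi.single i 1))) ∘ c) x₀ :=
      (contMDiffAt_iff_contDiffAt.2 h4).comp x₀ (contMDiffAt_chart (chart_mem_atlas E x₀) hcs)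
    refine h5.congr_of_eventuallyEq ?_
    filter_upwards [c.open_source.mem_nhds hcs, hU.mem_nhds hx₀] with x hx hxU
    have e1 : c.symm (c x) = x := c.left_inv hx
    have hyU : c.symm (c x) ∈ U := by rwa [e1]
    have e2 : mfderiv 𝓘(ℝ, E) 𝓘(ℝ, E) c.symm (c x) ((frame (c x)).inverse (Pi.single i 1)) =
        w (c.symm (c x)) i := by
      apply (hb _ hyU).1
      ext k
      have e3 := (hinv' _ (c.map_source hx) hyU).self_apply_inverse (Pi.single i (1 : ℝ))
      refine (congrFun e3 k).trans ?_
      beta_reduce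
      rw [hw _ hyU, Pi.single_apply]
    have e4 : localRep θ c (c x) ((frame (c x)).inverse (Pi.single i 1)) =
        θ (c.symm (c x)) (w (c.symm (c x)) i) := congrArg (θ (c.symm (c x))) e2
    rw [Function.comp_apply, e4, e1]
  · intro x hx
    ext v
    have hv : v = ∑ i, τ i x v • w x i := by
      apply (hb x hx).1
      ext k
      simp [hw x hx]
    conv_lhs => rw [hv]
    simp [mul_comm]

/-- First integrals may be restricted to smaller neighbourhoods, so only the germ of the Pfaffian
system at `x` matters. -/
lemma firstIntegrals_congr {U U' O : Set N} {V V' : ∀ x : N, Submodule ℝ (Cot E x)} {x : N}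
    (hU : IsOpen U) (hU' : IsOpen U') (hO : IsOpen O) (hx : x ∈ U) (hx' : x ∈ U') (hxO : x ∈ O)
    (h : ∀ y ∈ O, V y = V' y) : firstIntegrals U V x = firstIntegrals U' V' x := by
  have key : ∀ {U U' : Set N} {V V' : ∀ x : N, Submodule ℝ (Cot E x)}, IsOpen U → IsOpen U' →
      x ∈ U → x ∈ U' → (∀ y ∈ O, V y = V' y) →
      firstIntegrals U V x ≤ firstIntegrals U' V' x := by
    intro U U' V V' hU hU' hx hx' h
    refine Submodule.span_mono ?_
    rintro α ⟨Q, f, hQ, hxQ, -, hf, hfV, rfl⟩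
    exact ⟨Q ∩ U' ∩ O, f, (hQ.inter hU').inter hO, ⟨⟨hxQ, hx'⟩, hxO⟩, fun y hy => hy.1.2,
      hf.mono fun y hy => hy.1.1, fun y hy => h y hy.2 ▸ hfV y hy.1.1, rfl⟩
  exact le_antisymm (key hU hU' hx hx' h) (key hU' hU hx' hx fun y hy => (h y hy).symm)

lemma diff_mem_firstIntegrals {U O : Set N} {V : ∀ x : N, Submodule ℝ (Cot E x)} {x : N}
    {f : N → ℝ} (hU : IsOpen U) (hO : IsOpen O) (hx : x ∈ U) (hxO : x ∈ O)
    (hf : ContMDiffOn 𝓘(ℝ, E) 𝓘(ℝ, ℝ) ∞ f O) (h : ∀ y ∈ O, diff f y ∈ V y) :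
    diff f x ∈ firstIntegrals U V x :=
  Submodule.subset_span ⟨O ∩ U, f, hO.inter hU, ⟨hxO, hx⟩, Set.inter_subset_right,
    hf.mono Set.inter_subset_left, fun y hy => h y hy.1, rfl⟩

lemma firstIntegrals_le {U : Set N} {V : ∀ x : N, Submodule ℝ (Cot E x)} {x : N} :
    firstIntegrals U V x ≤ V x := by
  refine Submodule.span_le.2 ?_
  rintro α ⟨O, f, -, hxO, -, -, hfV, rfl⟩
  exact hfV x hxO

namespace AdaptedCoframe

variable {s : ℕ} {I : FormIdeal E N} {U U' : Set N}

/-- Interchanging the two singular systems. -/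
def swap (c : AdaptedCoframe s I U) : AdaptedCoframe s I U where
  θ := c.θ
  σhat := c.σchk
  σchk := c.σhat
  smooth_θ := c.smooth_θ
  smooth_σhat := c.smooth_σchk
  smooth_σchk := c.smooth_σhat
  adapted x hx := (c.adapted x hx).swap

/-- All the 1-forms of an adapted coframe. -/
def all (c : AdaptedCoframe s I U) : Fin s ⊕ Fin 2 ⊕ Fin 2 → OneForm E N :=
  Sum.elim c.θ (Sum.elim c.σhat c.σchk)

lemma smooth_all (c : AdaptedCoframe s I U) : ∀ i, SmoothOn (c.all i) U := by
  rintro (i | i | i)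
  · exact c.smooth_θ i
  · exact c.smooth_σhat i
  · exact c.smooth_σchk i

lemma all_apply (c : AdaptedCoframe s I U) {x : N} (hx : x ∈ U) (i) :
    c.all i x = (c.adapted x hx).all i := by
  rcases i with i | i | i <;> rfl

lemma all_bijective (c : AdaptedCoframe s I U) {x : N} (hx : x ∈ U) :
    Function.Bijective (fun (v : Tan E x) i => c.all i x v) := by
  simp only [c.all_apply hx]
  exact (c.adapted x hx).all_bijective

lemma exists_coeff (c : AdaptedCoframe s I U) (hU : IsOpen U) {θ : OneForm E N}
    (hθ : SmoothOn θ U) : ∃ f : Fin s ⊕ Fin 2 ⊕ Fin 2 → N → ℝ,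
      (∀ i, ContMDiffOn 𝓘(ℝ, E) 𝓘(ℝ, ℝ) ∞ (f i) U) ∧ ∀ x ∈ U, θ x = ∑ i, f i x • c.all i x :=
  EDS.exists_coeff hU c.smooth_all (fun _ hx => c.all_bijective hx) hθ

/-- Restriction to a smaller set. -/
def restrict (c : AdaptedCoframe s I U) (h : U' ⊆ U) : AdaptedCoframe s I U' where
  θ := c.θ
  σhat := c.σhat
  σchk := c.σchk
  smooth_θ e := (c.smooth_θ e).mono h
  smooth_σhat a := (c.smooth_σhat a).mono h
  smooth_σchk a := (c.smooth_σchk a).mono h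
  adapted x hx := c.adapted x (h hx)

/-- Membership in the check system means that the two `σ̂` coefficients vanish; these are
continuous. -/
lemma not_mem_chkV_nhds (c : AdaptedCoframe s I U) (hU : IsOpen U) (hU' : IsOpen U') {x : N}
    (hx : x ∈ U) (hx' : x ∈ U') {g : OneForm E N} (hg : SmoothOn g U') (hgx : g x ∉ c.chkV x) :
    ∀ᶠ y in 𝓝 x, g y ∉ c.chkV y := by
  have hO := hU.inter hU'
  obtain ⟨f, hf, hfg⟩ := (c.restrict (Set.inter_subset_left : U ∩ U' ⊆ U)).exists_coeff hO
    (hg.mono Set.inter_subset_right)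
  have key : ∀ y (hy : y ∈ U ∩ U'), g y ∈ c.chkV y ↔ ∀ a : Fin 2, f (Sum.inr (Sum.inl a)) y = 0 := by
    intro y hy
    have h1 : g y ∈ c.chkV y ↔ _ := (c.adapted y hy.1).swap.mem_hat
    have h2 : ∀ m, g y ((c.adapted y hy.1).vec m 0) = ∑ a, f (Sum.inr (Sum.inl a)) y * m a := by
      intro m
      rw [hfg y hy]
      have e1 := (c.adapted y hy.1).θ_vec m 0
      have e2 := (c.adapted y hy.1).σhat_vec m 0
      have e3 := (c.adapted y hy.1).σchk_vec m 0
      beta_reduce at e1 e2 e3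
      simp [Fintype.sum_sum_type, all, restrict, e1, e2, e3]
    rw [h1]
    simp only [(c.adapted y hy.1).vec_swap, h2]
    constructor
    · intro H a
      have := H (Pi.single a 1)
      simpa [Pi.single_apply] using this
    · intro H n
      simp [H]
  rw [key x ⟨hx, hx'⟩] at hgx
  push Not at hgx
  obtain ⟨a, ha⟩ := hgx
  have hc : ContinuousAt (f (Sum.inr (Sum.inl a))) x :=
    ((hf _).contMDiffAt (hO.mem_nhds ⟨hx, hx'⟩)).continuousAt
  filter_upwards [hc.eventually_ne ha, hO.mem_nhds ⟨hx, hx'⟩] with y hy hyO hmem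
  exact hy ((key y hyO).1 hmem a)

/-- At nearby points the two pairs of singular systems agree or are interchanged. Since the hat and
check systems have equal rank and differ, some form of `c'.hatV` lies outside `c.chkV` at `x`; it
stays outside nearby, which rules out the interchange. -/
lemma eventually_hatV_eq (c : AdaptedCoframe s I U) (c' : AdaptedCoframe s I U') (hU : IsOpen U)
    (hU' : IsOpen U') {x : N} (hx : x ∈ U) (hx' : x ∈ U') (h : c'.hatV x = c.hatV x) :
    ∀ᶠ y in 𝓝 x, c'.hatV y = c.hatV y ∧ c'.chkV y = c.chkV y := by
  obtain ⟨g, hg, hgV, hgx⟩ : ∃ g : OneForm E N, SmoothOn g U' ∧ (∀ y, g y ∈ c'.hatV y) ∧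
      g x ∉ c.chkV x := by
    by_contra! hcon
    have hle : c'.hatV x ≤ c.chkV x := by
      refine Submodule.span_le.2 ?_
      rintro α (⟨e, rfl⟩ | ⟨a, rfl⟩)
      · exact hcon _ (c'.smooth_θ e) fun y => Submodule.subset_span (Or.inl ⟨e, rfl⟩)
      · exact hcon _ (c'.smooth_σhat a) fun y => Submodule.subset_span (Or.inr ⟨a, rfl⟩)
    rw [h] at hle
    have fd : FiniteDimensional ℝ (c.chkV x) :=
      FiniteDimensional.span_of_finite ℝ (Set.toFinite _)
    have h2 : c.hatV x = c.chkV x := Submodule.eq_of_le_of_finrank_eq hle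
      (((c.adapted x hx).finrank_hat).trans ((c.adapted x hx).swap.finrank_hat).symm)
    exact (c.adapted x hx).hat_ne_chk h2
  filter_upwards [c.not_mem_chkV_nhds hU hU' hx hx' hg hgx, hU.mem_nhds hx, hU'.mem_nhds hx']
    with y hy hyU hyU'
  rcases (c.adapted y hyU).hat_chk_unique (c'.adapted y hyU') with h1 | h1
  · exact h1
  · have h2 : c'.hatV y = c.chkV y := h1.1
    exact absurd (h2 ▸ hgV y) hy

/-- The bundles of first integrals do not depend on the coframe, up to interchange. -/
lemma firstIntegrals_unique (c : AdaptedCoframe s I U) (c' : AdaptedCoframe s I U')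
    (hU : IsOpen U) (hU' : IsOpen U') {x : N} (hx : x ∈ U) (hx' : x ∈ U') :
    (c'.hatV x = c.hatV x ∧ c'.chkV x = c.chkV x ∧
      firstIntegrals U' c'.hatV x = firstIntegrals U c.hatV x ∧
      firstIntegrals U' c'.chkV x = firstIntegrals U c.chkV x) ∨
    (c'.hatV x = c.chkV x ∧ c'.chkV x = c.hatV x ∧
      firstIntegrals U' c'.hatV x = firstIntegrals U c.chkV x ∧
      firstIntegrals U' c'.chkV x = firstIntegrals U c.hatV x) := by
  have key : ∀ c : AdaptedCoframe s I U, c'.hatV x = c.hatV x → c'.chkV x = c.chkV x →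
      c'.hatV x = c.hatV x ∧ c'.chkV x = c.chkV x ∧
      firstIntegrals U' c'.hatV x = firstIntegrals U c.hatV x ∧
      firstIntegrals U' c'.chkV x = firstIntegrals U c.chkV x := by
    intro c h h'
    obtain ⟨O, hO, hOo, hxO⟩ := eventually_nhds_iff.1 (c.eventually_hatV_eq c' hU hU' hx hx' h)
    exact ⟨h, h', firstIntegrals_congr hU' hU hOo hx' hx hxO fun y hy => (hO y hy).1,
      firstIntegrals_congr hU' hU hOo hx' hx hxO fun y hy => (hO y hy).2⟩
  rcases (c.adapted x hx).hat_chk_unique (c'.adapted x hx') with h | h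
  · exact Or.inl (key c h.1 h.2)
  · exact Or.inr (key c.swap h.1 h.2)

end AdaptedCoframe

end Coframes

/-! ### Smoothness of the slopes and tangent vectors of the prolongation space. -/

section ProlongationCharts

variable {E : Type*} [NormedAddCommGroup E] [NormedSpace ℝ E]
  {N : Type*} [TopologicalSpace N] [ChartedSpace E N]
  [FiniteDimensional ℝ E] {s : ℕ} {I : FormIdeal E N} {h : IsHyperbolic s I}

lemma dmap_clm {E₁ : Type*} [NormedAddCommGroup E₁] [NormedSpace ℝ E₁]
    (L : E →L[ℝ] E₁) (x : E) : (dmap E E₁ L x : E →L[ℝ] E₁) = L :=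
  (mfderiv_eq_fderiv).trans L.fderiv

namespace Prolongation

namespace ChartData

variable (d : ChartData h)

/-- Interchanging the two singular systems in the data of a chart. -/
def swap : ChartData h where
  U := d.U
  isOpen := d.isOpen
  c := d.c.swap
  i := d.j
  j := d.i
  q₀ := d.q₀

lemma good_swap {q : Prolongation h} : d.swap.Good q ↔ d.Good q := and_comm

lemma swap_source : d.swap.chart.source = d.chart.source := by
  ext q
  exact and_congr Iff.rfl (and_congr Iff.rfl d.good_swap)

lemma exists_elt {q : Prolongation h} (hq : q ∈ d.chart.source) :
    ∃ (x : N) (hx : x ∈ d.U) (a b : ℝ), x ∈ d.φ.source ∧ q = d.elt hx a b :=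
  ⟨q.1.1, hq.2.1, _, _, hq.1, d.eq_elt hq.2.1 hq.2.2⟩

variable [IsManifold 𝓘(ℝ, E) ∞ N]

/-- The charts of the prolongation space as local homeomorphisms. -/
def hom : OpenPartialHomeomorph (Prolongation h) (E × ℝ × ℝ) :=
  (core h).openPartialHomeomorph d.chart ⟨d, rfl⟩

lemma hom_mem : d.hom ∈ atlas (E × ℝ × ℝ) (Prolongation h) :=
  Set.mem_iUnion₂.2 ⟨d.chart, ⟨d, rfl⟩, rfl⟩

lemma hom_apply (q : Prolongation h) : d.hom q = (d.φ q.1.1, d.hatSlope q, d.chkSlope q) := rfl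

lemma isOpen_source : IsOpen d.chart.source := d.hom.open_source

lemma contMDiffAt_hom {q : Prolongation h} (hq : q ∈ d.chart.source) :
    ContMDiffAt 𝓘(ℝ, E × ℝ × ℝ) 𝓘(ℝ, E × ℝ × ℝ) ∞ d.hom q := contMDiffAt_chart d.hom_mem hq

lemma contMDiffOn_hom_comp {F : Type*} [NormedAddCommGroup F] [NormedSpace ℝ F]
    {g : E × ℝ × ℝ → F} (hg : ∀ p, p.1 ∈ d.φ.target → d.φ.symm p.1 ∈ d.U → ContDiffAt ℝ ∞ g p) :
    ContMDiffOn 𝓘(ℝ, E × ℝ × ℝ) 𝓘(ℝ, F) ∞ (fun q => g (d.hom q)) d.chart.source := by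
  intro q hq
  have ht := d.chart.map_source hq
  exact ((contMDiffAt_iff_contDiffAt.2 (hg _ ht.1 ht.2)).comp q
    (d.contMDiffAt_hom hq)).contMDiffWithinAt

lemma contMDiffOn_hatSlope : ContMDiffOn 𝓘(ℝ, E × ℝ × ℝ) 𝓘(ℝ, ℝ) ∞ d.hatSlope d.chart.source :=
  d.contMDiffOn_hom_comp (g := fun p => p.2.1) fun _ _ _ =>
    (contDiff_fst.comp contDiff_snd).contDiffAt

lemma contMDiffOn_chkSlope : ContMDiffOn 𝓘(ℝ, E × ℝ × ℝ) 𝓘(ℝ, ℝ) ∞ d.chkSlope d.chart.source :=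
  d.contMDiffOn_hom_comp (g := fun p => p.2.2) fun _ _ _ =>
    (contDiff_snd.comp contDiff_snd).contDiffAt

end ChartData

variable [IsManifold 𝓘(ℝ, E) ∞ N]

/-- In a chart the projection is the first component of `hom` followed by the inverse chart of the
base. -/
lemma contMDiff_base : ContMDiff 𝓘(ℝ, E × ℝ × ℝ) 𝓘(ℝ, E) ∞ (base h) := by
  intro q
  obtain ⟨d, hd⟩ := exists_chartData q
  have hd : q ∈ d.chart.source := hd
  have h1 : ContMDiffAt 𝓘(ℝ, E × ℝ × ℝ) 𝓘(ℝ, E) ∞ (fun q : Prolongation h => (d.hom q).1) q :=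
    (d.contMDiffOn_hom_comp (g := fun p => p.1) fun _ _ _ =>
      contDiff_fst.contDiffAt).contMDiffAt (d.isOpen_source.mem_nhds hd)
  have h2 : ContMDiffAt 𝓘(ℝ, E × ℝ × ℝ) 𝓘(ℝ, E) ∞
      (d.φ.symm ∘ fun q : Prolongation h => (d.hom q).1) q :=
    (contMDiffAt_chart_symm d.φ_mem (d.φ.map_source hd.1)).comp q h1
  refine h2.congr_of_eventuallyEq ?_
  filter_upwards [d.isOpen_source.mem_nhds hd] with q' hq'
  exact (d.φ.left_inv hq'.1).symm

/-- The differential of the projection. -/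
abbrev dbase (q : Prolongation h) : Tan (E × ℝ × ℝ) q →L[ℝ] Tan E q.1.1 :=
  dmap (E × ℝ × ℝ) E (base h) q

namespace ChartData

variable (d : ChartData h)

lemma dmap_clm_hom {q : Prolongation h} (hq : q ∈ d.chart.source) {F : Type*}
    [NormedAddCommGroup F] [NormedSpace ℝ F] (L : E × ℝ × ℝ →L[ℝ] F) :
    dmap (E × ℝ × ℝ) F (L ∘ d.hom) q = L.comp (dmap (E × ℝ × ℝ) (E × ℝ × ℝ) d.hom q) := by
  rw [dmap_comp (d.contMDiffAt_hom hq) (contMDiffAt_iff_contDiffAt.2 L.contDiff.contDiffAt)]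
  ext v
  exact DFunLike.congr_fun (dmap_clm L (d.hom q)) _

/-- A tangent vector of the prolongation space is determined by its projection and by the
derivatives of the two slopes. -/
lemma bijective_dbase {q : Prolongation h} (hq : q ∈ d.chart.source) :
    Function.Bijective (fun v : Tan (E × ℝ × ℝ) q =>
      ((dbase q v, diff d.hatSlope q v, diff d.chkSlope q v) : Tan E q.1.1 × ℝ × ℝ)) := by
  have hM : IsManifold 𝓘(ℝ, E) 1 N := IsManifold.of_le (n := ∞) (by norm_num)
  have hM' : IsManifold 𝓘(ℝ, E × ℝ × ℝ) 1 (Prolongation h) :=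
    IsManifold.of_le (n := ∞) (by norm_num)
  have hb1 : Function.Bijective (dmap (E × ℝ × ℝ) (E × ℝ × ℝ) d.hom q) :=
    (mdifferentiable_of_mem_atlas (I := 𝓘(ℝ, E × ℝ × ℝ)) d.hom_mem).mfderiv_bijective hq
  have hb2 : Function.Bijective (dmap E E d.φ q.1.1) :=
    (mdifferentiable_of_mem_atlas (I := 𝓘(ℝ, E)) d.φ_mem).mfderiv_bijective hq.1
  have hb3 : Function.Bijective (Prod.map (dmap E E d.φ q.1.1) (id : ℝ × ℝ → ℝ × ℝ)) :=
    hb2.prodMap Function.bijective_id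
  -- After composition with the differential of `φ` on the base component, the map becomes the
  -- differential of the chart `hom`.
  rw [← Function.Bijective.of_comp_iff' hb3]
  have hb1' : Function.Bijective (fun v : Tan (E × ℝ × ℝ) q =>
    (dmap (E × ℝ × ℝ) (E × ℝ × ℝ) d.hom q v : E × ℝ × ℝ)) := hb1
  refine (congrArg Function.Bijective (funext fun v => ?_)).mpr hb1'
  have e1 := DFunLike.congr_fun (d.dmap_clm_hom hq (ContinuousLinearMap.fst ℝ E (ℝ × ℝ))) v
  have e2 := DFunLike.congr_fun (d.dmap_clm_hom hq ((ContinuousLinearMap.fst ℝ ℝ ℝ).comp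
    (ContinuousLinearMap.snd ℝ E (ℝ × ℝ)))) v
  have e3 := DFunLike.congr_fun (d.dmap_clm_hom hq ((ContinuousLinearMap.snd ℝ ℝ ℝ).comp
    (ContinuousLinearMap.snd ℝ E (ℝ × ℝ)))) v
  have e4 := DFunLike.congr_fun (dmap_comp (contMDiff_base q)
    (contMDiffAt_chart d.φ_mem hq.1 : ContMDiffAt 𝓘(ℝ, E) 𝓘(ℝ, E) ∞ d.φ (base h q))) v
  exact Prod.ext (e4.symm.trans e1) (Prod.ext e2 e3)

end ChartData

lemma surjective_dbase (q : Prolongation h) : Function.Surjective (dbase q) := by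
  obtain ⟨d, hd⟩ := exists_chartData q
  intro u
  obtain ⟨v, hv⟩ := (d.bijective_dbase hd).2 (u, 0, 0)
  exact ⟨v, congrArg Prod.fst hv⟩

end Prolongation

end ProlongationCharts

/-! ### Forms of degree two and pull-back of ideals. -/

section TwoForms

variable {V W : Type*} [AddCommGroup V] [Module ℝ V] [TopologicalSpace V]
  [AddCommGroup W] [Module ℝ W] [TopologicalSpace W]

/-- Exterior forms of degree two. -/
def twoForms (V : Type*) [AddCommGroup V] [Module ℝ V] [TopologicalSpace V] :
    Submodule ℝ (Ext V) :=
  Submodule.span ℝ {η | ∃ α β : V →L[ℝ] ℝ, η = form1 α * form1 β}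

lemma form1_mul_mem_twoForms (α β : V →L[ℝ] ℝ) : form1 α * form1 β ∈ twoForms V :=
  Submodule.subset_span ⟨α, β, rfl⟩

lemma ev2_pull (L : V →L[ℝ] W) {η : Ext W} (hη : η ∈ twoForms W) (v w : V) :
    ev2 v w (pull L η) = ev2 (L v) (L w) η := by
  induction hη using Submodule.span_induction with
  | mem x hx =>
    obtain ⟨α, β, rfl⟩ := hx
    rw [map_mul, pull_form1, pull_form1, ev2_form1_mul, ev2_form1_mul]
    rfl
  | zero => simp
  | add x y _ _ hx hy => rw [map_add, map_add, map_add, hx, hy]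
  | smul c x _ hx => rw [pull_smul, map_smul, map_smul, hx]

/-- Linear extension of `form1_mul_sub_mem` from decomposable forms; it is applied to exterior
derivatives. -/
lemma twoForm_sub_mem {K : Ideal (Ext V)} {ω₁ ω₂ : V →L[ℝ] ℝ} {e f : V}
    (h11 : ω₁ e = 1) (h12 : ω₁ f = 0) (h21 : ω₂ e = 0) (h22 : ω₂ f = 1)
    (hK : ∀ α : V →L[ℝ] ℝ, α e = 0 → α f = 0 → form1 α ∈ K) {η : Ext V} (hη : η ∈ twoForms V) :
    η - ev2 e f η • (form1 ω₁ * form1 ω₂) ∈ K := by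
  induction hη using Submodule.span_induction with
  | mem x hx =>
    obtain ⟨α, β, rfl⟩ := hx
    exact form1_mul_sub_mem h11 h12 h21 h22 hK α β
  | zero => simp
  | add x y _ _ hx hy =>
    have := add_mem hx hy
    rw [map_add]
    convert! this using 1
    module
  | smul c x _ hx =>
    have := smul_mem_ideal c hx
    rw [map_smul]
    convert! this using 1
    rw [smul_sub, smul_smul, smul_eq_mul]

lemma pull_mem {L : V →L[ℝ] W} {K : Ideal (Ext W)} {K' : Ideal (Ext V)} {S : Set (Ext W)}
    (hK : K = Ideal.span S) (h : ∀ η ∈ S, pull L η ∈ K') {η : Ext W} (hη : η ∈ K) :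
    pull L η ∈ K' := by
  have h1 : K ≤ Ideal.comap (pull L) K' := by
    rw [hK, Ideal.span_le]
    exact h
  exact h1 hη

lemma bijective_of_zero [FiniteDimensional ℝ V] {s : ℕ} (hd : Module.finrank ℝ V = s + 4)
    {θ : Fin s → (V →L[ℝ] ℝ)} {σ τ : Fin 2 → (V →L[ℝ] ℝ)}
    (h : ∀ v, (∀ e, θ e v = 0) → (∀ a, σ a v = 0) → (∀ a, τ a v = 0) → v = 0) :
    Function.Bijective (fun v : V => ((fun e => θ e v, fun a => σ a v, fun a => τ a v) :
      (Fin s → ℝ) × (Fin 2 → ℝ) × (Fin 2 → ℝ))) := by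
  let T : V →ₗ[ℝ] (Fin s → ℝ) × (Fin 2 → ℝ) × (Fin 2 → ℝ) :=
    { toFun := fun v => (fun e => θ e v, fun a => σ a v, fun a => τ a v)
      map_add' := fun v w => by ext <;> simp
      map_smul' := fun c v => by ext <;> simp }
  have hT : Function.Injective T := by
    rw [injective_iff_map_eq_zero]
    intro v hv
    exact h v (fun e => congrFun (congrArg Prod.fst hv) e)
      (fun a => congrFun (congrArg (fun p => p.2.1) hv) a)
      (fun a => congrFun (congrArg (fun p => p.2.2) hv) a)
  exact ⟨hT, (LinearMap.injective_iff_surjective_of_finrank_eq_finrank (by simp [hd])).1 hT⟩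

lemma IsAdapted.finrank_eq {s : ℕ} {K : Ideal (Ext V)} {θ : Fin s → (V →L[ℝ] ℝ)}
    {σ τ : Fin 2 → (V →L[ℝ] ℝ)} (h : IsAdapted K θ σ τ) : Module.finrank ℝ V = s + 4 := by
  rw [h.ev.finrank_eq]
  simp

lemma IsAdapted.eq_zero_on_plane {s : ℕ} {K : Ideal (Ext V)} {θ : Fin s → (V →L[ℝ] ℝ)}
    {σ τ : Fin 2 → (V →L[ℝ] ℝ)} (h : IsAdapted K θ σ τ) {m n : Fin 2 → ℝ} {α : V →L[ℝ] ℝ}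
    (h1 : α (h.vec m 0) = 0) (h2 : α (h.vec 0 n) = 0) {u : V} (hu : u ∈ h.plane m n) :
    α u = 0 := by
  obtain ⟨r, t, rfl⟩ := Submodule.mem_span_pair.1 hu
  rw [map_add, map_smul, map_smul, h1, h2]
  simp

end TwoForms

/-! ### Exterior derivatives in charts and closure of hyperbolic ideals. -/

section ExtD

variable {E : Type*} [NormedAddCommGroup E] [NormedSpace ℝ E]
  {N : Type*} [TopologicalSpace N] [ChartedSpace E N]
  [IsManifold 𝓘(ℝ, E) ∞ N] [FiniteDimensional ℝ E]

lemma extD_mem_twoForms (θ : OneForm E N) (x : N) : extD θ x ∈ twoForms (Tan E x) :=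
  Submodule.sum_mem _ fun _ _ => form1_mul_mem_twoForms _ _

lemma extD_model (θ : OneForm E E) (y : E) :
    extD θ y = alt (fderiv ℝ (fun z => (θ z : E →L[ℝ] ℝ)) y) := by
  have : localRep θ (chartAt E y) = fun z => (θ z : E →L[ℝ] ℝ) := by
    ext z v
    rw [localRep]
    have : mfderiv 𝓘(ℝ, E) 𝓘(ℝ, E) (OpenPartialHomeomorph.refl E).symm z =
        ContinuousLinearMap.id ℝ E := mfderiv_id
    exact congrArg (θ z : E →L[ℝ] ℝ) (DFunLike.congr_fun this v)
  exact congrArg (fun g : E → E →L[ℝ] ℝ => alt (fderiv ℝ g y)) this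

/-- The exterior derivative in a chart. -/
lemma ev2_extD {σ : OneForm E N} {U : Set N} (hU : IsOpen U) (hσ : SmoothOn σ U)
    {c : OpenPartialHomeomorph N E} (hc : c ∈ atlas E N) {y : E} (hy : y ∈ c.target)
    (hyU : c.symm y ∈ U) (e f : E) :
    ev2 (V := Tan E (c.symm y)) (mfderiv 𝓘(ℝ, E) 𝓘(ℝ, E) c.symm y e)
      (mfderiv 𝓘(ℝ, E) 𝓘(ℝ, E) c.symm y f) (extD σ (c.symm y)) =
    fderiv ℝ (localRep σ c) y e f - fderiv ℝ (localRep σ c) y f e := by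
  have h1 := extD_pb (E := E) c.open_target hU
    (contMDiffOn_symm_of_mem_maximalAtlas (IsManifold.subset_maximalAtlas hc)) hσ hy hyU
  rw [extD_model] at h1
  have h2 := ev2_pull (dmap E E c.symm y) (extD_mem_twoForms σ (c.symm y)) e f
  rw [← h1] at h2
  exact h2.symm.trans (ev2_alt _ e f)

namespace AdaptedCoframe

variable {s : ℕ} {I : FormIdeal E N} {U : Set N}

/-- The smooth coefficients in the full coframe are used; those of `σ̂` and `σ̌` vanish because a
covector of the ideal is a combination of the `θᵉ`. -/
lemma exists_coeff_θ (c : AdaptedCoframe s I U) (hU : IsOpen U) {η : OneForm E N}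
    (hη : SmoothOn η U) (h : ∀ x ∈ U, form1 (η x) ∈ I x) :
    ∃ f : Fin s → N → ℝ, (∀ e, ContMDiffOn 𝓘(ℝ, E) 𝓘(ℝ, ℝ) ∞ (f e) U) ∧
      ∀ x ∈ U, η x = ∑ e, f e x • c.θ e x := by
  obtain ⟨f, hf, hfη⟩ := c.exists_coeff hU hη
  refine ⟨fun e => f (Sum.inl e), fun e => hf _, fun x hx => ?_⟩
  have h1 := (c.adapted x hx).mem_span_θ.1 ((c.adapted x hx).form1_mem.1 (h x hx))
  have h2 : ∀ m n : Fin 2 → ℝ, ∑ a, f (Sum.inr (Sum.inl a)) x * m a +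
      ∑ a, f (Sum.inr (Sum.inr a)) x * n a = 0 := by
    intro m n
    have e0 := h1 m n
    rw [hfη x hx] at e0
    have e1 := (c.adapted x hx).θ_vec m n
    have e2 := (c.adapted x hx).σhat_vec m n
    have e3 := (c.adapted x hx).σchk_vec m n
    beta_reduce at e1 e2 e3
    simpa [Fintype.sum_sum_type, all, e1, e2, e3] using e0
  have h3 : ∀ a, f (Sum.inr (Sum.inl a)) x = 0 := fun a => by
    simpa [Pi.single_apply] using h2 (Pi.single a 1) 0
  have h4 : ∀ a, f (Sum.inr (Sum.inr a)) x = 0 := fun a => by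
    simpa [Pi.single_apply] using h2 0 (Pi.single a 1)
  rw [hfη x hx]
  simp [Fintype.sum_sum_type, all, h3, h4]

/-- An ideal with an adapted coframe is closed under exterior differentiation if it contains the
exterior derivatives of the `θᵉ`. -/
lemma extD_mem (c : AdaptedCoframe s I U) (hU : IsOpen U)
    (hd : ∀ e, ∀ x ∈ U, extD (c.θ e) x ∈ I x) {O : Set N} (hO : IsOpen O) {η : OneForm E N}
    (hη : SmoothOn η O) (h : ∀ x ∈ O, form1 (η x) ∈ I x) {x : N} (hx : x ∈ U) (hxO : x ∈ O) :
    extD η x ∈ I x := by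
  have hUO := hU.inter hO
  obtain ⟨f, hf, hfη⟩ := (c.restrict (Set.inter_subset_left : U ∩ O ⊆ U)).exists_coeff_θ hUO
    (hη.mono Set.inter_subset_right) fun y hy => h y hy.2
  rw [extD_congr hUO ⟨hx, hxO⟩ hfη, extD_sum_smul _ hUO hf
    (fun e => (c.restrict (Set.inter_subset_left : U ∩ O ⊆ U)).smooth_θ e) ⟨hx, hxO⟩]
  refine Submodule.sum_mem _ fun e _ => add_mem (Ideal.mul_mem_left _ _ ?_)
    (smul_mem_ideal _ (hd e x hx))
  exact (c.adapted x hx).form1_mem.2 (Submodule.subset_span ⟨e, rfl⟩)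

end AdaptedCoframe

end ExtD

/-! ### Torsion of the contact forms. -/

section Structure

variable {E : Type*} [NormedAddCommGroup E] [NormedSpace ℝ E]
  {N : Type*} [TopologicalSpace N] [ChartedSpace E N]
  [FiniteDimensional ℝ E] {s : ℕ} {I : FormIdeal E N} {h : IsHyperbolic s I}
  [IsManifold 𝓘(ℝ, E) ∞ N]

namespace Prolongation

lemma mem_contact {q : Prolongation h} {β : Cot (E × ℝ × ℝ) q} : β ∈ contact q ↔
    ∃ α : Cot E q.1.1, (∀ v ∈ q.1.2, α v = 0) ∧ α.comp (dbase q) = β := Iff.rfl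

namespace ChartData

variable (d : ChartData h)

/-- The contact form `σ̂ⁱ' - a σ̂ⁱ`. -/
def con : OneForm (E × ℝ × ℝ) (Prolongation h) := fun q =>
  pb (base h) (d.c.σhat d.i.rev) q - d.hatSlope q • pb (base h) (d.c.σhat d.i) q

/-- The form `σ̂ⁱ`. -/
def om : OneForm (E × ℝ × ℝ) (Prolongation h) := pb (base h) (d.c.σhat d.i)

/-- The value of `dσ` on the plane with coordinates `p`. -/
def curl (σ : OneForm E N) (p : E × ℝ × ℝ) : ℝ :=
  fderiv ℝ (localRep σ d.φ) p.1 (d.vecRep p.1 (dir d.i p.2.1) 0) (d.vecRep p.1 0 (dir d.j p.2.2)) -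
  fderiv ℝ (localRep σ d.φ) p.1 (d.vecRep p.1 0 (dir d.j p.2.2)) (d.vecRep p.1 (dir d.i p.2.1) 0)

/-- The value of `d(σ̂ⁱ' - a σ̂ⁱ)` on the integral element. -/
def tor (q : Prolongation h) : ℝ :=
  d.curl (d.c.σhat d.i.rev) (d.hom q) - (d.hom q).2.1 * d.curl (d.c.σhat d.i) (d.hom q)

/-- The form `da + T σ̌ʲ` which satisfies `d(σ̂ⁱ' - a σ̂ⁱ) ≡ σ̂ⁱ ∧ (da + T σ̌ʲ)` modulo the contact
forms. -/
def pi : OneForm (E × ℝ × ℝ) (Prolongation h) := fun q =>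
  diff d.hatSlope q + d.tor q • pb (base h) (d.c.σchk d.j) q

lemma contDiffAt_curl {σ : OneForm E N} (hσ : SmoothOn σ d.U) {p : E × ℝ × ℝ}
    (hp : p.1 ∈ d.φ.target) (hpU : d.φ.symm p.1 ∈ d.U) : ContDiffAt ℝ ∞ (d.curl σ) p := by
  have h1 : ContDiffAt ℝ ∞ (fun p : E × ℝ × ℝ => fderiv ℝ (localRep σ d.φ) p.1) p :=
    ContDiffAt.comp (g := fderiv ℝ (localRep σ d.φ)) p
      ((d.contDiffAt_localRep d.isOpen hσ hp hpU).fderiv_right (m := ∞) (by simp)) contDiffAt_fst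
  have : CompleteSpace E := FiniteDimensional.complete ℝ E
  have h2 : ContDiffAt ℝ ∞ (fun p : E × ℝ × ℝ => (d.frame p.1).inverse) p :=
    ContDiffAt.comp (g := ContinuousLinearMap.inverse) p
      (d.frame_invertible hp hpU).contDiffAt_map_inverse
      ((d.contDiffAt_frame hp hpU).comp p contDiffAt_fst)
  have h3 : ContDiffAt ℝ ∞ (fun p : E × ℝ × ℝ => d.vecRep p.1 (dir d.i p.2.1) 0) p :=
    h2.clm_apply (contDiffAt_const.prodMk ((contDiffAt_dir d.i
      (contDiffAt_fst.comp p contDiffAt_snd)).prodMk contDiffAt_const))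
  have h4 : ContDiffAt ℝ ∞ (fun p : E × ℝ × ℝ => d.vecRep p.1 0 (dir d.j p.2.2)) p :=
    h2.clm_apply (contDiffAt_const.prodMk (contDiffAt_const.prodMk (contDiffAt_dir d.j
      (contDiffAt_snd.comp p contDiffAt_snd))))
  exact ((h1.clm_apply h3).clm_apply h4).sub ((h1.clm_apply h4).clm_apply h3)

lemma contMDiffOn_tor : ContMDiffOn 𝓘(ℝ, E × ℝ × ℝ) 𝓘(ℝ, ℝ) ∞ d.tor d.chart.source :=
  d.contMDiffOn_hom_comp (g := fun p => d.curl (d.c.σhat d.i.rev) p - p.2.1 *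
    d.curl (d.c.σhat d.i) p) fun p hp hpU =>
    (d.contDiffAt_curl (d.c.smooth_σhat _) hp hpU).sub
      ((contDiffAt_fst.comp p contDiffAt_snd).mul (d.contDiffAt_curl (d.c.smooth_σhat _) hp hpU))

lemma smoothOn_pb {σ : OneForm E N} (hσ : SmoothOn σ d.U) :
    SmoothOn (pb (E := E × ℝ × ℝ) (base h) σ) d.chart.source :=
  hσ.pb d.isOpen_source d.isOpen contMDiff_base.contMDiffOn fun _ hq => hq.2.1

lemma smoothOn_con : SmoothOn d.con d.chart.source :=
  (d.smoothOn_pb (d.c.smooth_σhat _)).sub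
    ((d.smoothOn_pb (d.c.smooth_σhat _)).smul d.contMDiffOn_hatSlope)

lemma smoothOn_om : SmoothOn d.om d.chart.source := d.smoothOn_pb (d.c.smooth_σhat _)

lemma smoothOn_pi : SmoothOn d.pi d.chart.source :=
  (smoothOn_diff d.isOpen_source d.contMDiffOn_hatSlope).add
    ((d.smoothOn_pb (d.c.smooth_σchk _)).smul d.contMDiffOn_tor)

/-- `curl` is defined by chart expressions, so that its smoothness in `(y, a, b)` is visible; this
is its invariant meaning. -/
lemma curl_eq {σ : OneForm E N} (hσ : SmoothOn σ d.U) {y : E} (hy : y ∈ d.φ.target) {x : N}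
    (hx : d.φ.symm y = x) (hxU : x ∈ d.U) (a b : ℝ) :
    d.curl σ (y, a, b) = ev2 ((d.c.adapted x hxU).vec (dir d.i a) 0)
      ((d.c.adapted x hxU).vec 0 (dir d.j b)) (extD σ x) := by
  subst hx
  rw [← d.dφ_vecRep hy hxU, ← d.dφ_vecRep hy hxU]
  exact (ev2_extD d.isOpen hσ d.φ_mem hy hxU _ _).symm

/-- These are the `s + 2` linear equations of `P`; the contact forms are their pull-backs. -/
lemma mem_plane_iff {q : Prolongation h} (hq : q ∈ d.chart.source) {u : Tan E q.1.1} :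
    u ∈ q.1.2 ↔ (∀ e, d.c.θ e q.1.1 u = 0) ∧
      d.c.σhat d.i.rev q.1.1 u = d.hatSlope q * d.c.σhat d.i q.1.1 u ∧
      d.c.σchk d.j.rev q.1.1 u = d.chkSlope q * d.c.σchk d.j q.1.1 u := by
  obtain ⟨x, hx, a, b, -, rfl⟩ := d.exists_elt hq
  rw [d.hatSlope_elt, d.chkSlope_elt]
  constructor
  · intro hu
    refine ⟨fun e => ?_, d.rel_elt hx a b u hu⟩
    obtain ⟨r, t, rfl⟩ := (d.c.adapted x hx).mem_plane.1 hu
    exact (d.c.adapted x hx).θ_vec _ _ e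
  · rintro ⟨h1, h2, h3⟩
    refine (d.c.adapted x hx).mem_plane.2 ⟨d.c.σhat d.i x u, d.c.σchk d.j x u, ?_⟩
    have key : ∀ (i k : Fin 2), k = i ∨ k = i.rev := by decide
    refine (d.c.adapted x hx).eq_vec h1 (fun k => ?_) fun k => ?_
    · rcases key d.i k with rfl | rfl
      · simp [dir_self]
      · rw [Pi.smul_apply, dir_rev, smul_eq_mul, mul_comm]; exact h2
    · rcases key d.j k with rfl | rfl
      · simp [dir_self]
      · rw [Pi.smul_apply, dir_rev, smul_eq_mul, mul_comm]; exact h3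

/-- `e` and `f` are the generators of `P` in the hat and check directions, normalised by `σ̂ⁱ` and
`σ̌ʲ`. Only the listed values enter the structure equations. -/
lemma exists_dual {q : Prolongation h} (hq : q ∈ d.chart.source) : ∃ e f : Tan E q.1.1,
    (∀ α : Cot E q.1.1, α e = 0 → α f = 0 → ∀ u ∈ q.1.2, α u = 0) ∧
    d.c.σhat d.i q.1.1 e = 1 ∧ d.c.σchk d.j q.1.1 f = 1 ∧
    (∀ k, d.c.σhat k q.1.1 f = 0) ∧ (∀ k, d.c.σchk k q.1.1 e = 0) ∧
    (∀ k, d.c.θ k q.1.1 e = 0) ∧ (∀ k, d.c.θ k q.1.1 f = 0) ∧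
    d.tor q = ev2 e f (extD (d.c.σhat d.i.rev) q.1.1) -
      d.hatSlope q * ev2 e f (extD (d.c.σhat d.i) q.1.1) := by
  obtain ⟨x, hx, a, b, hxφ, rfl⟩ := d.exists_elt hq
  have had := d.c.adapted x hx
  refine ⟨had.vec (dir d.i a) 0, had.vec 0 (dir d.j b), ?_, ?_, ?_, ?_, ?_, ?_, ?_, ?_⟩
  · intro α h1 h2 u hu
    exact had.eq_zero_on_plane h1 h2 hu
  · exact (had.σhat_vec _ _ d.i).trans (dir_self _ _)
  · exact (had.σchk_vec _ _ d.j).trans (dir_self _ _)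
  · exact fun k => had.σhat_vec _ _ k
  · exact fun k => had.σchk_vec _ _ k
  · exact fun k => had.θ_vec _ _ k
  · exact fun k => had.θ_vec _ _ k
  · have e1 : d.hom (d.elt hx a b) = (d.φ x, a, b) := by
      rw [hom_apply, d.hatSlope_elt, d.chkSlope_elt]
      rfl
    rw [tor, e1, d.hatSlope_elt,
      d.curl_eq (d.c.smooth_σhat _) (d.φ.map_source hxφ) (d.φ.left_inv hxφ) hx,
      d.curl_eq (d.c.smooth_σhat _) (d.φ.map_source hxφ) (d.φ.left_inv hxφ) hx]
    rfl

end ChartData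

end Prolongation

end Structure

/-! ### Structure equations; the prolongation is hyperbolic of class `s + 2`. -/

section Hyperbolic

variable {E : Type*} [NormedAddCommGroup E] [NormedSpace ℝ E]
  {N : Type*} [TopologicalSpace N] [ChartedSpace E N]
  [FiniteDimensional ℝ E] {s : ℕ} {I : FormIdeal E N} {h : IsHyperbolic s I}
  [IsManifold 𝓘(ℝ, E) ∞ N]

namespace Prolongation

/-- The algebraic ideal generated by the contact covectors. -/
abbrev contactIdeal (q : Prolongation h) : Ideal (Ext (Tan (E × ℝ × ℝ) q)) :=
  covIdeal (contact q : Set (Cot (E × ℝ × ℝ) q))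

lemma form1_mem_contactIdeal {q : Prolongation h} {β : Cot (E × ℝ × ℝ) q} (hβ : β ∈ contact q) :
    form1 β ∈ contactIdeal q := Ideal.subset_span ⟨β, hβ, rfl⟩

lemma contactIdeal_le (q : Prolongation h) : contactIdeal q ≤ system h q :=
  Ideal.span_mono Set.subset_union_left

namespace ChartData

variable (d : ChartData h)

lemma rev_or (i k : Fin 2) : k = i ∨ k = i.rev := by revert i k; decide

lemma con_mem_contact {q : Prolongation h} (hq : q ∈ d.chart.source) : d.con q ∈ contact q := by
  refine mem_contact.2 ⟨d.c.σhat d.i.rev q.1.1 - d.hatSlope q • d.c.σhat d.i q.1.1, ?_, rfl⟩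
  intro v hv
  have := ((d.mem_plane_iff hq).1 hv).2.1
  rw [sub_apply, smul_apply, smul_eq_mul, this, sub_self]

lemma θ_mem_contact {q : Prolongation h} (hq : q ∈ d.chart.source) (e : Fin s) :
    pb (base h) (d.c.θ e) q ∈ contact q :=
  mem_contact.2 ⟨d.c.θ e q.1.1, fun _ hv => ((d.mem_plane_iff hq).1 hv).1 e, rfl⟩

lemma swap_mem_source {q : Prolongation h} (hq : q ∈ d.chart.source) :
    q ∈ d.swap.chart.source := by rwa [swap_source]

/-- Covectors on the base which vanish on two dual vectors of the plane pull back to contact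
covectors; modulo these, a 2-form is a multiple of `σ̂ⁱ ∧ σ̌ʲ`. -/
lemma pull_twoForm_sub_mem {q : Prolongation h} {ω₁ ω₂ : Cot E q.1.1} {e f : Tan E q.1.1}
    (hef : ∀ α : Cot E q.1.1, α e = 0 → α f = 0 → ∀ u ∈ q.1.2, α u = 0)
    (h11 : ω₁ e = 1) (h12 : ω₁ f = 0) (h21 : ω₂ e = 0) (h22 : ω₂ f = 1)
    {η : Ext (Tan E q.1.1)} (hη : η ∈ twoForms (Tan E q.1.1)) :
    pull (dbase q) η - ev2 e f η • (form1 (ω₁.comp (dbase q)) * form1 (ω₂.comp (dbase q))) ∈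
      contactIdeal q := by
  have h1 := twoForm_sub_mem (K := covIdeal {α : Cot E q.1.1 | ∀ u ∈ q.1.2, α u = 0}) h11 h12 h21
    h22 (fun α h1 h2 => Ideal.subset_span ⟨α, hef α h1 h2, rfl⟩) hη
  have h2 := pull_mem (L := dbase q) (K' := contactIdeal q) rfl (by
    rintro _ ⟨α, hα, rfl⟩
    rw [pull_form1]
    exact form1_mem_contactIdeal (mem_contact.2 ⟨α, hα, rfl⟩)) h1
  rwa [map_sub, pull_smul, map_mul, pull_form1, pull_form1] at h2

/-- Modulo contact forms a 2-form on the base reduces to its value on `(e, f)`. That value is zero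
for `σ̂⁰ ∧ σ̂¹` because the `σ̂` kill `f`, and for `σ̌⁰ ∧ σ̌¹` because the `σ̌` kill `e`. -/
lemma pull_mem_contactIdeal {q : Prolongation h} {η : Ext (Tan E q.1.1)}
    (hη : η ∈ I q.1.1) : pull (dbase q) η ∈ contactIdeal q := by
  obtain ⟨d, hq⟩ := exists_chartData q
  obtain ⟨e, f, hef, h11, h22, h12, h21, -, -, -⟩ := d.exists_dual hq
  refine pull_mem (d.c.adapted _ hq.2.1).generates ?_ hη
  rintro _ (⟨k, rfl⟩ | rfl | rfl)
  · rw [pull_form1]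
    exact form1_mem_contactIdeal (d.θ_mem_contact hq k)
  · have := pull_twoForm_sub_mem hef h11 (h12 _) (h21 _) h22
      (form1_mul_mem_twoForms (d.c.σhat 0 q.1.1) (d.c.σhat 1 q.1.1))
    rwa [ev2_form1_mul, h12, h12, mul_zero, zero_mul, sub_zero, zero_smul, sub_zero] at this
  · have := pull_twoForm_sub_mem hef h11 (h12 _) (h21 _) h22
      (form1_mul_mem_twoForms (d.c.σchk 0 q.1.1) (d.c.σchk 1 q.1.1))
    rwa [ev2_form1_mul, h21, h21, mul_zero, zero_mul, sub_zero, zero_smul, sub_zero] at this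

lemma extD_pb_base {σ : OneForm E N} (hσ : SmoothOn σ d.U) {q : Prolongation h}
    (hq : q ∈ d.chart.source) :
    extD (pb (E := E × ℝ × ℝ) (base h) σ) q = pull (dbase q) (extD σ q.1.1) :=
  extD_pb isOpen_univ d.isOpen contMDiff_base.contMDiffOn hσ trivial hq.2.1

lemma extD_con {q : Prolongation h} (hq : q ∈ d.chart.source) :
    extD d.con q = pull (dbase q) (extD (d.c.σhat d.i.rev) q.1.1 -
      d.hatSlope q • extD (d.c.σhat d.i) q.1.1) -
      form1 (diff d.hatSlope q : Cot (E × ℝ × ℝ) q) * form1 (d.om q) := by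
  have h1 := extD_sub d.isOpen_source (d.smoothOn_pb (d.c.smooth_σhat d.i.rev))
    ((d.smoothOn_pb (d.c.smooth_σhat d.i)).smul d.contMDiffOn_hatSlope) hq
  rw [extD_smul d.isOpen_source d.contMDiffOn_hatSlope (d.smoothOn_pb (d.c.smooth_σhat d.i)) hq,
    d.extD_pb_base (d.c.smooth_σhat _) hq, d.extD_pb_base (d.c.smooth_σhat _) hq] at h1
  refine h1.trans ?_
  rw [map_sub, pull_smul, om]
  abel

/-- The structure equation of the contact form. -/
lemma extD_con_sub_mem {q : Prolongation h} (hq : q ∈ d.chart.source) :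
    extD d.con q - form1 (d.om q) * form1 (d.pi q) ∈ contactIdeal q := by
  obtain ⟨e, f, hef, h11, h22, h12, h21, -, -, ht⟩ := d.exists_dual hq
  -- The part of `d(σ̂ⁱ' - a σ̂ⁱ)` coming from the base reduces to `tor` times `σ̂ⁱ ∧ σ̌ʲ`; adding
  -- `-da ∧ σ̂ⁱ` completes it to `om ∧ pi`.
  have h1 := pull_twoForm_sub_mem hef h11 (h12 _) (h21 _) h22
    (sub_mem (extD_mem_twoForms (d.c.σhat d.i.rev) q.1.1)
      (Submodule.smul_mem _ (d.hatSlope q) (extD_mem_twoForms (d.c.σhat d.i) q.1.1)))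
  rw [map_sub (ev2 e f), map_smul (ev2 e f), smul_eq_mul, ← ht] at h1
  convert! h1 using 1
  rw [d.extD_con hq]
  have e1 : form1 (d.pi q) = form1 (diff d.hatSlope q : Cot (E × ℝ × ℝ) q) +
      d.tor q • form1 (pb (base h) (d.c.σchk d.j) q) := by
    rw [pi, form1_add, form1_smul]
  have e2 := form1_mul_swap (diff d.hatSlope q : Cot (E × ℝ × ℝ) q) (d.om q)
  rw [e1, mul_add, e2, mul_smul_comm, sub_neg_eq_add]
  have e3 : ∀ A B C : Ext (Tan (E × ℝ × ℝ) q), A + B - (B + C) = A - C := fun A B C => by abel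
  exact e3 _ _ _

/-- The contact forms of the prolongation in the domain of a chart. -/
def conAll : Fin (s + 2) → OneForm (E × ℝ × ℝ) (Prolongation h) :=
  Fin.append (fun e => pb (base h) (d.c.θ e)) ![d.con, d.swap.con]

lemma forall_conAll {p : OneForm (E × ℝ × ℝ) (Prolongation h) → Prop} :
    (∀ k, p (d.conAll k)) ↔ (∀ e, p (pb (base h) (d.c.θ e))) ∧ p d.con ∧ p d.swap.con := by
  rw [conAll, Fin.forall_fin_add]
  simp only [Fin.append_left, Fin.append_right, Fin.forall_fin_two, Matrix.cons_val_zero,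
    Matrix.cons_val_one]

lemma contact_eq_span {q : Prolongation h} (hq : q ∈ d.chart.source) :
    contact q = Submodule.span ℝ (Set.range fun k => d.conAll k q) := by
  apply le_antisymm
  · intro β hβ
    obtain ⟨α, hα, rfl⟩ := mem_contact.1 hβ
    rw [mem_span_range_iff]
    intro v hv
    have h1 := (d.forall_conAll (p := fun η => η q v = 0)).1 hv
    refine hα _ ((d.mem_plane_iff hq).2 ⟨h1.1, sub_eq_zero.1 h1.2.1, sub_eq_zero.1 h1.2.2⟩)
  · rw [Submodule.span_le]
    rintro _ ⟨k, rfl⟩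
    revert k
    exact (d.forall_conAll (p := fun η => η q ∈ contact q)).2
      ⟨d.θ_mem_contact hq, d.con_mem_contact hq, d.swap.con_mem_contact (d.swap_mem_source hq)⟩

/-- A description free of charts. It makes it immediate that a map which respects projections and
planes pulls contact covectors back to contact covectors. -/
lemma mem_contact_iff {q : Prolongation h} {β : Cot (E × ℝ × ℝ) q} :
    β ∈ contact q ↔ ∀ v, dbase q v ∈ q.1.2 → β v = 0 := by
  constructor
  · intro hβ v hv
    obtain ⟨α, hα, rfl⟩ := mem_contact.1 hβ
    exact hα _ hv
  · intro hβ
    obtain ⟨d, hq⟩ := exists_chartData q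
    have hq : q ∈ d.chart.source := hq
    rw [d.contact_eq_span hq, mem_span_range_iff]
    intro v hv
    have h1 := (d.forall_conAll (p := fun η => η q v = 0)).1 hv
    exact hβ v ((d.mem_plane_iff hq).2 ⟨h1.1, sub_eq_zero.1 h1.2.1, sub_eq_zero.1 h1.2.2⟩)

/-- The ideal generated by the contact forms and the structure equations. -/
def alg : FormIdeal (E × ℝ × ℝ) (Prolongation h) := fun q =>
  Ideal.span (Set.range (fun k => form1 (d.conAll k q)) ∪
    {form1 (d.om q) * form1 (d.pi q), form1 (d.swap.om q) * form1 (d.swap.pi q)})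

/-- If `v` is killed by the contact forms and by `σ̂ⁱ`, `σ̌ʲ`, then all coframe members of the base
vanish on its projection, so `v` is vertical. On vertical vectors the remaining two forms are `da`
and `db`. -/
lemma coframe_bijective {q : Prolongation h} (hq : q ∈ d.chart.source) :
    Function.Bijective (fun v : Tan (E × ℝ × ℝ) q =>
      ((fun k => d.conAll k q v, fun a => (![d.om, d.pi] a : OneForm _ _) q v,
        fun a => (![d.swap.om, d.swap.pi] a : OneForm _ _) q v) :
      (Fin (s + 2) → ℝ) × (Fin 2 → ℝ) × (Fin 2 → ℝ))) := by
  have : FiniteDimensional ℝ (Tan (E × ℝ × ℝ) q) :=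
    inferInstanceAs (FiniteDimensional ℝ (E × ℝ × ℝ))
  refine bijective_of_zero (V := Tan (E × ℝ × ℝ) q) (θ := fun k => d.conAll k q)
    (σ := fun a => (![d.om, d.pi] a : OneForm _ _) q)
    (τ := fun a => (![d.swap.om, d.swap.pi] a : OneForm _ _) q) ?_ ?_
  · have h1 : Module.finrank ℝ E = s + 4 := (d.c.adapted q.1.1 hq.2.1).finrank_eq
    have h2 : Module.finrank ℝ (E × ℝ × ℝ) = s + 2 + 4 := by simp [h1]
    exact h2
  · intro v h1 h2 h3
    obtain ⟨e1, e2, e3⟩ := (d.forall_conAll (p := fun η => η q v = 0)).1 h1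
    have o1 : d.c.σhat d.i q.1.1 (dbase q v) = 0 := h2 0
    have o2 : d.c.σchk d.j q.1.1 (dbase q v) = 0 := h3 0
    have p1 : diff d.hatSlope q v + d.tor q * d.c.σchk d.j q.1.1 (dbase q v) = 0 := h2 1
    have p2 : diff d.chkSlope q v + d.swap.tor q * d.c.σhat d.i q.1.1 (dbase q v) = 0 := h3 1
    have e2' : d.c.σhat d.i.rev q.1.1 (dbase q v) -
      d.hatSlope q * d.c.σhat d.i q.1.1 (dbase q v) = 0 := e2
    have e3' : d.c.σchk d.j.rev q.1.1 (dbase q v) -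
      d.chkSlope q * d.c.σchk d.j q.1.1 (dbase q v) = 0 := e3
    rw [o1, mul_zero, sub_zero] at e2'
    rw [o2, mul_zero, sub_zero] at e3'
    rw [o2, mul_zero, add_zero] at p1
    rw [o1, mul_zero, add_zero] at p2
    have hb : dbase q v = 0 := by
      refine (d.c.adapted q.1.1 hq.2.1).eq_zero_of_coords e1 (fun k => ?_) fun k => ?_
      · rcases rev_or d.i k with rfl | rfl <;> assumption
      · rcases rev_or d.j k with rfl | rfl <;> assumption
    apply (d.bijective_dbase hq).1
    simp only [hb, p1, p2, map_zero]

/-- The adapted coframe of the prolongation in the domain of a chart. -/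
def algCoframe : AdaptedCoframe (s + 2) d.alg d.chart.source where
  θ := d.conAll
  σhat := ![d.om, d.pi]
  σchk := ![d.swap.om, d.swap.pi]
  smooth_θ := (d.forall_conAll (p := fun η => SmoothOn η d.chart.source)).2
    ⟨fun e => d.smoothOn_pb (d.c.smooth_θ e), d.smoothOn_con, d.swap_source ▸ d.swap.smoothOn_con⟩
  smooth_σhat := Fin.forall_fin_two.2 ⟨d.smoothOn_om, d.smoothOn_pi⟩
  smooth_σchk := Fin.forall_fin_two.2 ⟨d.swap_source ▸ d.swap.smoothOn_om,
    d.swap_source ▸ d.swap.smoothOn_pi⟩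
  adapted _ hq := ⟨d.coframe_bijective hq, rfl⟩

lemma contactIdeal_le_alg {q : Prolongation h} (hq : q ∈ d.chart.source) :
    contactIdeal q ≤ d.alg q := by
  refine Ideal.span_le.2 ?_
  rintro _ ⟨β, hβ, rfl⟩
  have hβ : β ∈ contact q := hβ
  rw [d.contact_eq_span hq] at hβ
  exact (d.algCoframe.adapted q hq).form1_mem.2 hβ

lemma extD_con_mem_alg {q : Prolongation h} (hq : q ∈ d.chart.source) :
    extD d.con q ∈ d.alg q := by
  have h1 := d.contactIdeal_le_alg hq (d.extD_con_sub_mem hq)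
  have h2 := add_mem h1 (Ideal.subset_span (Or.inr (Or.inl rfl)) :
    form1 (d.om q) * form1 (d.pi q) ∈ d.alg q)
  rwa [sub_add_cancel] at h2

lemma extD_swap_con_mem_alg {q : Prolongation h} (hq : q ∈ d.chart.source) :
    extD d.swap.con q ∈ d.alg q := by
  have h1 := d.contactIdeal_le_alg hq (d.swap.extD_con_sub_mem (d.swap_mem_source hq))
  have h2 := add_mem h1 (Ideal.subset_span (Or.inr (Or.inr rfl)) :
    form1 (d.swap.om q) * form1 (d.swap.pi q) ∈ d.alg q)
  rwa [sub_add_cancel] at h2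

/-- Closure of `I` puts `dθ` into `I`, and elements of `I` vanish on integral elements. -/
lemma extD_θ_mem_contactIdeal {q : Prolongation h} (hq : q ∈ d.chart.source) (e : Fin s) :
    extD (pb (base h) (d.c.θ e) : OneForm (E × ℝ × ℝ) _) q ∈ contactIdeal q := by
  rw [d.extD_pb_base (d.c.smooth_θ e) hq]
  refine pull_mem_contactIdeal (h.closed d.U d.isOpen _ (d.c.smooth_θ e) (fun x hx => ?_) _ hq.2.1)
  exact (d.c.adapted x hx).form1_mem.2 (Submodule.subset_span ⟨e, rfl⟩)

lemma extD_mem_system {O : Set (Prolongation h)} {η : OneForm (E × ℝ × ℝ) (Prolongation h)}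
    (hO : IsOpen O) {q : Prolongation h} (hq : q ∈ O) (hη : SmoothOn η O)
    (hc : ∀ q' ∈ O, η q' ∈ contact q') : extD η q ∈ system h q :=
  Ideal.subset_span (Or.inr ⟨O, η, hO, hq, hη, hc, rfl⟩)

/-- The algebraic ideal contains the derivatives of its contact generators, hence those of every
smooth contact form. Conversely `om ∧ pi` is the derivative of a contact form minus an element of
the contact ideal. -/
lemma system_eq_alg {q : Prolongation h} (hq : q ∈ d.chart.source) : system h q = d.alg q := by
  apply le_antisymm
  · refine Ideal.span_le.2 (Set.union_subset ?_ ?_)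
    · exact (Ideal.subset_span).trans (d.contactIdeal_le_alg hq)
    · rintro _ ⟨O, η, hO, hqO, hη, hc, rfl⟩
      have hdc : ∀ k, ∀ q ∈ d.chart.source, extD (d.conAll k) q ∈ d.alg q :=
        (d.forall_conAll (p := fun η => ∀ q ∈ d.chart.source, extD η q ∈ d.alg q)).2
          ⟨fun e q hq => d.contactIdeal_le_alg hq (d.extD_θ_mem_contactIdeal hq e),
            fun q hq => d.extD_con_mem_alg hq, fun q hq => d.extD_swap_con_mem_alg hq⟩
      refine d.algCoframe.extD_mem d.isOpen_source hdc (hO.inter d.isOpen_source)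
        (hη.mono Set.inter_subset_left) (fun q' hq' => ?_) hq ⟨hqO, hq⟩
      exact d.contactIdeal_le_alg hq'.2 (form1_mem_contactIdeal (hc q' hq'.1))
  · refine Ideal.span_le.2 (Set.union_subset ?_ ?_)
    · rintro _ ⟨k, rfl⟩
      refine contactIdeal_le q (form1_mem_contactIdeal ?_)
      rw [d.contact_eq_span hq]
      exact Submodule.subset_span ⟨k, rfl⟩
    · have key : ∀ d : ChartData h, q ∈ d.chart.source →
          form1 (d.om q) * form1 (d.pi q) ∈ system h q := by
        intro d hq
        have h1 := contactIdeal_le q (d.extD_con_sub_mem hq)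
        have h2 : extD d.con q ∈ system h q := extD_mem_system d.isOpen_source hq d.smoothOn_con
          fun q' hq' => d.con_mem_contact hq'
        have h3 := sub_mem h2 h1
        rwa [sub_sub_cancel] at h3
      rintro _ (rfl | rfl)
      · exact key d hq
      · exact key d.swap (d.swap_mem_source hq)

/-- The adapted coframe of the prolongation in the domain of a chart. -/
def coframe : AdaptedCoframe (s + 2) (system h) d.chart.source where
  __ := d.algCoframe
  adapted q hq := by rw [d.system_eq_alg hq]; exact d.algCoframe.adapted q hq

end ChartData

/-- Adjoining derivatives creates no new covectors. Closure of the prolongation follows: a smooth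
1-form in it is a contact form, whose derivative belongs by definition. -/
lemma form1_mem_system {q : Prolongation h} {β : Cot (E × ℝ × ℝ) q} :
    form1 β ∈ system h q ↔ β ∈ contact q := by
  obtain ⟨d, hq⟩ := exists_chartData q
  have hq : q ∈ d.chart.source := hq
  rw [d.contact_eq_span hq]
  exact (d.coframe.adapted q hq).form1_mem

variable (h) in
/-- The prolongation of a class `s` hyperbolic system is a class `s + 2` hyperbolic system. -/
lemma isHyperbolic_system : IsHyperbolic (s + 2) (system h) where
  closed _ hO _ hη hc _ hq := ChartData.extD_mem_system hO hq hη fun _ hq' =>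
    form1_mem_system.1 (hc _ hq')
  exists_coframe q := by
    obtain ⟨d, hq⟩ := exists_chartData q
    exact ⟨_, d.isOpen_source, hq, ⟨d.coframe⟩⟩

end Prolongation

end Hyperbolic

/-! ### Adding one covector to a pulled-back adapted coframe. -/

section PullbackAlgebra

variable {V W : Type*} [AddCommGroup V] [Module ℝ V] [TopologicalSpace V]
  [AddCommGroup W] [Module ℝ W] [TopologicalSpace W]

lemma IsIntegral.apply_eq_zero {K : Ideal (Ext V)} {P : Submodule ℝ V} (hP : IsIntegral K P)
    {α : V →L[ℝ] ℝ} (hα : form1 α ∈ K) {v : V} (hv : v ∈ P) : α v = 0 := by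
  have := hP _ hα
  rw [pull_form1, form1, ExteriorAlgebra.ι_eq_zero_iff] at this
  exact DFunLike.congr_fun this ⟨v, hv⟩

/-- Adding a covector to the pull-back of an adapted coframe. -/
lemma IsAdapted.pullback [FiniteDimensional ℝ V] {s : ℕ} {K : Ideal (Ext W)}
    {θ : Fin s → (W →L[ℝ] ℝ)} {σ τ : Fin 2 → (W →L[ℝ] ℝ)} (h : IsAdapted K θ σ τ)
    {L : V →L[ℝ] W} (hL : Function.Surjective L) (hk : Module.finrank ℝ L.ker = 1)
    {J : Submodule ℝ (V →L[ℝ] ℝ)} (hJ : IsCompl (annihilator J) L.ker) {ξ : V →L[ℝ] ℝ}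
    (hξ : J = Submodule.span ℝ {ξ}) {A : Ideal (Ext V)}
    (hA : A = Ideal.span ((form1 '' (J : Set (V →L[ℝ] ℝ))) ∪
      (pull L '' (K : Set (Ext W))))) :
    IsAdapted A (Matrix.vecCons ξ fun e => (θ e).comp L) (fun a => (σ a).comp L)
      (fun a => (τ a).comp L) where
  coframe := by
    apply bijective_of_zero
    · have h1 := LinearMap.finrank_range_add_finrank_ker (L : V →ₗ[ℝ] W)
      rw [LinearMap.range_eq_top.2 hL, finrank_top, h.finrank_eq] at h1
      have h2 : Module.finrank ℝ (LinearMap.ker (L : V →ₗ[ℝ] W)) = 1 := hk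
      omega
    · intro v h1 h2 h3
      rw [Fin.forall_fin_succ] at h1
      have hLv : L v = 0 := h.eq_zero_of_coords h1.2 h2 h3
      have hv : v ∈ annihilator J := by
        intro α hα
        rw [hξ, Submodule.mem_span_singleton] at hα
        obtain ⟨c, rfl⟩ := hα
        have h4 : ξ v = 0 := h1.1
        rw [smul_apply, h4, smul_zero]
      exact (Submodule.disjoint_def.1 hJ.disjoint) v hv hLv
  generates := by
    rw [hA]
    apply le_antisymm
    · refine Ideal.span_le.2 (Set.union_subset ?_ ?_)
      · rintro _ ⟨α, hα, rfl⟩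
        have hα : α ∈ J := hα
        rw [hξ, Submodule.mem_span_singleton] at hα
        obtain ⟨c, rfl⟩ := hα
        rw [form1_smul]
        exact smul_mem_ideal c (Ideal.subset_span (Or.inl ⟨0, rfl⟩))
      · rintro _ ⟨η, hη, rfl⟩
        refine pull_mem h.generates ?_ hη
        rintro _ (⟨k, rfl⟩ | rfl | rfl)
        · rw [pull_form1]
          exact Ideal.subset_span (Or.inl ⟨k.succ, rfl⟩)
        · rw [map_mul, pull_form1, pull_form1]
          exact Ideal.subset_span (Or.inr (Or.inl rfl))
        · rw [map_mul, pull_form1, pull_form1]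
          exact Ideal.subset_span (Or.inr (Or.inr rfl))
    · have key : ∀ η ∈ K, pull L η ∈ Ideal.span ((form1 '' (J : Set (V →L[ℝ] ℝ))) ∪
          (pull L '' (K : Set (Ext W)))) := fun η hη => Ideal.subset_span (Or.inr ⟨η, hη, rfl⟩)
      have hK : ∀ η ∈ (Set.range (fun e => form1 (θ e)) ∪
          {form1 (σ 0) * form1 (σ 1), form1 (τ 0) * form1 (τ 1)} : Set (Ext W)), η ∈ K :=
        fun η hη => by rw [h.generates]; exact Ideal.subset_span hη
      refine Ideal.span_le.2 (Set.union_subset ?_ ?_)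
      · rintro _ ⟨k, rfl⟩
        refine Fin.cases ?_ (fun k => ?_) k
        · refine Ideal.subset_span (Or.inl ⟨ξ, ?_, rfl⟩)
          rw [hξ]
          exact Submodule.mem_span_singleton_self ξ
        · have := key _ (hK _ (Or.inl ⟨k, rfl⟩))
          rwa [pull_form1] at this
      · rintro _ (rfl | rfl)
        · have := key _ (hK _ (Or.inr (Or.inl rfl)))
          rwa [map_mul, pull_form1, pull_form1] at this
        · have := key _ (hK _ (Or.inr (Or.inr rfl)))
          rwa [map_mul, pull_form1, pull_form1] at this

lemma IsAdapted.map_plane {s : ℕ} {K : Ideal (Ext W)}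
    {θ : Fin s → (W →L[ℝ] ℝ)} {σ τ : Fin 2 → (W →L[ℝ] ℝ)} (h : IsAdapted K θ σ τ)
    {L : V →L[ℝ] W} {ξ : V →L[ℝ] ℝ} {A : Ideal (Ext V)}
    (hA : IsAdapted A (Matrix.vecCons ξ fun e => (θ e).comp L) (fun a => (σ a).comp L)
      (fun a => (τ a).comp L)) (m n : Fin 2 → ℝ) :
    Submodule.map L.toLinearMap (hA.plane m n) = h.plane m n := by
  have key : ∀ m n, L (hA.vec m n) = h.vec m n := fun m n =>
    h.eq_vec (fun e => hA.θ_vec m n e.succ) (hA.σhat_vec m n) (hA.σchk_vec m n)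
  rw [IsAdapted.plane, IsAdapted.plane, Submodule.map_span, Set.image_pair]
  exact congrArg₂ (fun a b => Submodule.span ℝ {a, b}) (key _ _) (key _ _)

/-- The number of generators of a complement of a line. -/
lemma eq_one_of_isCompl [FiniteDimensional ℝ V] {L : V →L[ℝ] W}
    (hk : Module.finrank ℝ L.ker = 1) {r : ℕ} {ξ : Fin r → (V →L[ℝ] ℝ)}
    (hξ : LinearIndependent ℝ ξ)
    (hJ : IsCompl (annihilator (Submodule.span ℝ (Set.range ξ))) L.ker) : r = 1 := by
  let R : (V →L[ℝ] ℝ) →ₗ[ℝ] Module.Dual ℝ L.ker :=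
    { toFun := fun α => (α : V →ₗ[ℝ] ℝ).comp L.ker.subtype
      map_add' := fun _ _ => rfl
      map_smul' := fun _ _ => rfl }
  -- A combination of the `ξᵢ` that vanishes on the kernel also vanishes on the complementary
  -- annihilator, so it is zero. The `ξᵢ` thus stay independent in the dual of a line.
  have h1 : LinearIndependent ℝ (R ∘ ξ) := by
    rw [Fintype.linearIndependent_iff]
    intro g hg
    have h2 : ∑ i, g i • ξ i = 0 := by
      ext v
      obtain ⟨a, ha, k, hk, rfl⟩ := Submodule.mem_sup.1
        (hJ.codisjoint.eq_top ▸ Submodule.mem_top : v ∈ _ ⊔ L.ker)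
      have e1 : (∑ i, g i • ξ i) a = 0 := ha _ (Submodule.sum_mem _ fun i _ =>
        Submodule.smul_mem _ _ (Submodule.subset_span ⟨i, rfl⟩))
      have e2 := LinearMap.congr_fun hg ⟨k, hk⟩
      have e3 : (∑ i, g i • ξ i) k = 0 := by
        simpa [R] using e2
      rw [map_add, e1, e3, add_zero]
      rfl
    exact Fintype.linearIndependent_iff.1 hξ g h2
  have h3 := h1.fintype_card_le_finrank
  rw [Subspace.dual_finrank_eq, hk, Fintype.card_fin] at h3
  -- Without generators the annihilator would be the whole space and its complement, the kernel
  -- line, would be zero.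
  rcases Nat.lt_or_ge 0 r with h0 | h0
  · omega
  · obtain rfl : r = 0 := by omega
    have h4 : annihilator (Submodule.span ℝ (Set.range ξ)) = ⊤ := by
      rw [eq_top_iff]
      intro v _ α hα
      rw [Set.range_eq_empty, Submodule.span_empty, Submodule.mem_bot] at hα
      rw [hα]; rfl
    have h5 := hJ.inf_eq_bot
    rw [h4, top_inf_eq] at h5
    rw [h5, finrank_bot] at hk
    omega

end PullbackAlgebra

/-! ### Integrable extensions of hyperbolic systems. -/

section Extensions

variable {E : Type*} [NormedAddCommGroup E] [NormedSpace ℝ E] [FiniteDimensional ℝ E]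
  {N : Type*} [TopologicalSpace N] [ChartedSpace E N] [IsManifold 𝓘(ℝ, E) ∞ N]
  {E₁ : Type*} [NormedAddCommGroup E₁] [NormedSpace ℝ E₁] [FiniteDimensional ℝ E₁]
  {M : Type*} [TopologicalSpace M] [ChartedSpace E₁ M] [IsManifold 𝓘(ℝ, E₁) ∞ M]
  {s : ℕ} {A : FormIdeal E N} {I : FormIdeal E₁ M} {p : N → M}
  {J : ∀ x : N, Submodule ℝ (Cot E x)}

/-- The pull-back of an adapted coframe along an integrable extension. -/
lemma exists_pullback_coframe (hp : ContMDiff 𝓘(ℝ, E) 𝓘(ℝ, E₁) ∞ p)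
    (hs : ∀ x, Function.Surjective (dmap E E₁ p x)) (hJ : IsSmoothSubbundle J)
    (hc : ∀ x, IsCompl (annihilator (J x)) (dmap E E₁ p x).ker)
    (hA : ∀ x, A x = Ideal.span ((form1 '' (J x : Set (Cot E x))) ∪
      (pull (dmap E E₁ p x) '' (I (p x) : Set (Ext (Tan E₁ (p x)))))))
    (hk : ∀ x, Module.finrank ℝ (dmap E E₁ p x).ker = 1) {U : Set M} (c : AdaptedCoframe s I U)
    {O : Set M} (hU : IsOpen U) (hO : IsOpen O) {x : N} (hx : p x ∈ U) (hxO : p x ∈ O) :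
    ∃ (U' : Set N) (ξ : OneForm E N) (c' : AdaptedCoframe (s + 1) A U'), IsOpen U' ∧ x ∈ U' ∧
      (∀ y ∈ U', p y ∈ U ∧ p y ∈ O ∧ J y = Submodule.span ℝ {ξ y}) ∧
      c'.θ = Matrix.vecCons ξ (fun e => pb p (c.θ e)) ∧
      (∀ a, c'.σhat a = pb p (c.σhat a)) ∧ (∀ a, c'.σchk a = pb p (c.σchk a)) := by
  obtain ⟨r, hr⟩ := hJ
  obtain ⟨U₁, hU₁, hx₁, ξ, hξ, hξJ⟩ := hr x
  have fd : ∀ y : N, FiniteDimensional ℝ (Tan E y) := fun y =>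
    inferInstanceAs (FiniteDimensional ℝ E)
  obtain rfl : r = 1 := eq_one_of_isCompl (hk x) (hξJ x hx₁).1 (by
    rw [(hξJ x hx₁).2]; exact hc x)
  have hU' : IsOpen (U₁ ∩ p ⁻¹' (U ∩ O)) := hU₁.inter ((hU.inter hO).preimage hp.continuous)
  have hJξ : ∀ y ∈ U₁, J y = Submodule.span ℝ {ξ 0 y} := fun y hy => by
    rw [← (hξJ y hy).2]
    congr 1
    ext α
    simp [Fin.exists_fin_one, eq_comm]
  have hsm : ∀ {η : OneForm E₁ M}, SmoothOn η U → SmoothOn (pb (E := E) p η)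
      (U₁ ∩ p ⁻¹' (U ∩ O)) := fun hη => hη.pb hU' hU hp.contMDiffOn fun y hy => hy.2.1
  refine ⟨U₁ ∩ p ⁻¹' (U ∩ O), ξ 0, ⟨Matrix.vecCons (ξ 0) fun e => pb p (c.θ e),
    fun a => pb p (c.σhat a), fun a => pb p (c.σchk a), ?_, fun a => hsm (c.smooth_σhat a),
    fun a => hsm (c.smooth_σchk a), ?_⟩, hU', ⟨hx₁, hx, hxO⟩,
    fun y hy => ⟨hy.2.1, hy.2.2, hJξ y hy.1⟩, rfl, fun _ => rfl, fun _ => rfl⟩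
  · rw [Fin.forall_fin_succ]
    exact ⟨(hξ 0).mono Set.inter_subset_left, fun e => hsm (c.smooth_θ e)⟩
  · intro y hy
    have := (c.adapted (p y) hy.2.1).pullback (hs y) (hk y) (hc y) (hJξ y hy.1) (hA y)
    convert! this using 1
    ext e : 1
    refine Fin.cases ?_ (fun e => ?_) e <;> rfl

/-- Each adapted coframe downstairs yields one upstairs with a single additional `θ`; closure under
`d` belongs to the data of a Bäcklund transformation. -/
lemma isHyperbolic_of_extension (hcl : IsDClosed A) (hI : IsHyperbolic s I)
    (hext : IsIntegrableExtension A I p) (hk : ∀ x, Module.finrank ℝ (dmap E E₁ p x).ker = 1) :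
    IsHyperbolic (s + 1) A where
  closed := hcl
  exists_coframe x := by
    obtain ⟨hp, hs, J, hJ, hc, hA⟩ := hext
    obtain ⟨U, hU, hx, ⟨c⟩⟩ := hI.exists_coframe (p x)
    obtain ⟨U', ξ, c', hU', hx', -⟩ :=
      exists_pullback_coframe hp hs hJ hc hA hk c hU isOpen_univ hx trivial
    exact ⟨U', hU', hx', ⟨c'⟩⟩

/-- In matching coframes the plane with parameters `m`, `n` is carried to the plane with the same
parameters, and for a hyperbolic ideal every such plane is regular. -/
lemma isRegular_map_plane (hI : IsHyperbolic s I) (hext : IsIntegrableExtension A I p)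
    (hk : ∀ x, Module.finrank ℝ (dmap E E₁ p x).ker = 1) {x : N} {P : Submodule ℝ (Tan E x)}
    (hP : IsRegularIntegralPlane (A x) P) :
    IsRegularIntegralPlane (I (p x)) (Submodule.map (dmap E E₁ p x).toLinearMap P) := by
  obtain ⟨hp, hs, J, hJ, hc, hA⟩ := hext
  obtain ⟨U, hU, hx, ⟨c⟩⟩ := hI.exists_coframe (p x)
  obtain ⟨U', ξ, c', hU', hx', hy, -, -, -⟩ :=
    exists_pullback_coframe hp hs hJ hc hA hk c hU isOpen_univ hx trivial
  have : FiniteDimensional ℝ (Tan E x) := inferInstanceAs (FiniteDimensional ℝ E)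
  have : FiniteDimensional ℝ (Tan E₁ (p x)) := inferInstanceAs (FiniteDimensional ℝ E₁)
  have had := (c.adapted (p x) hx).pullback (hs x) (hk x) (hc x) (hy x hx').2.2 (hA x)
  obtain ⟨m, n, hm, hn, rfl⟩ := had.exists_plane hP.integral hP.finrank_eq
  rw [(c.adapted (p x) hx).map_plane had]
  exact (c.adapted (p x) hx).regular_plane hm hn

end Extensions

/-! ### Prolongation of an integrable extension. -/

section ProlongMap

variable {E : Type*} [NormedAddCommGroup E] [NormedSpace ℝ E] [FiniteDimensional ℝ E]
  {N : Type*} [TopologicalSpace N] [ChartedSpace E N] [IsManifold 𝓘(ℝ, E) ∞ N]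
  {E₁ : Type*} [NormedAddCommGroup E₁] [NormedSpace ℝ E₁] [FiniteDimensional ℝ E₁]
  {M : Type*} [TopologicalSpace M] [ChartedSpace E₁ M] [IsManifold 𝓘(ℝ, E₁) ∞ M]
  {s : ℕ} {A : FormIdeal E N} {I : FormIdeal E₁ M} {p : N → M}
  {J : ∀ x : N, Submodule ℝ (Cot E x)} {hA : IsHyperbolic (s + 1) A} {hI : IsHyperbolic s I}

namespace Prolongation

/-- The map `(x, P) ↦ (p x, p_* P)` of the prolongation spaces. -/
def prolongMap (hreg : ∀ e : Prolongation hA, IsRegularIntegralPlane (I (p e.1.1))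
    (Submodule.map (dmap E E₁ p e.1.1).toLinearMap e.1.2)) : Prolongation hA → Prolongation hI :=
  fun e => ⟨⟨p e.1.1, Submodule.map (dmap E E₁ p e.1.1).toLinearMap e.1.2⟩, hreg e⟩

/-- Charts of the prolongation spaces in which the prolongation of `p` preserves the slopes. -/
structure Compat (p : N → M) (dN : ChartData hA) (dM : ChartData hI) : Prop where
  i_eq : dN.i = dM.i
  j_eq : dN.j = dM.j
  hat_eq : ∀ a, dN.c.σhat a = pb p (dM.c.σhat a)
  chk_eq : ∀ a, dN.c.σchk a = pb p (dM.c.σchk a)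
  mem_U : ∀ x ∈ dN.U, p x ∈ dM.U
  mem_source : ∀ x ∈ dN.U, p x ∈ dM.φ.source

lemma Compat.swap {dN : ChartData hA} {dM : ChartData hI} (hd : Compat p dN dM) :
    Compat p dN.swap dM.swap :=
  ⟨hd.j_eq, hd.i_eq, hd.chk_eq, hd.hat_eq, hd.mem_U, hd.mem_source⟩

variable {hreg : ∀ e : Prolongation hA, IsRegularIntegralPlane (I (p e.1.1))
    (Submodule.map (dmap E E₁ p e.1.1).toLinearMap e.1.2)}

local notation "qm" => prolongMap (hI := hI) hreg

lemma map_mem_prolongMap {e : Prolongation hA} {v : Tan E e.1.1} (hv : v ∈ e.1.2) :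
    (dmap E E₁ p e.1.1 v : Tan E₁ (qm e).1.1) ∈ (qm e).1.2 := ⟨v, hv, rfl⟩

section CompatLemmas

variable {dN : ChartData hA} {dM : ChartData hI} (hd : Compat p dN dM)
include hd

lemma Compat.mem {e : Prolongation hA} (he : e ∈ dN.chart.source) : qm e ∈ dM.chart.source := by
  obtain ⟨-, h2, ⟨v, hv, hv0⟩, ⟨w, hw, hw0⟩⟩ := he
  rw [hd.i_eq, hd.hat_eq] at hv0
  rw [hd.j_eq, hd.chk_eq] at hw0
  exact ⟨hd.mem_source _ h2, hd.mem_U _ h2, ⟨_, map_mem_prolongMap hv, hv0⟩,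
    ⟨_, map_mem_prolongMap hw, hw0⟩⟩

/-- The coframe upstairs is pulled back, so the relation between `σ̂ⁱ'` and `σ̂ⁱ` on `P` is the
relation on `p_* P`. -/
lemma Compat.hatSlope_eq {e : Prolongation hA} (he : e ∈ dN.chart.source) :
    dN.hatSlope e = dM.hatSlope (qm e) := by
  refine ChartData.slope_eq (fun v hv => ?_) he.2.2.1
  have h1 := ((dM.mem_plane_iff (hd.mem (hreg := hreg) he)).1 (map_mem_prolongMap hv)).2.1
  rw [hd.i_eq, hd.hat_eq, hd.hat_eq]
  exact h1

lemma Compat.chkSlope_eq {e : Prolongation hA} (he : e ∈ dN.chart.source) :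
    dN.chkSlope e = dM.chkSlope (qm e) :=
  hd.swap.hatSlope_eq (dN.swap_mem_source he)

/-- In matching charts the map is `p` on base points and the identity on the slopes. -/
lemma Compat.contMDiffAt (hp : ContMDiff 𝓘(ℝ, E) 𝓘(ℝ, E₁) ∞ p) {e : Prolongation hA}
    (he : e ∈ dN.chart.source) :
    ContMDiffAt 𝓘(ℝ, E × ℝ × ℝ) 𝓘(ℝ, E₁ × ℝ × ℝ) ∞ qm e := by
  have hmem := hd.mem (hreg := hreg) he
  have h1 : ContMDiffAt 𝓘(ℝ, E × ℝ × ℝ) 𝓘(ℝ, E₁) ∞ (dM.φ ∘ (p ∘ base hA)) e :=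
    (contMDiffAt_chart dM.φ_mem (hd.mem_source _ he.2.1)).comp e
      ((hp _).comp e (contMDiff_base e))
  have hn := dN.isOpen_source.mem_nhds he
  have h2 : ContMDiffAt 𝓘(ℝ, E × ℝ × ℝ) 𝓘(ℝ, E₁ × ℝ × ℝ) ∞
      (fun e => ((dM.φ ∘ (p ∘ base hA)) e, dN.hatSlope e, dN.chkSlope e)) e :=
    h1.prodMk_space ((dN.contMDiffOn_hatSlope.contMDiffAt hn).prodMk_space
      (dN.contMDiffOn_chkSlope.contMDiffAt hn))
  have h3 : ∀ e ∈ dN.chart.source,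
      ((dM.φ ∘ (p ∘ base hA)) e, dN.hatSlope e, dN.chkSlope e) = dM.hom (qm e) := by
    intro e he
    rw [hd.hatSlope_eq (hreg := hreg) he, hd.chkSlope_eq (hreg := hreg) he]
    rfl
  have h4 : ContMDiffAt 𝓘(ℝ, E₁ × ℝ × ℝ) 𝓘(ℝ, E₁ × ℝ × ℝ) ∞ dM.hom.symm
      ((fun e => ((dM.φ ∘ (p ∘ base hA)) e, dN.hatSlope e, dN.chkSlope e)) e) := by
    refine contMDiffAt_chart_symm dM.hom_mem ?_
    beta_reduce
    rw [h3 e he]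
    exact dM.hom.map_source hmem
  refine (h4.comp e h2).congr_of_eventuallyEq ?_
  filter_upwards [hn] with e' he'
  rw [Function.comp_apply, h3 e' he']
  exact (dM.hom.left_inv (hd.mem (hreg := hreg) he')).symm

lemma Compat.dbase_dmap (hp : ContMDiff 𝓘(ℝ, E) 𝓘(ℝ, E₁) ∞ p) {e : Prolongation hA}
    (he : e ∈ dN.chart.source) (v : Tan (E × ℝ × ℝ) e) :
    dbase (qm e) (dmap (E × ℝ × ℝ) (E₁ × ℝ × ℝ) qm e v) = dmap E E₁ p e.1.1 (dbase e v) := by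
  have h1 := dmap_comp (hd.contMDiffAt (hreg := hreg) hp he) (contMDiff_base (qm e))
  have h2 := dmap_comp (contMDiff_base e) (hp (base hA e))
  exact (DFunLike.congr_fun h1 v).symm.trans (DFunLike.congr_fun h2 v)

lemma Compat.diff_dmap (hp : ContMDiff 𝓘(ℝ, E) 𝓘(ℝ, E₁) ∞ p) {e : Prolongation hA}
    (he : e ∈ dN.chart.source) (v : Tan (E × ℝ × ℝ) e) :
    diff dM.hatSlope (qm e) (dmap (E × ℝ × ℝ) (E₁ × ℝ × ℝ) qm e v) = diff dN.hatSlope e v := by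
  have hn := dN.isOpen_source.mem_nhds he
  have h1 := dmap_comp (hd.contMDiffAt (hreg := hreg) hp he)
    (dM.contMDiffOn_hatSlope.contMDiffAt
      (dM.isOpen_source.mem_nhds (hd.mem (hreg := hreg) he)))
  have h2 : (diff (dM.hatSlope ∘ qm) e : Cot (E × ℝ × ℝ) e) = diff dN.hatSlope e := by
    refine diff_congr ?_
    filter_upwards [hn] with e' he'
    exact (hd.hatSlope_eq he').symm
  rw [← h2]
  exact (DFunLike.congr_fun h1 v).symm

lemma Compat.con_eq (hp : ContMDiff 𝓘(ℝ, E) 𝓘(ℝ, E₁) ∞ p) {e : Prolongation hA}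
    (he : e ∈ dN.chart.source) : dN.con e = pb (E := E × ℝ × ℝ) qm dM.con e := by
  ext v
  have h1 := hd.dbase_dmap (hreg := hreg) hp he v
  have h2 := congrArg (dM.c.σhat dM.i.rev (p e.1.1)) h1
  have h3 := congrArg (dM.c.σhat dM.i (p e.1.1)) h1
  have h4 := hd.hatSlope_eq (hreg := hreg) he
  simp only [ChartData.con]
  rw [hd.i_eq, hd.hat_eq, hd.hat_eq, h4]
  exact (congrArg₂ (fun x y => x - dM.hatSlope (qm e) * y) h2 h3).symm

/-- A componentwise criterion for `w` to be the image of `v`. It produces both preimages, for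
surjectivity, and vectors of the kernel. -/
lemma Compat.bijective (hp : ContMDiff 𝓘(ℝ, E) 𝓘(ℝ, E₁) ∞ p) {e : Prolongation hA}
    (he : e ∈ dN.chart.source) {v : Tan (E × ℝ × ℝ) e} {w : Tan (E₁ × ℝ × ℝ) (qm e)}
    (h1 : dmap E E₁ p e.1.1 (dbase e v) = dbase (qm e) w)
    (h2 : diff dN.hatSlope e v = diff dM.hatSlope (qm e) w)
    (h3 : diff dN.chkSlope e v = diff dM.chkSlope (qm e) w) :
    dmap (E × ℝ × ℝ) (E₁ × ℝ × ℝ) qm e v = w := by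
  apply (dM.bijective_dbase (hd.mem (hreg := hreg) he)).1
  have e1 := hd.dbase_dmap (hreg := hreg) hp he v
  have e2 := hd.diff_dmap (hreg := hreg) hp he v
  have e3 := hd.swap.diff_dmap (hreg := hreg) hp (dN.swap_mem_source he) v
  exact Prod.ext (e1.trans h1) (Prod.ext (e2.trans h2) (e3.trans h3))

end CompatLemmas

/-- The chart downstairs is chosen first, about the image plane. Its coframe is then pulled back
over a neighbourhood small enough to be mapped into the coframe domain and into the chart domain. -/
lemma exists_compat (hp : ContMDiff 𝓘(ℝ, E) 𝓘(ℝ, E₁) ∞ p)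
    (hs : ∀ x, Function.Surjective (dmap E E₁ p x)) (hJ : IsSmoothSubbundle J)
    (hc : ∀ x, IsCompl (annihilator (J x)) (dmap E E₁ p x).ker)
    (hAJ : ∀ x, A x = Ideal.span ((form1 '' (J x : Set (Cot E x))) ∪
      (pull (dmap E E₁ p x) '' (I (p x) : Set (Ext (Tan E₁ (p x)))))))
    (hk : ∀ x, Module.finrank ℝ (dmap E E₁ p x).ker = 1)
    (hreg : ∀ e : Prolongation hA, IsRegularIntegralPlane (I (p e.1.1))
      (Submodule.map (dmap E E₁ p e.1.1).toLinearMap e.1.2)) (e : Prolongation hA) :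
    ∃ (dN : ChartData hA) (dM : ChartData hI) (ξ : OneForm E N), e ∈ dN.chart.source ∧
      Compat p dN dM ∧ dN.c.θ = Matrix.vecCons ξ (fun k => pb p (dM.c.θ k)) ∧
      ∀ x ∈ dN.U, ξ x ∈ J x := by
  obtain ⟨dM, hdM⟩ := exists_chartData (prolongMap (hI := hI) hreg e)
  have hdM : prolongMap (hI := hI) hreg e ∈ dM.chart.source := hdM
  obtain ⟨U', ξ, c', hU', hx', hy, hθ, h1, h2⟩ :=
    exists_pullback_coframe hp hs hJ hc hAJ hk dM.c dM.isOpen dM.φ.open_source (x := e.1.1)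
      hdM.2.1 hdM.1
  have hv : ∃ v ∈ e.1.2, dM.c.σhat dM.i (p e.1.1) (dmap E E₁ p e.1.1 v) ≠ 0 := by
    obtain ⟨_, ⟨v, hv, rfl⟩, hv0⟩ := hdM.2.2.1
    exact ⟨v, hv, hv0⟩
  have hw : ∃ v ∈ e.1.2, dM.c.σchk dM.j (p e.1.1) (dmap E E₁ p e.1.1 v) ≠ 0 := by
    obtain ⟨_, ⟨v, hv, rfl⟩, hv0⟩ := hdM.2.2.2
    exact ⟨v, hv, hv0⟩
  refine ⟨⟨U', hU', c', dM.i, dM.j, e⟩, dM, ξ, ⟨mem_chart_source E e.1.1, hx', ?_, ?_⟩,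
    ⟨rfl, rfl, h1, h2, fun x hx => (hy x hx).1, fun x hx => (hy x hx).2.1⟩, hθ,
    fun x hx => ?_⟩
  · obtain ⟨v, hv, hv0⟩ := hv
    refine ⟨v, hv, ?_⟩
    dsimp only
    rw [h1]; exact hv0
  · obtain ⟨v, hv, hv0⟩ := hw
    refine ⟨v, hv, ?_⟩
    dsimp only
    rw [h2]; exact hv0
  · rw [(hy x hx).2.2]; exact Submodule.mem_span_singleton_self _

/-- The projection is a submersion, so pull-back of covectors is injective and local frames of `J`
remain frames. -/
lemma isSmoothSubbundle_map (hJ : IsSmoothSubbundle J) :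
    IsSmoothSubbundle (fun e : Prolongation hA => Submodule.map (pullCov (dbase e)) (J e.1.1)) := by
  obtain ⟨r, hr⟩ := hJ
  refine ⟨r, fun e => ?_⟩
  obtain ⟨U, hU, hx, ξ, hξ, hξJ⟩ := hr e.1.1
  have hU' : IsOpen (base hA ⁻¹' U) := hU.preimage contMDiff_base.continuous
  refine ⟨base hA ⁻¹' U, hU', hx, fun i => pb (base hA) (ξ i),
    fun i => (hξ i).pb hU' hU contMDiff_base.contMDiffOn fun _ h => h, fun e' he' => ⟨?_, ?_⟩⟩
  · have hker : LinearMap.ker (pullCov (dbase e')) = ⊥ := by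
      rw [LinearMap.ker_eq_bot']
      intro α hα
      ext u
      obtain ⟨v, rfl⟩ := surjective_dbase e' u
      exact DFunLike.congr_fun hα v
    have h0 : LinearIndependent ℝ (fun i => ξ i e'.1.1) := (hξJ _ he').1
    have h1 := h0.map' (pullCov (dbase e')) hker
    exact h1
  · have h1 := congrArg (Submodule.map (pullCov (dbase e'))) (hξJ _ he').2
    have h2 := Submodule.map_span (pullCov (dbase e')) (Set.range fun i => ξ i e'.1.1)
    rw [← Set.range_comp] at h2
    exact h2.symm.trans h1

/-- The annihilator of `π^* J` is the preimage of that of `J`. A kernel vector of the prolonged map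
has vanishing slope components, so it is determined by its projection, which lies in the kernel of
`dp`. -/
lemma isCompl_prolongMap (hp : ContMDiff 𝓘(ℝ, E) 𝓘(ℝ, E₁) ∞ p)
    (hc : ∀ x, IsCompl (annihilator (J x)) (dmap E E₁ p x).ker)
    (hcompat : ∀ e : Prolongation hA, ∃ (dN : ChartData hA) (dM : ChartData hI) (ξ : OneForm E N),
      e ∈ dN.chart.source ∧ Compat p dN dM ∧
      dN.c.θ = Matrix.vecCons ξ (fun k => pb p (dM.c.θ k)) ∧ ∀ x ∈ dN.U, ξ x ∈ J x) (e : Prolongation hA) :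
    IsCompl (annihilator (Submodule.map (pullCov (dbase e)) (J e.1.1)))
      (dmap (E × ℝ × ℝ) (E₁ × ℝ × ℝ) qm e).ker := by
  obtain ⟨dN, dM, ξ, he, hd, -⟩ := hcompat e
  have hann : ∀ v : Tan (E × ℝ × ℝ) e,
      v ∈ annihilator (Submodule.map (pullCov (dbase e)) (J e.1.1)) ↔
        dbase e v ∈ annihilator (J e.1.1) := by
    intro v
    constructor
    · exact fun hv α hα => hv _ (Submodule.mem_map_of_mem hα)
    · rintro hv _ ⟨α, hα, rfl⟩
      exact hv α hα
  constructor
  · rw [Submodule.disjoint_def]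
    intro v hv hv'
    rw [hann] at hv
    have hv' : dmap (E × ℝ × ℝ) (E₁ × ℝ × ℝ) qm e v = 0 := hv'
    have e1 := hd.dbase_dmap (hreg := hreg) hp he v
    have e2 := hd.diff_dmap (hreg := hreg) hp he v
    have e3 := hd.swap.diff_dmap (hreg := hreg) hp (dN.swap_mem_source he) v
    rw [hv', map_zero] at e1 e2 e3
    have h1 : dbase e v = 0 := Submodule.disjoint_def.1 (hc e.1.1).disjoint _ hv e1.symm
    apply (dN.bijective_dbase he).1
    exact Prod.ext (h1.trans (map_zero _).symm) (Prod.ext (e2.symm.trans (map_zero _).symm)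
      (e3.symm.trans (map_zero _).symm))
  · rw [codisjoint_iff, eq_top_iff]
    intro v _
    obtain ⟨u, hu, k, hk', huk⟩ := Submodule.mem_sup.1
      ((hc e.1.1).codisjoint.eq_top ▸ Submodule.mem_top :
        dbase e v ∈ annihilator (J e.1.1) ⊔ (dmap E E₁ p e.1.1).ker)
    -- Lifting the kernel part of the projection with zero slope components gives a kernel vector;
    -- subtracting it leaves a vector of the annihilator.
    obtain ⟨w, hw⟩ := (dN.bijective_dbase he).2 (k, 0, 0)
    simp only [Prod.mk.injEq] at hw
    have hw' : dmap (E × ℝ × ℝ) (E₁ × ℝ × ℝ) qm e w = 0 := by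
      apply hd.bijective (hreg := hreg) hp he
      · rw [hw.1, map_zero]; exact hk'
      · rw [hw.2.1, map_zero]
      · rw [hw.2.2, map_zero]
    refine Submodule.mem_sup.2 ⟨v - w, ?_, w, hw', sub_add_cancel v w⟩
    rw [hann, map_sub, hw.1, ← huk, add_sub_cancel_right]
    exact hu

/-- For the inclusion from left to right, the contact forms upstairs are a section of `π^* J` and
pull-backs of contact forms; naturality of `d` and the structure equation then give `om ∧ pi`. For
the other inclusion, covectors of `J` lie in `A` and so vanish on integral elements, while contact
forms and their derivatives pull back to contact forms and their derivatives. -/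
lemma system_prolongMap (hp : ContMDiff 𝓘(ℝ, E) 𝓘(ℝ, E₁) ∞ p)
    (hsm : ContMDiff 𝓘(ℝ, E × ℝ × ℝ) 𝓘(ℝ, E₁ × ℝ × ℝ) ∞ qm)
    (hAJ : ∀ x, A x = Ideal.span ((form1 '' (J x : Set (Cot E x))) ∪
      (pull (dmap E E₁ p x) '' (I (p x) : Set (Ext (Tan E₁ (p x)))))))
    (hcompat : ∀ e : Prolongation hA, ∃ (dN : ChartData hA) (dM : ChartData hI) (ξ : OneForm E N),
      e ∈ dN.chart.source ∧ Compat p dN dM ∧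
      dN.c.θ = Matrix.vecCons ξ (fun k => pb p (dM.c.θ k)) ∧ ∀ x ∈ dN.U, ξ x ∈ J x) (e : Prolongation hA) :
    system hA e = Ideal.span ((form1 '' ((Submodule.map (pullCov (dbase e)) (J e.1.1) :
      Submodule ℝ (Cot (E × ℝ × ℝ) e)) : Set (Cot (E × ℝ × ℝ) e))) ∪
      (pull (dmap (E × ℝ × ℝ) (E₁ × ℝ × ℝ) qm e) ''
        (system hI (qm e) : Set (Ext (Tan (E₁ × ℝ × ℝ) (qm e)))))) := by
  obtain ⟨dN, dM, ξ, he, hd, hθ, hξ⟩ := hcompat e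
  set R := Ideal.span ((form1 '' ((Submodule.map (pullCov (dbase e)) (J e.1.1) :
    Submodule ℝ (Cot (E × ℝ × ℝ) e)) : Set (Cot (E × ℝ × ℝ) e))) ∪
    (pull (dmap (E × ℝ × ℝ) (E₁ × ℝ × ℝ) qm e) ''
      (system hI (qm e) : Set (Ext (Tan (E₁ × ℝ × ℝ) (qm e)))))) with hR
  have hcontact : ∀ β ∈ contact (qm e),
      β.comp (dmap (E × ℝ × ℝ) (E₁ × ℝ × ℝ) qm e) ∈ contact e := by
    intro β hβ
    rw [ChartData.mem_contact_iff] at hβ ⊢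
    intro v hv
    refine hβ _ ?_
    exact Eq.mpr (congrArg (fun u => u ∈ (qm e).1.2) (hd.dbase_dmap (hreg := hreg) hp he v))
      (map_mem_prolongMap hv)
  apply le_antisymm
  · have hpullR : ∀ η ∈ system hI (qm e),
        pull (dmap (E × ℝ × ℝ) (E₁ × ℝ × ℝ) qm e) η ∈ R :=
      fun η hη => Ideal.subset_span (Or.inr ⟨η, hη, rfl⟩)
    have hcovR : ∀ β ∈ contact (qm e),
        form1 (β.comp (dmap (E × ℝ × ℝ) (E₁ × ℝ × ℝ) qm e)) ∈ R := by
      intro β hβ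
      rw [← pull_form1]
      exact hpullR _ (form1_mem_system.2 hβ)
    have hcon : ∀ {dN : ChartData hA} {dM : ChartData hI}, Compat p dN dM →
        e ∈ dN.chart.source → form1 (dN.con e) ∈ R := by
      intro dN dM hd he
      rw [hd.con_eq (hreg := hreg) hp he]
      exact hcovR _ (dM.con_mem_contact (hd.mem (hreg := hreg) he))
    have hθR : ∀ k, form1 (pb (base hA) (dN.c.θ k) e) ∈ R := by
      rw [hθ, Fin.forall_fin_succ]
      refine ⟨Ideal.subset_span (Or.inl ⟨_, Submodule.mem_map_of_mem (hξ _ he.2.1), rfl⟩),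
        fun k => ?_⟩
      have h1 := hcovR _ (dM.θ_mem_contact (hd.mem (hreg := hreg) he) k)
      convert! h1 using 2
      ext v
      exact congrArg (dM.c.θ k (p e.1.1)) (hd.dbase_dmap (hreg := hreg) hp he v).symm
    have hcR : contactIdeal e ≤ R := by
      refine Ideal.span_le.2 ?_
      rintro _ ⟨β, hβ, rfl⟩
      have hβ : β ∈ contact e := hβ
      rw [dN.contact_eq_span he] at hβ
      have h1 := form1_mem_covIdeal hβ
      refine (Ideal.span_le.2 ?_ : covIdeal _ ≤ R) h1
      rintro _ ⟨_, ⟨k, rfl⟩, rfl⟩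
      exact (dN.forall_conAll (p := fun η => form1 (η e) ∈ R)).2
        ⟨hθR, hcon hd he, hcon hd.swap (dN.swap_mem_source he)⟩ k
    have hstr : ∀ {dN : ChartData hA} {dM : ChartData hI}, Compat p dN dM →
        e ∈ dN.chart.source → form1 (dN.om e) * form1 (dN.pi e) ∈ R := by
      intro dN dM hd he
      have hmem := hd.mem (hreg := hreg) he
      have h1 : extD dN.con e = pull (dmap (E × ℝ × ℝ) (E₁ × ℝ × ℝ) qm e)
          (extD dM.con (qm e)) := by
        rw [← extD_pb dN.isOpen_source dM.isOpen_source hsm.contMDiffOn dM.smoothOn_con he hmem]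
        exact extD_congr dN.isOpen_source he fun e' he' => hd.con_eq hp he'
      have h2 : extD dN.con e ∈ R := by
        rw [h1]
        exact hpullR _ (ChartData.extD_mem_system dM.isOpen_source hmem dM.smoothOn_con
          fun q hq => dM.con_mem_contact hq)
      have h3 := sub_mem h2 (hcR (dN.extD_con_sub_mem he))
      rwa [sub_sub_cancel] at h3
    rw [dN.system_eq_alg he]
    refine Ideal.span_le.2 (Set.union_subset ?_ ?_)
    · rintro _ ⟨k, rfl⟩
      refine hcR (form1_mem_contactIdeal ?_)
      rw [dN.contact_eq_span he]
      exact Submodule.subset_span ⟨k, rfl⟩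
    · rintro _ (rfl | rfl)
      · exact hstr hd he
      · exact hstr hd.swap (dN.swap_mem_source he)
  · refine Ideal.span_le.2 (Set.union_subset ?_ ?_)
    · rintro _ ⟨_, ⟨α, hα, rfl⟩, rfl⟩
      refine form1_mem_system.2 (mem_contact.2 ⟨α, fun v hv => ?_, rfl⟩)
      refine e.2.integral.apply_eq_zero ?_ hv
      rw [hAJ]
      exact Ideal.subset_span (Or.inl ⟨α, hα, rfl⟩)
    · rintro _ ⟨η, hη, rfl⟩
      refine pull_mem rfl ?_ hη
      rintro _ (⟨β, hβ, rfl⟩ | ⟨O, θ, hO, hqO, hθ', hθc, rfl⟩)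
      · rw [pull_form1]
        exact form1_mem_system.2 (hcontact β hβ)
      · have hO' : IsOpen (qm ⁻¹' O) := hO.preimage hsm.continuous
        rw [← extD_pb hO' hO hsm.contMDiffOn hθ' hqO hqO]
        refine ChartData.extD_mem_system hO' hqO
          (hθ'.pb hO' hO hsm.contMDiffOn fun _ h => h) fun e' he' => ?_
        rw [ChartData.mem_contact_iff]
        intro v hv
        refine ChartData.mem_contact_iff.1 (hθc _ he') _ ?_
        obtain ⟨dN', dM', ξ', he'', hd', -⟩ := hcompat e'
        exact Eq.mpr (congrArg (fun u => u ∈ (qm e').1.2)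
          (hd'.dbase_dmap (hreg := hreg) hp he'' v)) (map_mem_prolongMap hv)

/-- Rank and nullity: the dimensions of source and target both grow by two. -/
lemma finrank_ker_prolongMap (hs : ∀ x, Function.Surjective (dmap E E₁ p x))
    (hk : ∀ x, Module.finrank ℝ (dmap E E₁ p x).ker = 1) {e : Prolongation hA}
    (hsurj : Function.Surjective (dmap (E × ℝ × ℝ) (E₁ × ℝ × ℝ) qm e)) :
    Module.finrank ℝ (dmap (E × ℝ × ℝ) (E₁ × ℝ × ℝ) qm e).ker = 1 := by
  have : FiniteDimensional ℝ (Tan (E × ℝ × ℝ) e) :=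
    inferInstanceAs (FiniteDimensional ℝ (E × ℝ × ℝ))
  have : FiniteDimensional ℝ (Tan E e.1.1) := inferInstanceAs (FiniteDimensional ℝ E)
  have h1 := LinearMap.finrank_range_add_finrank_ker
    (dmap (E × ℝ × ℝ) (E₁ × ℝ × ℝ) qm e).toLinearMap
  rw [LinearMap.range_eq_top.2 hsurj, finrank_top] at h1
  have h2 := LinearMap.finrank_range_add_finrank_ker (dmap E E₁ p e.1.1).toLinearMap
  rw [LinearMap.range_eq_top.2 (hs e.1.1), finrank_top] at h2
  have h3 : Module.finrank ℝ (LinearMap.ker (dmap E E₁ p e.1.1).toLinearMap) = 1 := hk e.1.1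
  have e1 : Module.finrank ℝ (Tan E e.1.1) = Module.finrank ℝ E := rfl
  have e2 : Module.finrank ℝ (Tan E₁ (p e.1.1)) = Module.finrank ℝ E₁ := rfl
  have e3 : Module.finrank ℝ (Tan (E × ℝ × ℝ) e) = Module.finrank ℝ (E × ℝ × ℝ) := rfl
  have e4 : Module.finrank ℝ (Tan (E₁ × ℝ × ℝ) (qm e)) = Module.finrank ℝ (E₁ × ℝ × ℝ) := rfl
  have e5 : Module.finrank ℝ (E × ℝ × ℝ) = Module.finrank ℝ E + 2 := by simp
  have e6 : Module.finrank ℝ (E₁ × ℝ × ℝ) = Module.finrank ℝ E₁ + 2 := by simp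
  have goal : Module.finrank ℝ
    (LinearMap.ker (dmap (E × ℝ × ℝ) (E₁ × ℝ × ℝ) qm e).toLinearMap) = 1 := by omega
  exact goal

/-- The prolongation of an integrable extension with one-dimensional fibres. -/
lemma isIntegrableExtension_prolongMap (hext : IsIntegrableExtension A I p)
    (hk : ∀ x, Module.finrank ℝ (dmap E E₁ p x).ker = 1) :
    IsIntegrableExtension (system hA) (system hI) qm ∧
      ∀ e, Module.finrank ℝ (dmap (E × ℝ × ℝ) (E₁ × ℝ × ℝ) qm e).ker = 1 := by
  obtain ⟨hp, hs, J, hJ, hc, hAJ⟩ := hext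
  have hcompat := exists_compat (hA := hA) (hI := hI) hp hs hJ hc hAJ hk hreg
  have hsm : ContMDiff 𝓘(ℝ, E × ℝ × ℝ) 𝓘(ℝ, E₁ × ℝ × ℝ) ∞ qm := by
    intro e
    obtain ⟨dN, dM, ξ, he, hd, -⟩ := hcompat e
    exact hd.contMDiffAt hp he
  have hsurj : ∀ e, Function.Surjective (dmap (E × ℝ × ℝ) (E₁ × ℝ × ℝ) qm e) := by
    intro e w
    obtain ⟨dN, dM, ξ, he, hd, -⟩ := hcompat e
    obtain ⟨u, hu⟩ := hs e.1.1 (dbase (qm e) w)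
    obtain ⟨v, hv⟩ := (dN.bijective_dbase he).2
      (u, diff dM.hatSlope (qm e) w, diff dM.chkSlope (qm e) w)
    simp only [Prod.mk.injEq] at hv
    exact ⟨v, hd.bijective hp he (by rw [hv.1, hu]) hv.2.1 hv.2.2⟩
  exact ⟨⟨hsm, hsurj, _, isSmoothSubbundle_map hJ, isCompl_prolongMap hp hc hcompat,
    system_prolongMap hp hsm hAJ hcompat⟩, fun e => finrank_ker_prolongMap hs hk (hsurj e)⟩

end Prolongation

end ProlongMap

/-! ### Criteria for Darboux integrability and a test for closed combinations. -/

section Darboux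

variable {V : Type*} [AddCommGroup V] [Module ℝ V] [TopologicalSpace V]

/-- By duality, finitely many covectors without a common nonzero zero vector span the whole dual. -/
lemma sup_eq_top_of_annihilator {ι κ : Type*} [Finite ι] [Finite κ] {τ : ι → (V →L[ℝ] ℝ)}
    {τ' : κ → (V →L[ℝ] ℝ)} {S S' : Submodule ℝ (V →L[ℝ] ℝ)} (hτ : ∀ i, τ i ∈ S)
    (hτ' : ∀ i, τ' i ∈ S') (h : ∀ v, (∀ i, τ i v = 0) → (∀ i, τ' i v = 0) → v = 0) :
    S ⊔ S' = ⊤ := by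
  rw [eq_top_iff]
  intro α _
  have h1 : α ∈ Submodule.span ℝ (Set.range (Sum.elim τ τ')) := by
    rw [mem_span_range_iff]
    intro v hv
    rw [h v (fun i => hv (Sum.inl i)) (fun i => hv (Sum.inr i)), map_zero]
  refine Submodule.span_le.2 ?_ h1
  rintro _ ⟨i | i, rfl⟩
  · exact Submodule.mem_sup_left (hτ i)
  · exact Submodule.mem_sup_right (hτ' i)

variable {E : Type*} [NormedAddCommGroup E] [NormedSpace ℝ E]
  {N : Type*} [TopologicalSpace N] [ChartedSpace E N]
  [IsManifold 𝓘(ℝ, E) ∞ N] [FiniteDimensional ℝ E] {s : ℕ} {I : FormIdeal E N}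

/-- Darboux integrability can be tested in one coframe about each point. -/
lemma isDarbouxIntegrableOn_of_coframe (hI : IsHyperbolic s I) {O : Set N} (hO : IsOpen O) (k : ℕ)
    (H : ∀ x ∈ O, ∃ (U : Set N) (c : AdaptedCoframe s I U), IsOpen U ∧ x ∈ U ∧
      Module.finrank ℝ (firstIntegrals U c.hatV x) = k ∧
      Module.finrank ℝ (firstIntegrals U c.chkV x) = k ∧
      c.hatV x ⊔ firstIntegrals U c.chkV x = ⊤ ∧ c.chkV x ⊔ firstIntegrals U c.hatV x = ⊤ ∧
      firstIntegrals U c.hatV x ⊓ firstIntegrals U c.chkV x = ⊥) :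
    IsDarbouxIntegrableOn s I O := by
  have key : ∀ U', IsOpen U' → ∀ c' : AdaptedCoframe s I U', ∀ x ∈ U' ∩ O,
      Module.finrank ℝ (firstIntegrals U' c'.hatV x) = k ∧
      Module.finrank ℝ (firstIntegrals U' c'.chkV x) = k ∧
      c'.hatV x ⊔ firstIntegrals U' c'.chkV x = ⊤ ∧ c'.chkV x ⊔ firstIntegrals U' c'.hatV x = ⊤ ∧
      firstIntegrals U' c'.hatV x ⊓ firstIntegrals U' c'.chkV x = ⊥ := by
    intro U' hU' c' x hx
    obtain ⟨U, c, hU, hxU, h1, h2, h3, h4, h5⟩ := H x hx.2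
    rcases c.firstIntegrals_unique c' hU hU' hxU hx.1 with ⟨e1, e2, e3, e4⟩ | ⟨e1, e2, e3, e4⟩
    · rw [e1, e2, e3, e4]
      exact ⟨h1, h2, h3, h4, h5⟩
    · rw [e1, e2, e3, e4]
      exact ⟨h2, h1, h4, h3, by rw [inf_comm]; exact h5⟩
  refine ⟨hI, fun U hU c x hx => ?_, fun U hU c x hx => ?_, fun U hU c x hx => ?_⟩
  · filter_upwards [(hU.inter hO).mem_nhds hx] with y hy
    have h1 := key U hU c x hx
    have h2 := key U hU c y hy
    exact ⟨h2.1.trans h1.1.symm, h2.2.1.trans h1.2.1.symm⟩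
  · exact ⟨(key U hU c x hx).2.2.1, (key U hU c x hx).2.2.2.1⟩
  · exact (key U hU c x hx).2.2.2.2

lemma AdaptedCoframe.exists_coeff_hat {U : Set N} (c : AdaptedCoframe s I U) (hU : IsOpen U)
    {η : OneForm E N} (hη : SmoothOn η U) (h : ∀ x ∈ U, η x ∈ c.hatV x) :
    ∃ f : Fin s ⊕ Fin 2 → N → ℝ, (∀ i, ContMDiffOn 𝓘(ℝ, E) 𝓘(ℝ, ℝ) ∞ (f i) U) ∧
      ∀ x ∈ U, η x = ∑ i, f i x • (Sum.elim c.θ c.σhat i : OneForm E N) x := by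
  obtain ⟨f, hf, hfη⟩ := c.exists_coeff hU hη
  refine ⟨fun i => f (Sum.map id Sum.inl i), fun i => hf _, fun x hx => ?_⟩
  have h1 := (c.adapted x hx).mem_hat.1 (h x hx)
  have h2 : ∀ a, f (Sum.inr (Sum.inr a)) x = 0 := by
    intro a
    have e0 := h1 (Pi.single a 1)
    rw [hfη x hx] at e0
    have e1 := (c.adapted x hx).θ_vec 0 (Pi.single a 1)
    have e2 := (c.adapted x hx).σhat_vec 0 (Pi.single a 1)
    have e3 := (c.adapted x hx).σchk_vec 0 (Pi.single a 1)
    beta_reduce at e1 e2 e3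
    simp [Fintype.sum_sum_type, all, e1, e2, e3, Pi.single_apply] at e0
    fin_cases a <;> simpa using e0
  rw [hfη x hx]
  simp [Fintype.sum_sum_type, all, h2]

/-- If `∑ fᵢ τᵢ` is closed, then `∑ fᵢ dτᵢ` vanishes on the vectors annihilated by the `τᵢ`. -/
lemma sum_smul_ev2_extD {ι : Type*} [Fintype ι] {f : ι → N → ℝ} {τ : ι → OneForm E N}
    {η : OneForm E N} {U : Set N} (hU : IsOpen U)
    (hf : ∀ i, ContMDiffOn 𝓘(ℝ, E) 𝓘(ℝ, ℝ) ∞ (f i) U) (hτ : ∀ i, SmoothOn (τ i) U)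
    (hη : ∀ x ∈ U, η x = ∑ i, f i x • τ i x) {x : N} (hx : x ∈ U) (hd : extD η x = 0)
    {v w : Tan E x} (hvw : ∀ i, (∀ y ∈ U, f i y = 0) ∨ τ i x v = 0 ∧ τ i x w = 0) :
    ∑ i, f i x * ev2 v w (extD (τ i) x) = 0 := by
  rw [extD_congr hU hx hη, extD_sum_smul _ hU hf hτ hx] at hd
  have h1 := congrArg (ev2 v w) hd
  rw [map_sum, map_zero] at h1
  rw [← h1]
  refine Finset.sum_congr rfl fun i _ => ?_
  rw [map_add, map_smul, ev2_form1_mul, smul_eq_mul]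
  -- The unknown terms `dfᵢ ∧ τᵢ` disappear either because `fᵢ` is identically zero on `U`, so that
  -- `dfᵢ = 0`, or because `τᵢ` kills both vectors.
  rcases hvw i with h2 | h2
  · have h3 : (diff (f i) x : Cot E x) = 0 := by
      rw [← diff_const (E := E) 0 x]
      refine diff_congr ?_
      filter_upwards [hU.mem_nhds hx] with y hy
      exact h2 y hy
    rw [h3]
    simp
  · rw [h2.1, h2.2]
    simp

end Darboux

/-! ### Darboux integrability of the prolonged wave equation. -/

section Wave

variable {E : Type*} [NormedAddCommGroup E] [NormedSpace ℝ E]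
  {N : Type*} [TopologicalSpace N] [ChartedSpace E N]
  [IsManifold 𝓘(ℝ, E) ∞ N] [FiniteDimensional ℝ E] {I : FormIdeal E N}

/-- A variant of `exists_chartData` with a prescribed coframe, so that the special coframe of the
wave equation can be used. -/
lemma Prolongation.exists_mem_source {s : ℕ} {h : IsHyperbolic s I} {q : Prolongation h}
    {U : Set N} (hU : IsOpen U) (c : AdaptedCoframe s I U) (hx : q.1.1 ∈ U) :
    ∃ i j, q ∈ (⟨U, hU, c, i, j, q⟩ : ChartData h).chart.source := by
  obtain ⟨m, n, hm, hn, hP⟩ := (c.adapted _ hx).exists_plane q.2.integral q.2.finrank_eq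
  obtain ⟨i, hi⟩ := Function.ne_iff.1 hm
  obtain ⟨j, hj⟩ := Function.ne_iff.1 hn
  refine ⟨i, j, mem_chart_source E q.1.1, hx,
    ⟨(c.adapted _ hx).vec m 0, ?_, ?_⟩, ⟨(c.adapted _ hx).vec 0 n, ?_, ?_⟩⟩
  · rw [hP]; exact Submodule.subset_span (Or.inl rfl)
  · exact ne_of_eq_of_ne ((c.adapted _ hx).σhat_vec m 0 i) hi
  · rw [hP]; exact Submodule.subset_span (Or.inr rfl)
  · exact ne_of_eq_of_ne ((c.adapted _ hx).σchk_vec 0 n j) hj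

namespace Prolongation.ChartData

variable {s : ℕ} {h : IsHyperbolic s I} (d : ChartData h)

/-- The two lists of contact forms differ in order only; both span the contact system. -/
lemma swap_coframe_hatV {q : Prolongation h} (hq : q ∈ d.chart.source) :
    d.swap.coframe.hatV q = d.coframe.chkV q := by
  have h1 := (d.contact_eq_span hq).symm.trans (d.swap.contact_eq_span (d.swap_mem_source hq))
  show Submodule.span ℝ (Set.range (fun k => d.swap.conAll k q) ∪ _) =
    Submodule.span ℝ (Set.range (fun k => d.conAll k q) ∪ _)
  rw [Submodule.span_union, Submodule.span_union, ← h1]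
  rfl

lemma firstIntegrals_swap {q : Prolongation h} (hq : q ∈ d.chart.source) :
    firstIntegrals d.swap.chart.source d.swap.coframe.hatV q =
      firstIntegrals d.chart.source d.coframe.chkV q :=
  firstIntegrals_congr d.swap.isOpen_source d.isOpen_source d.isOpen_source
    (d.swap_mem_source hq) hq hq fun _ hy => d.swap_coframe_hatV hy

lemma θ_mem_hatV {q : Prolongation h} (e : Fin s) :
    pb (base h) (d.c.θ e) q ∈ d.coframe.hatV q :=
  (d.forall_conAll (p := fun η => η q ∈ d.coframe.hatV q)).1
    (fun k => Submodule.subset_span (Or.inl ⟨k, rfl⟩)) |>.1 e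

lemma con_mem_hatV {q : Prolongation h} : d.con q ∈ d.coframe.hatV q :=
  ((d.forall_conAll (p := fun η => η q ∈ d.coframe.hatV q)).1
    (fun k => Submodule.subset_span (Or.inl ⟨k, rfl⟩))).2.1

lemma om_mem_hatV {q : Prolongation h} : d.om q ∈ d.coframe.hatV q :=
  Submodule.subset_span (Or.inr ⟨0, rfl⟩)

lemma σhat_mem_hatV {q : Prolongation h} (k : Fin 2) :
    pb (base h) (d.c.σhat k) q ∈ d.coframe.hatV q := by
  rcases rev_or d.i k with rfl | rfl
  · exact d.om_mem_hatV
  · have h1 := add_mem d.con_mem_hatV (Submodule.smul_mem _ (d.hatSlope q)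
      (d.om_mem_hatV (q := q)))
    rwa [con, om, sub_add_cancel] at h1

end Prolongation.ChartData

/-- Coframes in which the `σ` are differentials of functions and
`dθ = -σ̂¹ ∧ σ̂² - σ̌¹ ∧ σ̌²`, as for the wave equation. -/
structure IsWaveCoframe {U : Set N} (c : AdaptedCoframe 1 I U) : Prop where
  hat : ∀ a, ∃ f : N → ℝ, ContMDiffOn 𝓘(ℝ, E) 𝓘(ℝ, ℝ) ∞ f U ∧ c.σhat a = diff f
  chk : ∀ a, ∃ f : N → ℝ, ContMDiffOn 𝓘(ℝ, E) 𝓘(ℝ, ℝ) ∞ f U ∧ c.σchk a = diff f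
  extD_θ : ∀ x ∈ U, extD (c.θ 0) x = -(form1 (c.σhat 0 x) * form1 (c.σhat 1 x)) -
    form1 (c.σchk 0 x) * form1 (c.σchk 1 x)

lemma IsWaveCoframe.swap {U : Set N} {c : AdaptedCoframe 1 I U} (hc : IsWaveCoframe c) :
    IsWaveCoframe c.swap :=
  ⟨hc.chk, hc.hat, fun x hx => (hc.extD_θ x hx).trans (by
    simp only [AdaptedCoframe.swap]; abel)⟩

lemma IsWaveCoframe.extD_σhat {U : Set N} {c : AdaptedCoframe 1 I U} (hc : IsWaveCoframe c)
    (hU : IsOpen U) (a : Fin 2) {x : N} (hx : x ∈ U) : extD (c.σhat a) x = 0 := by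
  obtain ⟨f, hf, hfa⟩ := hc.hat a
  rw [hfa]
  exact extD_diff hU hf hx

/-- The order `σ̂ = (dp, dx)`, `σ̌ = (dq, dy)` matches the signs in `dθ = -dp ∧ dx - dq ∧ dy`. -/
lemma IsWaveSystem.exists_coframe (hI : IsWaveSystem I) (z : N) :
    ∃ (U : Set N) (c : AdaptedCoframe 1 I U), IsOpen U ∧ z ∈ U ∧ IsWaveCoframe c := by
  obtain ⟨U, hU, hz, x, y, u, p, q, hsm, hz'⟩ := hI z
  have hx := hsm x (by simp)
  have hy := hsm y (by simp)
  have hu := hsm u (by simp)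
  have hp := hsm p (by simp)
  have hq := hsm q (by simp)
  have h1 := (smoothOn_diff hU hu).sub ((smoothOn_diff hU hx).smul hp)
  have h2 := (smoothOn_diff hU hy).smul hq
  let c : AdaptedCoframe 1 I U :=
    { θ := fun _ z => diff u z - p z • diff x z - q z • diff y z
      σhat := ![diff p, diff x]
      σchk := ![diff q, diff y]
      smooth_θ := fun _ => h1.sub h2
      smooth_σhat := Fin.forall_fin_two.2 ⟨smoothOn_diff hU hp, smoothOn_diff hU hx⟩
      smooth_σchk := Fin.forall_fin_two.2 ⟨smoothOn_diff hU hq, smoothOn_diff hU hy⟩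
      adapted := by
        intro z hz
        obtain ⟨hb, hg⟩ := hz' z hz
        have fd : FiniteDimensional ℝ (Tan E z) := inferInstanceAs (FiniteDimensional ℝ E)
        refine ⟨bijective_of_zero ?_ ?_, ?_⟩
        · let T : Tan E z →ₗ[ℝ] (Fin 5 → ℝ) :=
            { toFun := fun v => ![diff x z v, diff y z v, diff u z v, diff p z v, diff q z v]
              map_add' := fun v w => by ext i; fin_cases i <;> simp
              map_smul' := fun c v => by ext i; fin_cases i <;> simp }
          exact (LinearEquiv.ofBijective T hb).finrank_eq.trans (by simp)
        · intro v h1 h2 h3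
          have e1 : diff u z v - p z * diff x z v - q z * diff y z v = 0 := h1 0
          have e2 : diff p z v = 0 := h2 0
          have e3 : diff x z v = 0 := h2 1
          have e4 : diff q z v = 0 := h3 0
          have e5 : diff y z v = 0 := h3 1
          rw [e3, e5, mul_zero, mul_zero, sub_zero, sub_zero] at e1
          apply hb.1
          beta_reduce
          rw [e1, e2, e3, e4, e5, map_zero, map_zero, map_zero, map_zero, map_zero]
        · rw [hg, Set.range_const, Set.singleton_union]
          rfl }
  refine ⟨U, c, hU, hz, Fin.forall_fin_two.2 ⟨⟨p, hp, rfl⟩, ⟨x, hx, rfl⟩⟩,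
    Fin.forall_fin_two.2 ⟨⟨q, hq, rfl⟩, ⟨y, hy, rfl⟩⟩, fun z hz => ?_⟩
  have e1 := extD_sub hU h1 h2 hz
  rw [extD_sub hU (smoothOn_diff hU hu) ((smoothOn_diff hU hx).smul hp) hz,
    extD_smul hU hp (smoothOn_diff hU hx) hz, extD_smul hU hq (smoothOn_diff hU hy) hz,
    extD_diff hU hu hz, extD_diff hU hx hz, extD_diff hU hy hz, smul_zero, smul_zero, add_zero,
    add_zero, zero_sub] at e1
  exact e1

lemma IsWaveSystem.isHyperbolic (hI : IsWaveSystem I) : IsHyperbolic 1 I where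
  closed O hO η hη h x hx := by
    obtain ⟨U, c, hU, hxU, hc⟩ := hI.exists_coframe x
    refine c.extD_mem hU (fun e y hy => ?_) hO hη h hxU hx
    rw [Subsingleton.elim e 0, hc.extD_θ y hy, (c.adapted y hy).generates]
    exact sub_mem (neg_mem (Ideal.subset_span (Or.inr (Or.inl rfl))))
      (Ideal.subset_span (Or.inr (Or.inr rfl)))
  exists_coframe x := by
    obtain ⟨U, c, hU, hxU, -⟩ := hI.exists_coframe x
    exact ⟨U, hU, hxU, ⟨c⟩⟩

namespace Prolongation.ChartData

variable {h : IsHyperbolic 1 I} (d : ChartData h) (hc : IsWaveCoframe d.c)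
include hc

/-- The torsion is made of values of the `dσ̂`, and these forms are exact. -/
lemma tor_eq_zero {q : Prolongation h} (hq : q ∈ d.chart.source) : d.tor q = 0 := by
  obtain ⟨e, f, -, -, -, -, -, -, -, ht⟩ := d.exists_dual hq
  rw [ht, hc.extD_σhat d.isOpen _ hq.2.1, hc.extD_σhat d.isOpen _ hq.2.1]
  simp

lemma pi_eq {q : Prolongation h} (hq : q ∈ d.chart.source) :
    d.pi q = (diff d.hatSlope q : Cot (E × ℝ × ℝ) q) := by
  rw [pi, d.tor_eq_zero hc hq, zero_smul, add_zero]

lemma extD_con_wave {q : Prolongation h} (hq : q ∈ d.chart.source) :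
    extD d.con q = -(form1 (diff d.hatSlope q : Cot (E × ℝ × ℝ) q) * form1 (d.om q)) := by
  rw [d.extD_con hq, hc.extD_σhat d.isOpen _ hq.2.1, hc.extD_σhat d.isOpen _ hq.2.1]
  simp

lemma extD_pb_θ {q : Prolongation h} (hq : q ∈ d.chart.source) (v w : Tan (E × ℝ × ℝ) q) :
    ev2 v w (extD (pb (base h) (d.c.θ 0) : OneForm (E × ℝ × ℝ) _) q) =
      -(d.c.σhat 0 q.1.1 (dbase q v) * d.c.σhat 1 q.1.1 (dbase q w) -
        d.c.σhat 0 q.1.1 (dbase q w) * d.c.σhat 1 q.1.1 (dbase q v)) -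
      (d.c.σchk 0 q.1.1 (dbase q v) * d.c.σchk 1 q.1.1 (dbase q w) -
        d.c.σchk 0 q.1.1 (dbase q w) * d.c.σchk 1 q.1.1 (dbase q v)) := by
  rw [d.extD_pb_base (d.c.smooth_θ 0) hq, ev2_pull _ (extD_mem_twoForms _ _), hc.extD_θ _ hq.2.1,
    map_sub, map_neg, ev2_form1_mul, ev2_form1_mul]

/-- The first integrals of the prolongation of the wave equation: `σ̂¹, σ̂², da`. -/
lemma firstIntegrals_wave {q : Prolongation h} (hq : q ∈ d.chart.source) :
    firstIntegrals d.chart.source d.coframe.hatV q =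
      Submodule.span ℝ (Set.range ![pb (base h) (d.c.σhat 0) q, pb (base h) (d.c.σhat 1) q,
        (diff d.hatSlope q : Cot (E × ℝ × ℝ) q)]) := by
  apply le_antisymm
  · refine Submodule.span_le.2 ?_
    rintro _ ⟨O, f, hO, hqO, hOs, hf, hfV, rfl⟩
    obtain ⟨g, hg, hgf⟩ := (d.coframe.restrict hOs).exists_coeff_hat hO (smoothOn_diff hO hf) hfV
    have hgf : ∀ y ∈ O, (diff f y : Cot (E × ℝ × ℝ) y) = ∑ i, g i y •
      (Sum.elim d.conAll ![d.om, d.pi] i : OneForm (E × ℝ × ℝ) (Prolongation h)) y := hgf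
    have hsm : ∀ i, SmoothOn (Sum.elim d.conAll ![d.om, d.pi] i :
        OneForm (E × ℝ × ℝ) (Prolongation h)) O := by
      rintro (i | i)
      · exact (d.coframe.smooth_θ i).mono hOs
      · exact (d.coframe.smooth_σhat i).mono hOs
    have hdo : ∀ y ∈ O, ∀ v w, ev2 v w (extD d.om y) = 0 := by
      intro y hy v w
      rw [om, d.extD_pb_base (d.c.smooth_σhat _) (hOs hy), hc.extD_σhat d.isOpen _ (hOs hy).2.1,
        map_zero, map_zero]
    have hdp : ∀ y ∈ O, ∀ v w, ev2 v w (extD d.pi y) = 0 := by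
      intro y hy v w
      rw [extD_congr hO hy fun y hy => d.pi_eq hc (hOs hy),
        extD_diff d.isOpen_source d.contMDiffOn_hatSlope (hOs hy), map_zero]
    have hchar : ∀ y ∈ O, ∀ u : Tan (E × ℝ × ℝ) y, d.c.θ 0 y.1.1 (dbase y u) = 0 →
        (∀ k, d.c.σhat k y.1.1 (dbase y u) = 0) → diff d.hatSlope y u = 0 →
        pb (base h) (d.c.θ 0) y u = 0 ∧ d.con y u = 0 ∧ d.om y u = 0 ∧ d.pi y u = 0 := by
      intro y hy u h1 h2 h3
      refine ⟨h1, ?_, h2 _, (DFunLike.congr_fun (d.pi_eq hc (hOs hy)) u).trans h3⟩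
      have h4 : d.con y u = d.c.σhat d.i.rev y.1.1 (dbase y u) -
        d.hatSlope y * d.c.σhat d.i y.1.1 (dbase y u) := rfl
      rw [h4, h2, h2, mul_zero, sub_zero]
    -- The identity `d(df) = 0` is evaluated on vectors killed by `θ`, the `σ̂` and `da`. Only the
    -- coefficient of `θ` and that of the check contact form contribute. The latter form need not
    -- vanish on such vectors, which accounts for the final alternative.
    have hsum : ∀ y ∈ O, ∀ v w : Tan (E × ℝ × ℝ) y,
        d.c.θ 0 y.1.1 (dbase y v) = 0 → d.c.θ 0 y.1.1 (dbase y w) = 0 →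
        (∀ k, d.c.σhat k y.1.1 (dbase y v) = 0) → (∀ k, d.c.σhat k y.1.1 (dbase y w) = 0) →
        diff d.hatSlope y v = 0 → diff d.hatSlope y w = 0 →
        ((∀ z ∈ O, g (Sum.inl (Fin.natAdd 1 1)) z = 0) ∨ d.swap.con y v = 0 ∧ d.swap.con y w = 0) →
        g (Sum.inl (Fin.castAdd 2 0)) y *
          (d.c.σchk 0 y.1.1 (dbase y v) * d.c.σchk 1 y.1.1 (dbase y w) -
            d.c.σchk 0 y.1.1 (dbase y w) * d.c.σchk 1 y.1.1 (dbase y v)) +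
        g (Sum.inl (Fin.natAdd 1 1)) y * (diff d.chkSlope y v * d.c.σchk d.j y.1.1 (dbase y w) -
          diff d.chkSlope y w * d.c.σchk d.j y.1.1 (dbase y v)) = 0 := by
      intro y hy v w hv hw hv' hw' hv'' hw'' hs
      obtain ⟨v1, v2, v3, v4⟩ := hchar y hy v hv hv' hv''
      obtain ⟨w1, w2, w3, w4⟩ := hchar y hy w hw hw' hw''
      have h1 := sum_smul_ev2_extD hO hg hsm hgf hy (extD_diff hO hf hy) (v := v) (w := w) (by
        rintro (i | i)
        · refine Fin.addCases (fun i => ?_) (fun i => ?_) i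
          · right
            rw [Subsingleton.elim i 0]
            simp only [Sum.elim_inl, conAll, Fin.append_left]
            exact ⟨v1, w1⟩
          · fin_cases i
            · right
              simp only [Sum.elim_inl, conAll, Fin.append_right]
              exact ⟨v2, w2⟩
            · rcases hs with hs | hs
              · exact Or.inl hs
              · right
                simp only [Sum.elim_inl, conAll, Fin.append_right]
                exact hs
        · right
          fin_cases i
          · exact ⟨v3, w3⟩
          · exact ⟨v4, w4⟩)
      rw [Fintype.sum_sum_type, Fin.sum_univ_add, Fin.sum_univ_two, Fin.sum_univ_two] at h1
      simp only [Sum.elim_inl, Sum.elim_inr, conAll, Fin.append_left, Fin.append_right,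
        Finset.univ_unique, Fin.default_eq_zero, Finset.sum_singleton, Matrix.cons_val_zero,
        Matrix.cons_val_one] at h1
      have h2 := d.swap.extD_con_wave hc.swap (d.swap_mem_source (hOs hy))
      have h3 : d.swap.om y = pb (base h) (d.c.σchk d.j) y := rfl
      rw [hdo y hy, hdp y hy, d.extD_pb_θ hc (hOs hy), d.extD_con_wave hc (hOs hy), h2, map_neg,
        map_neg, ev2_form1_mul, ev2_form1_mul, hv', hw', hv', hw', hv'', hw''] at h1
      have h4 : d.swap.hatSlope = d.chkSlope := rfl
      have h5 : ∀ u, d.swap.om y u = d.c.σchk d.j y.1.1 (dbase y u) := fun _ => rfl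
      rw [h4, h5, h5] at h1
      linear_combination -h1
    -- The test pair is `∂/∂b` together with a lift of the check direction of the plane itself. Both
    -- are killed by the check contact form, and the `θ` term vanishes because the first is
    -- vertical.
    have hγ : ∀ y ∈ O, g (Sum.inl (Fin.natAdd 1 1)) y = 0 := by
      intro y hy
      have hys := hOs hy
      have had := d.c.adapted y.1.1 hys.2.1
      obtain ⟨v, hv⟩ := (d.bijective_dbase hys).2 (0, 0, 1)
      obtain ⟨w, hw⟩ := (d.bijective_dbase hys).2 (had.vec 0 (dir d.j (d.chkSlope y)), 0, 0)
      simp only [Prod.mk.injEq] at hv hw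
      have w1 := had.θ_vec 0 (dir d.j (d.chkSlope y))
      have w2 := had.σhat_vec 0 (dir d.j (d.chkSlope y))
      have w3 := had.σchk_vec 0 (dir d.j (d.chkSlope y))
      beta_reduce at w1 w2 w3
      have h1 := hsum y hy v w (by rw [hv.1, map_zero]) (by rw [hw.1, w1])
        (fun k => by rw [hv.1, map_zero]) (fun k => by rw [hw.1, w2]; rfl) hv.2.1 hw.2.1
        (Or.inr ?_)
      · rw [hv.1, hw.1, hv.2.2, hw.2.2, w3, w3, w3, dir_self] at h1
        simpa using h1
      · have h4 : ∀ u, d.swap.con y u = d.c.σchk d.j.rev y.1.1 (dbase y u) -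
          d.chkSlope y * d.c.σchk d.j y.1.1 (dbase y u) := fun _ => rfl
        rw [h4, h4, hv.1, hw.1, w3, w3, dir_self, dir_rev]
        simp
    -- The coefficient of the check contact form is now identically zero, so arbitrary check
    -- directions may be inserted; the lifts of the two dual vectors isolate the coefficient of `θ`.
    have hα : ∀ y ∈ O, g (Sum.inl (Fin.castAdd 2 0)) y = 0 := by
      intro y hy
      have hys := hOs hy
      have had := d.c.adapted y.1.1 hys.2.1
      obtain ⟨v, hv⟩ := (d.bijective_dbase hys).2 (had.vec 0 (Pi.single 0 1), 0, 0)
      obtain ⟨w, hw⟩ := (d.bijective_dbase hys).2 (had.vec 0 (Pi.single 1 1), 0, 0)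
      simp only [Prod.mk.injEq] at hv hw
      have v1 := had.θ_vec 0 (Pi.single 0 1)
      have v2 := had.σhat_vec 0 (Pi.single 0 1)
      have v3 := had.σchk_vec 0 (Pi.single 0 1)
      have w1 := had.θ_vec 0 (Pi.single 1 1)
      have w2 := had.σhat_vec 0 (Pi.single 1 1)
      have w3 := had.σchk_vec 0 (Pi.single 1 1)
      beta_reduce at v1 v2 v3 w1 w2 w3
      have h1 := hsum y hy v w (by rw [hv.1, v1]) (by rw [hw.1, w1])
        (fun k => by rw [hv.1, v2]; rfl) (fun k => by rw [hw.1, w2]; rfl) hv.2.1 hw.2.1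
        (Or.inl hγ)
      rw [hv.1, hw.1, hγ y hy, v3, v3, w3, w3] at h1
      simpa using h1
    -- What remains of `df` is a combination of `con`, `om` and `pi`, which vanish on every vector
    -- killed by both `σ̂` and `da`.
    rw [SetLike.mem_coe, mem_span_range_iff]
    intro v hv
    have hσ : ∀ k, d.c.σhat k q.1.1 (dbase q v) = 0 := Fin.forall_fin_two.2 ⟨hv 0, hv 1⟩
    have hp : d.pi q v = 0 := (DFunLike.congr_fun (d.pi_eq hc hq) v).trans (hv 2)
    have ho : d.om q v = 0 := hσ _
    have hcon : d.con q v = 0 := by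
      have h4 : d.con q v = d.c.σhat d.i.rev q.1.1 (dbase q v) -
        d.hatSlope q * d.c.σhat d.i q.1.1 (dbase q v) := rfl
      rw [h4, hσ, hσ, mul_zero, sub_zero]
    have h1 := DFunLike.congr_fun (hgf q hqO) v
    rw [Fintype.sum_sum_type, Fin.sum_univ_add, Fin.sum_univ_two, Fin.sum_univ_two] at h1
    simp only [Sum.elim_inl, Sum.elim_inr, conAll, Fin.append_left, Fin.append_right,
      Finset.univ_unique, Fin.default_eq_zero, Finset.sum_singleton, Matrix.cons_val_zero,
      Matrix.cons_val_one] at h1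
    rw [hα q hqO, hγ q hqO] at h1
    simpa [hp, ho, hcon] using h1
  · refine Submodule.span_le.2 ?_
    have key : ∀ k, pb (base h) (d.c.σhat k) q ∈
        firstIntegrals d.chart.source d.coframe.hatV q := by
      intro k
      obtain ⟨f, hf, hfk⟩ := hc.hat k
      have h1 : ∀ q ∈ d.chart.source, pb (base h) (d.c.σhat k) q =
          (diff (f ∘ base h) q : Cot (E × ℝ × ℝ) q) := by
        intro q hq
        rw [hfk]
        exact pb_diff (contMDiff_base q) (hf.contMDiffAt (d.isOpen.mem_nhds hq.2.1))
      rw [h1 q hq]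
      refine diff_mem_firstIntegrals d.isOpen_source d.isOpen_source hq hq
        (hf.comp contMDiff_base.contMDiffOn fun q hq => hq.2.1) fun q hq => ?_
      rw [← h1 q hq]
      exact d.σhat_mem_hatV k
    rintro _ ⟨i, rfl⟩
    fin_cases i
    · exact key 0
    · exact key 1
    · refine diff_mem_firstIntegrals d.isOpen_source d.isOpen_source hq hq
        d.contMDiffOn_hatSlope fun q hq => ?_
      rw [← d.pi_eq hc hq]
      exact Submodule.subset_span (Or.inr ⟨1, rfl⟩)

lemma mem_firstIntegrals_wave {q : Prolongation h} (hq : q ∈ d.chart.source)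
    {β : Cot (E × ℝ × ℝ) q} : β ∈ firstIntegrals d.chart.source d.coframe.hatV q ↔
      ∀ v, (∀ k, d.c.σhat k q.1.1 (dbase q v) = 0) → diff d.hatSlope q v = 0 → β v = 0 := by
  rw [d.firstIntegrals_wave hc hq, mem_span_range_iff]
  constructor
  · intro H v h1 h2
    refine H v fun i => ?_
    fin_cases i
    exacts [h1 0, h1 1, h2]
  · exact fun H v hv => H v (Fin.forall_fin_two.2 ⟨hv 0, hv 1⟩) (hv 2)

lemma finrank_firstIntegrals_wave {q : Prolongation h} (hq : q ∈ d.chart.source) :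
    Module.finrank ℝ (firstIntegrals d.chart.source d.coframe.hatV q) = 3 := by
  rw [d.firstIntegrals_wave hc hq]
  have had := d.c.adapted q.1.1 hq.2.1
  choose v hv using fun j : Fin 3 => (d.bijective_dbase hq).2
    (![had.vec (Pi.single 0 1) 0, had.vec (Pi.single 1 1) 0, 0] j, ![0, 0, 1] j, 0)
  simp only [Prod.mk.injEq] at hv
  have h1 := had.σhat_vec (Pi.single 0 1) 0
  have h2 := had.σhat_vec (Pi.single 1 1) 0
  beta_reduce at h1 h2
  have hli : LinearIndependent ℝ ![pb (base h) (d.c.σhat 0) q, pb (base h) (d.c.σhat 1) q,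
        (diff d.hatSlope q : Cot (E × ℝ × ℝ) q)] := by
    refine linearIndependent_of_dual (v := v) ?_
    have key : ∀ k j, pb (base h) (d.c.σhat k) q (v j) = d.c.σhat k q.1.1
        (![had.vec (Pi.single 0 1) 0, had.vec (Pi.single 1 1) 0, 0] j) := fun k j =>
      congrArg (d.c.σhat k q.1.1) (hv j).1
    intro i j
    fin_cases i
    · refine (key 0 j).trans ?_
      fin_cases j
      · exact h1 0
      · exact h2 0
      · exact map_zero _
    · refine (key 1 j).trans ?_
      fin_cases j
      · exact h1 1
      · exact h2 1
      · exact map_zero _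
    · refine (hv j).2.1.trans ?_
      fin_cases j <;> rfl
  rw [finrank_span_eq_card hli]
  rfl

/-- The hat first integrals contain `om` and `pi`, exactly what the check system lacks in the
adapted coframe. -/
lemma sup_firstIntegrals_wave {q : Prolongation h} (hq : q ∈ d.chart.source) :
    d.coframe.chkV q ⊔ firstIntegrals d.chart.source d.coframe.hatV q = ⊤ := by
  refine sup_eq_top_of_annihilator (τ := fun i => Sum.elim d.coframe.θ d.coframe.σchk i q)
    (τ' := ![pb (base h) (d.c.σhat 0) q, pb (base h) (d.c.σhat 1) q,
        (diff d.hatSlope q : Cot (E × ℝ × ℝ) q)]) ?_ ?_ ?_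
  · rintro (i | i)
    · exact Submodule.subset_span (Or.inl ⟨i, rfl⟩)
    · exact Submodule.subset_span (Or.inr ⟨i, rfl⟩)
  · rw [d.firstIntegrals_wave hc hq]
    exact fun i => Submodule.subset_span ⟨i, rfl⟩
  · intro v h1 h2
    refine (d.coframe.adapted q hq).eq_zero_of_coords (fun e => h1 (Sum.inl e)) ?_
      (fun a => h1 (Sum.inr a))
    have h3 : d.om q v = 0 := by
      have h4 : ∀ k, pb (base h) (d.c.σhat k) q v = 0 := Fin.forall_fin_two.2 ⟨h2 0, h2 1⟩
      exact h4 d.i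
    refine Fin.forall_fin_two.2 ⟨h3, ?_⟩
    exact (DFunLike.congr_fun (d.pi_eq hc hq) v).trans (h2 2)

end Prolongation.ChartData

/-- The prolongation of the wave equation is Darboux integrable. -/
lemma IsWaveSystem.isDarbouxIntegrableOn_system (hI : IsWaveSystem I) (h : IsHyperbolic 1 I) :
    IsDarbouxIntegrableOn 3 (Prolongation.system h) Set.univ := by
  refine isDarbouxIntegrableOn_of_coframe (Prolongation.isHyperbolic_system h) isOpen_univ 3 ?_
  intro q _
  obtain ⟨d, hc, hq⟩ : ∃ d : Prolongation.ChartData h, IsWaveCoframe d.c ∧ q ∈ d.chart.source := by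
    obtain ⟨U, c, hU, hx, hc⟩ := hI.exists_coframe q.1.1
    obtain ⟨i, j, hq⟩ := Prolongation.exists_mem_source hU c hx
    exact ⟨⟨U, hU, c, i, j, q⟩, hc, hq⟩
  have hq' := d.swap_mem_source hq
  have hcs : IsWaveCoframe d.swap.c := hc.swap
  refine ⟨_, d.coframe, d.isOpen_source, hq, d.finrank_firstIntegrals_wave hc hq, ?_, ?_,
    d.sup_firstIntegrals_wave hc hq, ?_⟩
  · rw [← d.firstIntegrals_swap hq]
    exact d.swap.finrank_firstIntegrals_wave hcs hq'
  · have h1 := d.swap.sup_firstIntegrals_wave hcs hq'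
    have h2 : d.swap.coframe.chkV q = d.coframe.hatV q := (d.swap.swap_coframe_hatV hq').symm
    rwa [d.firstIntegrals_swap hq, h2] at h1
  · rw [← d.firstIntegrals_swap hq, eq_bot_iff]
    intro β hβ
    have h1 := (d.mem_firstIntegrals_wave hc hq).1 hβ.1
    have h2 := (d.swap.mem_firstIntegrals_wave hcs hq').1 hβ.2
    have had := d.c.adapted q.1.1 hq.2.1
    rw [Submodule.mem_bot]
    ext v
    -- `w` has the `σ̂` and `da` components of `v`, and its `σ̌` and `db` components are zero. Hence
    -- `β` kills `w` as a check first integral and `v - w` as a hat first integral.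
    obtain ⟨w, hw⟩ := (d.bijective_dbase hq).2
      (had.vec (fun k => d.c.σhat k q.1.1 (Prolongation.dbase q v)) 0, diff d.hatSlope q v, 0)
    simp only [Prod.mk.injEq] at hw
    have e1 : β w = 0 := by
      refine h2 w (fun k => ?_) hw.2.2
      rw [hw.1]
      exact had.σchk_vec _ _ k
    have e2 : β (v - w) = 0 := by
      refine h1 _ (fun k => ?_) ?_
      · have h3 := had.σhat_vec (fun k => d.c.σhat k q.1.1 (Prolongation.dbase q v)) 0 k
        beta_reduce at h3
        rw [map_sub, map_sub, hw.1, h3, sub_self]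
      · rw [map_sub, hw.2.1, sub_self]
    rw [map_sub, e1, sub_zero] at e2
    exact e2

end Wave

/-! ### Genericity of slopes and descent of functions to the base. -/

section Density

variable {E : Type*} [NormedAddCommGroup E] [NormedSpace ℝ E]
  {N : Type*} [TopologicalSpace N] [ChartedSpace E N]
  [IsManifold 𝓘(ℝ, E) ∞ N] [FiniteDimensional ℝ E] {s : ℕ} {I : FormIdeal E N}

lemma AdaptedCoframe.eventually_ne_zero {U : Set N} (c : AdaptedCoframe s I U) (hU : IsOpen U)
    {η : OneForm E N} (hη : SmoothOn η U) {x : N} (hx : x ∈ U) (h : η x ≠ 0) :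
    ∀ᶠ y in 𝓝 x, η y ≠ 0 := by
  obtain ⟨f, hf, hfη⟩ := c.exists_coeff hU hη
  obtain ⟨i, hi⟩ : ∃ i, f i x ≠ 0 := by
    by_contra! hc
    exact h (by rw [hfη x hx]; simp [hc])
  have hc : ContinuousAt (f i) x := ((hf i).contMDiffAt (hU.mem_nhds hx)).continuousAt
  filter_upwards [hc.eventually_ne hi, hU.mem_nhds hx] with y hy hyU h0
  obtain ⟨v, hv⟩ := (c.all_bijective hyU).2 (Pi.single i 1)
  have h1 := DFunLike.congr_fun (hfη y hyU) v
  rw [h0] at h1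
  have h2 : ∀ j, c.all j y v = (Pi.single i 1 : _ → ℝ) j := fun j => congrFun hv j
  simp [h2, Pi.single_apply, -Fintype.sum_sum_type] at h1
  exact hy h1.symm

/-- Directions with different slopes form a basis; `r` and `t` solve `r + t = m i` and `r a + t b =
m i.rev`. -/
lemma eq_comb_dir (i : Fin 2) {a b : ℝ} (h : a ≠ b) (m : Fin 2 → ℝ) :
    ∃ r t : ℝ, m = r • dir i a + t • dir i b := by
  have h' : a - b ≠ 0 := sub_ne_zero.2 h
  refine ⟨(m i.rev - b * m i) / (a - b), m i - (m i.rev - b * m i) / (a - b), ?_⟩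
  ext k
  rcases Prolongation.ChartData.rev_or i k with rfl | rfl
  · simp [dir_self]
  · simp only [Pi.add_apply, Pi.smul_apply, dir_rev, smul_eq_mul]
    field_simp
    ring

/-- Two distinct slopes suffice to test a covector on the whole 2-dimensional hat space. -/
lemma IsAdapted.apply_vec_eq_zero {V : Type*} [AddCommGroup V] [Module ℝ V] [TopologicalSpace V]
    {K : Ideal (Ext V)} {θ : Fin s → (V →L[ℝ] ℝ)} {σ τ : Fin 2 → (V →L[ℝ] ℝ)}
    (h : IsAdapted K θ σ τ) {α : V →L[ℝ] ℝ} (i : Fin 2) {a b : ℝ} (hab : a ≠ b)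
    (ha : α (h.vec (dir i a) 0) = 0) (hb : α (h.vec (dir i b) 0) = 0) (m : Fin 2 → ℝ) :
    α (h.vec m 0) = 0 := by
  obtain ⟨r, t, rfl⟩ := eq_comb_dir i hab m
  have h1 : h.vec (r • dir i a + t • dir i b) 0 =
      r • h.vec (dir i a) 0 + t • h.vec (dir i b) 0 := by
    rw [h.vec_smul, h.vec_smul, h.vec_add, smul_zero, smul_zero, add_zero]
  rw [h1, map_add, map_smul, map_smul, ha, hb]
  simp

lemma exists_mem_not_mem_of_finrank_lt {V : Type*} [AddCommGroup V] [Module ℝ V] {S : Set V}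
    {T : Submodule ℝ V} [FiniteDimensional ℝ T]
    (h : Module.finrank ℝ T < Module.finrank ℝ (Submodule.span ℝ S)) : ∃ α ∈ S, α ∉ T := by
  by_contra! hc
  exact absurd (Submodule.finrank_mono (Submodule.span_le.2 hc)) (by omega)

namespace Prolongation.ChartData

variable {h : IsHyperbolic s I} (d : ChartData h)

lemma elt_mem_source {x : N} (hx : x ∈ d.U) (hxφ : x ∈ d.φ.source) (a b : ℝ) :
    d.elt hx a b ∈ d.chart.source := ⟨hxφ, hx, d.good_elt hx a b⟩

lemma hom_symm_eq {x : N} (hx : x ∈ d.U) (hxφ : x ∈ d.φ.source) (a b : ℝ) :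
    d.hom.symm (d.φ x, a, b) = d.elt hx a b :=
  d.inv_eq_of_eq (p := (d.φ x, a, b)) hx (d.φ.left_inv hxφ)

/-- In the chart, an open set contains a ball about each of its points. With the maximum norm this
ball is a product, so the slopes can vary over intervals independently of the base point. -/
lemma exists_box {x₀ : N} (hx₀ : x₀ ∈ d.U) (hφ : x₀ ∈ d.φ.source) {a₀ b₀ : ℝ}
    {O : Set (Prolongation h)} (hO : IsOpen O) (hmem : d.elt hx₀ a₀ b₀ ∈ O) :
    ∃ R : Set N, IsOpen R ∧ x₀ ∈ R ∧ R ⊆ d.φ.source ∧ R ⊆ d.U ∧ ∃ ε > 0, ∀ x (hx : x ∈ d.U), x ∈ R →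
      ∀ a ∈ Metric.ball a₀ ε, ∀ b ∈ Metric.ball b₀ ε, d.elt hx a b ∈ O := by
  have hT := d.hom.isOpen_inter_preimage_symm hO
  have hp : (d.φ x₀, a₀, b₀) ∈ d.hom.target ∩ d.hom.symm ⁻¹' O := by
    refine ⟨⟨d.φ.map_source hφ, ?_⟩, ?_⟩
    · show d.φ.symm (d.φ x₀) ∈ d.U
      rwa [d.φ.left_inv hφ]
    · rw [Set.mem_preimage, d.hom_symm_eq hx₀ hφ]
      exact hmem
  obtain ⟨ε, hε, hball⟩ := Metric.isOpen_iff.1 hT _ hp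
  refine ⟨d.φ.source ∩ d.φ ⁻¹' Metric.ball (d.φ x₀) ε ∩ d.U,
    (d.φ.isOpen_inter_preimage Metric.isOpen_ball).inter d.isOpen,
    ⟨⟨hφ, Metric.mem_ball_self hε⟩, hx₀⟩, fun x hx => hx.1.1, fun x hx => hx.2, ε, hε,
    fun x hx hxR a ha b hb => ?_⟩
  rw [← d.hom_symm_eq hx hxR.1.1]
  refine (hball ?_).2
  rw [← ball_prod_same, ← ball_prod_same]
  exact ⟨hxR.1.2, ha, hb⟩

/-- A function whose differential annihilates the fibres of the projection descends. -/
lemma exists_descend {x₀ : N} (hx₀ : x₀ ∈ d.U) (hφ : x₀ ∈ d.φ.source) {a₀ b₀ : ℝ}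
    {O : Set (Prolongation h)} (hO : IsOpen O) (hmem : d.elt hx₀ a₀ b₀ ∈ O)
    {F : Prolongation h → ℝ} (hF : ContMDiffOn 𝓘(ℝ, E × ℝ × ℝ) 𝓘(ℝ, ℝ) ∞ F O)
    (hv : ∀ q ∈ O, ∀ v : Tan (E × ℝ × ℝ) q, dbase q v = 0 → diff F q v = 0) :
    ∃ (R : Set N) (g : N → ℝ), IsOpen R ∧ x₀ ∈ R ∧ R ⊆ d.U ∧ R ⊆ d.φ.source ∧
      ContMDiffOn 𝓘(ℝ, E) 𝓘(ℝ, ℝ) ∞ g R ∧ ∃ ε > 0, ∀ x (hx : x ∈ d.U), x ∈ R →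
      ∀ a ∈ Metric.ball a₀ ε, ∀ b ∈ Metric.ball b₀ ε, d.elt hx a b ∈ O ∧
        ∀ v, diff F (d.elt hx a b) v = diff g x (dbase (d.elt hx a b) v) := by
  obtain ⟨R, hR, hxR, hRφ, hRU, ε, hε, hbox⟩ := d.exists_box hx₀ hφ hO hmem
  have hsymm : ∀ x (hx : x ∈ d.U), x ∈ d.φ.source → ∀ a b, ContMDiffAt 𝓘(ℝ, E × ℝ × ℝ)
      𝓘(ℝ, E × ℝ × ℝ) ∞ d.hom.symm (d.φ x, a, b) := fun x hx hxφ a b =>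
    contMDiffAt_chart_symm d.hom_mem ⟨d.φ.map_source hxφ, by
      show d.φ.symm (d.φ x) ∈ d.U
      rwa [d.φ.left_inv hxφ]⟩
  have hconst : ∀ x (hx : x ∈ d.U), x ∈ R → ∀ a ∈ Metric.ball a₀ ε, ∀ b ∈ Metric.ball b₀ ε,
      F (d.elt hx a b) = F (d.elt hx a₀ b₀) := by
    intro x hx hxR
    have hxφ := hRφ hxR
    have hι : ∀ r : ℝ × ℝ, ContMDiffAt 𝓘(ℝ, ℝ × ℝ) 𝓘(ℝ, E × ℝ × ℝ) ∞
        (fun r : ℝ × ℝ => d.hom.symm (d.φ x, r)) r := fun r =>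
      (hsymm x hx hxφ r.1 r.2).comp r
        (contMDiffAt_iff_contDiffAt.2 (contDiffAt_const.prodMk contDiffAt_id))
    -- The slice over a fixed `x` projects to a constant, so its velocities are vertical and `F` has
    -- zero derivative along it; the ball is convex, whence `F` is constant there.
    have hk : ∀ r ∈ Metric.ball (a₀, b₀) ε, HasFDerivAt (fun r : ℝ × ℝ => F (d.hom.symm (d.φ x, r)))
        (0 : ℝ × ℝ →L[ℝ] ℝ) r := by
      intro r hr
      rw [← ball_prod_same] at hr
      have hr' : d.hom.symm (d.φ x, r) ∈ O := by
        rw [d.hom_symm_eq hx hxφ r.1 r.2]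
        exact hbox x hx hxR r.1 hr.1 r.2 hr.2
      have hFr := hF.contMDiffAt (hO.mem_nhds hr')
      have h1 : ContMDiffAt 𝓘(ℝ, ℝ × ℝ) 𝓘(ℝ, ℝ) ∞
        (F ∘ fun r : ℝ × ℝ => d.hom.symm (d.φ x, r)) r := hFr.comp r (hι r)
      have h2 := dmap_comp (hι r) hFr
      have h3 := dmap_comp (hι r) (contMDiff_base (d.hom.symm (d.φ x, r)))
      have h4 : (base h ∘ fun r : ℝ × ℝ => d.hom.symm (d.φ x, r)) = fun _ => x := by
        ext r
        rw [Function.comp_apply, d.hom_symm_eq hx hxφ r.1 r.2]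
        rfl
      have h5 : ∀ u : Tan (ℝ × ℝ) r, dmap (ℝ × ℝ) E
          (base h ∘ fun r : ℝ × ℝ => d.hom.symm (d.φ x, r)) r u = 0 := by
        intro u
        rw [h4]
        exact DFunLike.congr_fun (mfderiv_const (I := 𝓘(ℝ, ℝ × ℝ)) (I' := 𝓘(ℝ, E)) (x := r)
          (c := x)) u
      have h6 : fderiv ℝ (F ∘ fun r : ℝ × ℝ => d.hom.symm (d.φ x, r)) r = 0 := by
        rw [← mfderiv_eq_fderiv]
        refine ContinuousLinearMap.ext fun u => ?_
        refine (DFunLike.congr_fun h2 u).trans (hv _ hr' _ ?_)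
        exact (DFunLike.congr_fun h3 u).symm.trans (h5 u)
      have h7 := ((contMDiffAt_iff_contDiffAt.1 h1).differentiableAt (by simp)).hasFDerivAt
      rwa [h6] at h7
    intro a ha b hb
    have h1 := (convex_ball (a₀, b₀) ε).is_const_of_fderivWithin_eq_zero (𝕜 := ℝ)
      (f := fun r : ℝ × ℝ => F (d.hom.symm (d.φ x, r)))
      (fun r hr => (hk r hr).differentiableAt.differentiableWithinAt)
      (fun r hr => by
        rw [fderivWithin_of_isOpen Metric.isOpen_ball hr]
        exact (hk r hr).fderiv)
      (x := (a, b)) (y := (a₀, b₀)) (by rw [← ball_prod_same]; exact ⟨ha, hb⟩)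
      (Metric.mem_ball_self hε)
    beta_reduce at h1
    rwa [d.hom_symm_eq hx hxφ, d.hom_symm_eq hx hxφ] at h1
  have ha₀ := Metric.mem_ball_self (x := a₀) hε
  have hb₀ := Metric.mem_ball_self (x := b₀) hε
  have hg : ContMDiffOn 𝓘(ℝ, E) 𝓘(ℝ, ℝ) ∞ (fun x => F (d.hom.symm (d.φ x, a₀, b₀))) R := by
    intro x hxR
    have hx := hRU hxR
    have h1 : d.hom.symm (d.φ x, a₀, b₀) ∈ O := by
      rw [d.hom_symm_eq hx (hRφ hxR)]
      exact hbox x hx hxR _ ha₀ _ hb₀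
    have h2 : ContMDiffAt 𝓘(ℝ, E) 𝓘(ℝ, E × ℝ × ℝ) ∞ (fun x => (d.φ x, a₀, b₀)) x :=
      (contMDiffAt_chart d.φ_mem (hRφ hxR)).prodMk_space contMDiffAt_const
    exact ((hF.contMDiffAt (hO.mem_nhds h1)).comp x
      ((hsymm x hx (hRφ hxR) a₀ b₀).comp x h2)).contMDiffWithinAt
  refine ⟨R, _, hR, hxR, hRU, hRφ, hg, ε, hε, fun x hx hxR a ha b hb =>
    ⟨hbox x hx hxR a ha b hb, fun v => ?_⟩⟩
  have hqs := d.elt_mem_source hx (hRφ hxR) a b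
  have hn := d.isOpen_source.mem_nhds hqs
  have h1 := pb_diff (contMDiff_base (d.elt hx a b)) (hg.contMDiffAt (hR.mem_nhds hxR))
  -- Near the given element `F` coincides with the composition of `g` and the projection, because
  -- `F` does not depend on the slopes in the box.
  have h2 : (diff F (d.elt hx a b) : Cot (E × ℝ × ℝ) _) =
      diff ((fun x => F (d.hom.symm (d.φ x, a₀, b₀))) ∘ base h) (d.elt hx a b) := by
    refine diff_congr ?_
    have c1 := (d.contMDiffOn_hatSlope.contMDiffAt hn).continuousAt
    have c2 := (d.contMDiffOn_chkSlope.contMDiffAt hn).continuousAt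
    have c3 := (contMDiff_base (d.elt hx a b)).continuousAt
    have n1 := c1 (Metric.isOpen_ball.mem_nhds (by rwa [d.hatSlope_elt]))
    have n2 := c2 (Metric.isOpen_ball.mem_nhds (by rwa [d.chkSlope_elt]))
    filter_upwards [hn, n1, n2, c3 (hR.mem_nhds hxR)] with q hq hqa hqb hqR
    have e1 := d.eq_elt hq.2.1 hq.2.2
    have e2 : F q = F (d.elt hq.2.1 (d.hatSlope q) (d.chkSlope q)) := congrArg F e1
    rw [e2, hconst q.1.1 hq.2.1 hqR _ hqa _ hqb]
    exact congrArg F (d.hom_symm_eq hq.2.1 (hRφ hqR) a₀ b₀).symm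
  rw [h2, ← h1]
  rfl

end Prolongation.ChartData

end Density

/-! ### First integrals modulo contact forms. -/

section Generic

variable {E : Type*} [NormedAddCommGroup E] [NormedSpace ℝ E]
  {N : Type*} [TopologicalSpace N] [ChartedSpace E N]
  [IsManifold 𝓘(ℝ, E) ∞ N] [FiniteDimensional ℝ E] {s : ℕ} {I : FormIdeal E N}

namespace Prolongation.ChartData

variable {h : IsHyperbolic s I} (d : ChartData h)

lemma apply_eq_zero_of_mem_hatV {q : Prolongation h} (hq : q ∈ d.chart.source)
    {β : Cot (E × ℝ × ℝ) q} (hβ : β ∈ d.coframe.hatV q) {v : Tan (E × ℝ × ℝ) q}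
    (h1 : dbase q v ∈ q.1.2) (h2 : d.om q v = 0) (h3 : d.pi q v = 0) : β v = 0 := by
  have had := d.coframe.adapted q hq
  have h4 : ∀ k, d.conAll k q v = 0 := by
    intro k
    refine mem_contact_iff.1 ?_ v h1
    rw [d.contact_eq_span hq]
    exact Submodule.subset_span ⟨k, rfl⟩
  have h5 : v = had.vec 0 (fun a => d.coframe.σchk a q v) :=
    had.eq_vec h4 (Fin.forall_fin_two.2 ⟨h2, h3⟩) fun a => rfl
  rw [h5]
  exact had.mem_hat.1 hβ _

/-- Modulo contact forms, the differential of a first integral is a combination of `σ̂ⁱ` and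
`π̂`. -/
lemma exists_coeff_om_pi {O : Set (Prolongation h)} (hO : IsOpen O) (hOs : O ⊆ d.chart.source)
    {F : Prolongation h → ℝ} (hF : ContMDiffOn 𝓘(ℝ, E × ℝ × ℝ) 𝓘(ℝ, ℝ) ∞ F O)
    (hFV : ∀ q ∈ O, diff F q ∈ d.coframe.hatV q) :
    ∃ A B : Prolongation h → ℝ, ContinuousOn A O ∧ ContinuousOn B O ∧
      ∀ q ∈ O, ∀ v : Tan (E × ℝ × ℝ) q, dbase q v ∈ q.1.2 →
        diff F q v = A q * d.om q v + B q * d.pi q v := by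
  obtain ⟨f, hf, hfF⟩ := (d.coframe.restrict hOs).exists_coeff_hat hO (smoothOn_diff hO hF) hFV
  refine ⟨f (Sum.inr 0), f (Sum.inr 1), (hf _).continuousOn, (hf _).continuousOn,
    fun q hq v hv => ?_⟩
  have h4 : ∀ k, d.conAll k q v = 0 := by
    intro k
    refine mem_contact_iff.1 ?_ v hv
    rw [d.contact_eq_span (hOs hq)]
    exact Submodule.subset_span ⟨k, rfl⟩
  have h5 : (diff F q : Cot (E × ℝ × ℝ) q) = ∑ i, f i q •
      (Sum.elim d.conAll ![d.om, d.pi] i : OneForm (E × ℝ × ℝ) (Prolongation h)) q := hfF q hq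
  have h6 := DFunLike.congr_fun h5 v
  simpa [Fintype.sum_sum_type, h4] using h6

/-- The vector which projects to `σ̂`-direction of the plane. -/
lemma exists_horizontal {q : Prolongation h} (hq : q ∈ d.chart.source) :
    ∃ v : Tan (E × ℝ × ℝ) q, dbase q v = (d.c.adapted q.1.1 hq.2.1).vec
      (dir d.i (d.hatSlope q)) 0 ∧ dbase q v ∈ q.1.2 ∧ d.om q v = 1 ∧ d.pi q v = 0 := by
  have had := d.c.adapted q.1.1 hq.2.1
  obtain ⟨v, hv⟩ := (d.bijective_dbase hq).2 (had.vec (dir d.i (d.hatSlope q)) 0, 0, 0)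
  simp only [Prod.mk.injEq] at hv
  have h1 := had.θ_vec (dir d.i (d.hatSlope q)) 0
  have h2 := had.σhat_vec (dir d.i (d.hatSlope q)) 0
  have h3 := had.σchk_vec (dir d.i (d.hatSlope q)) 0
  beta_reduce at h1 h2 h3
  refine ⟨v, hv.1, ?_, ?_, ?_⟩
  · rw [d.mem_plane_iff hq, hv.1, h2, h2, h3, h3, dir_self, dir_rev]
    exact ⟨h1, by simp, by simp⟩
  · have h4 : d.om q v = d.c.σhat d.i q.1.1 (dbase q v) := rfl
    rw [h4, hv.1, h2, dir_self]
  · have h4 : d.pi q v = diff d.hatSlope q v + d.tor q * d.c.σchk d.j q.1.1 (dbase q v) := rfl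
    rw [h4, hv.1, h3, hv.2.1]
    simp

/-- The vertical vector along the fibre coordinate `a`. -/
lemma exists_vertical {q : Prolongation h} (hq : q ∈ d.chart.source) :
    ∃ v : Tan (E × ℝ × ℝ) q, dbase q v = 0 ∧ d.om q v = 0 ∧ d.pi q v = 1 := by
  obtain ⟨v, hv⟩ := (d.bijective_dbase hq).2 (0, 1, 0)
  simp only [Prod.mk.injEq] at hv
  refine ⟨v, hv.1, ?_, ?_⟩
  · have h4 : d.om q v = d.c.σhat d.i q.1.1 (dbase q v) := rfl
    rw [h4, hv.1, map_zero]
  · have h4 : d.pi q v = diff d.hatSlope q v + d.tor q * d.c.σchk d.j q.1.1 (dbase q v) := rfl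
    rw [h4, hv.1, hv.2.1, map_zero, mul_zero, add_zero]

lemma pb_mem_hatV {q : Prolongation h} {β : Cot E q.1.1} (hβ : β ∈ d.c.hatV q.1.1) :
    β.comp (dbase q) ∈ d.coframe.hatV q := by
  have h1 : d.c.hatV q.1.1 ≤ (d.coframe.hatV q).comap (pullCov (dbase q)) := by
    refine Submodule.span_le.2 ?_
    rintro _ (⟨e, rfl⟩ | ⟨a, rfl⟩)
    · exact d.θ_mem_hatV e
    · exact d.σhat_mem_hatV a
  exact h1 hβ

/-- If a first integral descends to the base, then it descends to a first integral. -/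
lemma exists_descend_firstIntegral {x₀ : N} (hx₀ : x₀ ∈ d.U) (hφ : x₀ ∈ d.φ.source) {a₀ b₀ : ℝ}
    {O : Set (Prolongation h)} (hO : IsOpen O) (hmem : d.elt hx₀ a₀ b₀ ∈ O)
    {F : Prolongation h → ℝ} (hF : ContMDiffOn 𝓘(ℝ, E × ℝ × ℝ) 𝓘(ℝ, ℝ) ∞ F O)
    (hFV : ∀ q ∈ O, diff F q ∈ d.coframe.hatV q)
    (hv : ∀ q ∈ O, ∀ v : Tan (E × ℝ × ℝ) q, dbase q v = 0 → diff F q v = 0) :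
    ∃ β ∈ firstIntegrals d.U d.c.hatV x₀,
      ∀ v, diff F (d.elt hx₀ a₀ b₀) v = β (dbase (d.elt hx₀ a₀ b₀) v) := by
  obtain ⟨R, g, hR, hxR, hRU, hRφ, hg, ε, hε, hdesc⟩ := d.exists_descend hx₀ hφ hO hmem hF hv
  have ha₀ := Metric.mem_ball_self (x := a₀) hε
  have hb₀ := Metric.mem_ball_self (x := b₀) hε
  have hb₁ : b₀ + ε / 2 ∈ Metric.ball b₀ ε := by
    rw [Metric.mem_ball, Real.dist_eq, add_sub_cancel_left, abs_of_pos (half_pos hε)]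
    linarith
  refine ⟨diff g x₀, diff_mem_firstIntegrals d.isOpen hR hx₀ hxR hg fun x hxR => ?_,
    (hdesc x₀ hx₀ hxR _ ha₀ _ hb₀).2⟩
  have hx := hRU hxR
  have had := d.c.adapted x hx
  have key : ∀ b ∈ Metric.ball b₀ ε, diff g x (had.vec 0 (dir d.j b)) = 0 := by
    intro b hb
    obtain ⟨hqO, hFg⟩ := hdesc x hx hxR a₀ ha₀ b hb
    have hqs := d.elt_mem_source hx (hRφ hxR) a₀ b
    -- The component `-tor` along `a` makes `pi` vanish, so this lift of the check direction is a
    -- characteristic vector of the prolonged hat system.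
    obtain ⟨v, hv⟩ := (d.bijective_dbase hqs).2
      (had.vec 0 (dir d.j b), -d.tor (d.elt hx a₀ b), 0)
    have hv1 : dbase (d.elt hx a₀ b) v = had.vec 0 (dir d.j b) := congrArg Prod.fst hv
    have hv2 : diff d.hatSlope (d.elt hx a₀ b) v = -d.tor (d.elt hx a₀ b) :=
      congrArg (fun p => p.2.1) hv
    rw [← hv1, ← hFg v]
    have h2 := had.σhat_vec 0 (dir d.j b)
    have h3 := had.σchk_vec 0 (dir d.j b)
    beta_reduce at h2 h3
    refine d.apply_eq_zero_of_mem_hatV hqs (hFV _ hqO) ?_ ?_ ?_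
    · rw [hv1]
      exact Submodule.subset_span (R := ℝ) (M := Tan E x) (Or.inr rfl)
    · exact (congrArg (d.c.σhat d.i x) hv1).trans (h2 d.i)
    · have h4 : d.pi (d.elt hx a₀ b) v = diff d.hatSlope _ v +
        d.tor (d.elt hx a₀ b) * d.c.σchk d.j x (dbase (d.elt hx a₀ b) v) := rfl
      rw [h4, hv2, hv1, h3, dir_self]
      ring
  refine had.mem_hat.2 fun n => ?_
  rw [← had.vec_swap]
  -- The differential of `g` does not depend on `b`, so it kills the check directions of two
  -- different slopes, hence all of them.
  refine had.swap.apply_vec_eq_zero d.j (a := b₀) (b := b₀ + ε / 2) (by linarith) ?_ ?_ n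
  · rw [had.vec_swap]
    exact key _ hb₀
  · rw [had.vec_swap]
    exact key _ hb₁

end Prolongation.ChartData

end Generic

/-! ### Independence of first integrals and contact forms for a Monge-Ampère system. -/

section MongeAmpere

variable {E : Type*} [NormedAddCommGroup E] [NormedSpace ℝ E]
  {N : Type*} [TopologicalSpace N] [ChartedSpace E N]
  [IsManifold 𝓘(ℝ, E) ∞ N] [FiniteDimensional ℝ E] {I : FormIdeal E N}

instance (x : N) : FiniteDimensional ℝ (Tan E x) := inferInstanceAs (FiniteDimensional ℝ E)

lemma exists_firstIntegral_not_mem {U : Set N} {V : ∀ x : N, Submodule ℝ (Cot E x)} {x : N}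
    {T : Submodule ℝ (Cot E x)} [FiniteDimensional ℝ T]
    (h : Module.finrank ℝ T < Module.finrank ℝ (firstIntegrals U V x)) :
    ∃ (O : Set N) (f : N → ℝ), IsOpen O ∧ x ∈ O ∧ O ⊆ U ∧
      ContMDiffOn 𝓘(ℝ, E) 𝓘(ℝ, ℝ) ∞ f O ∧ (∀ y ∈ O, diff f y ∈ V y) ∧ diff f x ∉ T := by
  obtain ⟨α, ⟨O, f, hO, hxO, hOU, hf, hfV, rfl⟩, hα⟩ := exists_mem_not_mem_of_finrank_lt h
  exact ⟨O, f, hO, hxO, hOU, hf, hfV, hα⟩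

namespace Prolongation.ChartData

variable {h : IsHyperbolic 1 I} (d : ChartData h)

/-- By the contact condition, the pull-back of a first integral of the base is not contact
somewhere. -/
lemma exists_not_contact (hct : ∀ U : Set N, IsOpen U → ∀ θ : OneForm E N, SmoothOn θ U →
      (∀ x ∈ U, form1 (θ x) ∈ I x ∧ θ x ≠ 0) → ∀ x ∈ U, form1 (θ x) * extD θ x * extD θ x ≠ 0)
    {x₀ : N} (hx₀ : x₀ ∈ d.U) (hφ : x₀ ∈ d.φ.source) {a₀ b₀ : ℝ}
    {O : Set (Prolongation h)} (hO : IsOpen O) (hmem : d.elt hx₀ a₀ b₀ ∈ O) {Q : Set N}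
    (hQ : IsOpen Q) (hxQ : x₀ ∈ Q) {f : N → ℝ} (hf : ContMDiffOn 𝓘(ℝ, E) 𝓘(ℝ, ℝ) ∞ f Q)
    (hfV : ∀ x ∈ Q, diff f x ∈ d.c.hatV x) (hf0 : (diff f x₀ : Cot E x₀) ≠ 0) :
    ∃ q, ∃ hq : q ∈ d.chart.source, q ∈ O ∧ q.1.1 ∈ Q ∧
      diff f q.1.1 ((d.c.adapted q.1.1 hq.2.1).vec (dir d.i (d.hatSlope q)) 0) ≠ 0 := by
  -- Otherwise `df` kills the hat directions for an interval of slopes, so it belongs to the ideal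
  -- near `x₀`. Being nonzero there, it would be subject to the contact condition, which `d(df) = 0`
  -- violates.
  by_contra! hc
  obtain ⟨R, hR, hxR, hRφ, hRU, ε, hε, hbox⟩ := d.exists_box hx₀ hφ hO hmem
  have ha₀ := Metric.mem_ball_self (x := a₀) hε
  have hb₀ := Metric.mem_ball_self (x := b₀) hε
  have ha₁ : a₀ + ε / 2 ∈ Metric.ball a₀ ε := by
    rw [Metric.mem_ball, Real.dist_eq, add_sub_cancel_left, abs_of_pos (half_pos hε)]
    linarith
  have hθ : ∀ x ∈ R ∩ Q, form1 (diff f x : Cot E x) ∈ I x := by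
    rintro x ⟨hxR, hxQ⟩
    have hx := hRU hxR
    have had := d.c.adapted x hx
    have key : ∀ a ∈ Metric.ball a₀ ε, diff f x (had.vec (dir d.i a) 0) = 0 := by
      intro a ha
      have h1 := hc (d.elt hx a b₀) (d.elt_mem_source hx (hRφ hxR) a b₀)
        (hbox x hx hxR a ha b₀ hb₀) hxQ
      rw [d.hatSlope_elt] at h1
      exact h1
    rw [had.form1_mem, had.mem_span_θ]
    intro m n
    rw [had.vec_eq_add, map_add, had.mem_hat.1 (hfV x hxQ) n, add_zero]
    exact had.apply_vec_eq_zero d.i (a := a₀) (b := a₀ + ε / 2) (by linarith) (key _ ha₀)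
      (key _ ha₁) m
  have hsm := smoothOn_diff hQ hf
  have hne := (d.c.restrict (Set.inter_subset_left : d.U ∩ Q ⊆ d.U)).eventually_ne_zero
    (d.isOpen.inter hQ) (hsm.mono Set.inter_subset_right) ⟨hx₀, hxQ⟩ hf0
  obtain ⟨T, hT, hTo, hxT⟩ := eventually_nhds_iff.1 hne
  refine hct (T ∩ (R ∩ Q)) (hTo.inter (hR.inter hQ)) (diff f) (hsm.mono fun x hx => hx.2.2)
    (fun x hx => ⟨hθ x hx.2, hT x hx.1⟩) x₀ ⟨hxT, hxR, hxQ⟩ ?_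
  rw [extD_diff hQ hf hxQ, mul_zero]

/-- On an open subset, the first integrals are independent of the contact forms. -/
lemma exists_isOpen_inf_contact
    (hct : ∀ U : Set N, IsOpen U → ∀ θ : OneForm E N, SmoothOn θ U →
      (∀ x ∈ U, form1 (θ x) ∈ I x ∧ θ x ≠ 0) → ∀ x ∈ U, form1 (θ x) * extD θ x * extD θ x ≠ 0)
    (hr₁ : ∀ x ∈ d.U, Module.finrank ℝ (firstIntegrals d.U d.c.hatV x) = 1)
    (hr₂ : ∀ q ∈ d.chart.source,
      Module.finrank ℝ (firstIntegrals d.chart.source d.coframe.hatV q) = 2)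
    {O : Set (Prolongation h)} (hO : IsOpen O) (hOs : O ⊆ d.chart.source) (hne : O.Nonempty) :
    ∃ O' ⊆ O, IsOpen O' ∧ O'.Nonempty ∧ ∀ q ∈ O',
      firstIntegrals d.chart.source d.coframe.hatV q ⊓ contact q = ⊥ := by
  obtain ⟨q₀, hq₀⟩ := hne
  obtain ⟨x₀, hx₀, a₀, b₀, hφ, rfl⟩ := d.exists_elt (hOs hq₀)
  obtain ⟨Q, f, hQ, hxQ, hQU, hf, hfV, hf0⟩ := exists_firstIntegral_not_mem
    (T := (⊥ : Submodule ℝ (Cot E x₀))) (by rw [hr₁ x₀ hx₀, finrank_bot]; exact one_pos)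
  obtain ⟨q₁, hq₁s, hq₁O, hq₁Q, hq₁⟩ := d.exists_not_contact hct hx₀ hφ hO hq₀ hQ hxQ hf hfV hf0
  have hP : IsOpen (O ∩ base h ⁻¹' Q) := hO.inter (hQ.preimage contMDiff_base.continuous)
  have hF : ContMDiffOn 𝓘(ℝ, E × ℝ × ℝ) 𝓘(ℝ, ℝ) ∞ (f ∘ base h) (O ∩ base h ⁻¹' Q) :=
    hf.comp contMDiff_base.contMDiffOn fun q hq => hq.2
  have hdF : ∀ q ∈ O ∩ base h ⁻¹' Q, ∀ v : Tan (E × ℝ × ℝ) q,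
      diff (f ∘ base h) q v = diff f q.1.1 (dbase q v) := by
    intro q hq v
    rw [← pb_diff (contMDiff_base q) (hf.contMDiffAt (hQ.mem_nhds hq.2))]
    rfl
  have hFV : ∀ q ∈ O ∩ base h ⁻¹' Q, diff (f ∘ base h) q ∈ d.coframe.hatV q := by
    intro q hq
    have h1 := d.pb_mem_hatV (hfV _ hq.2)
    convert! h1 using 1
    exact ContinuousLinearMap.ext (hdF q hq)
  obtain ⟨A, B, hA, -, hAB⟩ := d.exists_coeff_om_pi hP (fun q hq => hOs hq.1) hF hFV
  -- The function comes from the base, so its differential has no component along `pi`.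
  have hB : ∀ q ∈ O ∩ base h ⁻¹' Q, B q = 0 := by
    intro q hq
    obtain ⟨v, h1, h2, h3⟩ := d.exists_vertical (hOs hq.1)
    have h4 := hAB q hq v (by rw [h1]; exact zero_mem _)
    rw [hdF q hq, h1, h2, h3, map_zero] at h4
    linarith
  have hP₁ : IsOpen ((O ∩ base h ⁻¹' Q) ∩ A ⁻¹' {0}ᶜ) :=
    hA.isOpen_inter_preimage hP isOpen_compl_singleton
  have hq₁P : q₁ ∈ (O ∩ base h ⁻¹' Q) ∩ A ⁻¹' {0}ᶜ := by
    refine ⟨⟨hq₁O, hq₁Q⟩, fun hA0 => hq₁ ?_⟩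
    obtain ⟨v, h1, h2, h3, h4⟩ := d.exists_horizontal hq₁s
    have h5 := hAB q₁ ⟨hq₁O, hq₁Q⟩ v h2
    rw [hdF q₁ ⟨hq₁O, hq₁Q⟩, h1, h4, mul_zero, add_zero, show A q₁ = 0 from hA0, zero_mul] at h5
    exact h5
  -- The question is whether some first integral, on an open part of the set where `A` is nonzero,
  -- varies along the fibres of the projection. If so, its `pi` coefficient `B'` is nonzero
  -- somewhere, and `A ≠ 0`, `B' ≠ 0` make the two differentials independent modulo contact forms.
  by_cases H : ∃ (T : Set (Prolongation h)) (F : Prolongation h → ℝ), IsOpen T ∧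
      T ⊆ (O ∩ base h ⁻¹' Q) ∩ A ⁻¹' {0}ᶜ ∧ ContMDiffOn 𝓘(ℝ, E × ℝ × ℝ) 𝓘(ℝ, ℝ) ∞ F T ∧
      (∀ q ∈ T, diff F q ∈ d.coframe.hatV q) ∧
      ∃ q ∈ T, ∃ v : Tan (E × ℝ × ℝ) q, dbase q v = 0 ∧ diff F q v ≠ 0
  · obtain ⟨T, F, hT, hTP, hFs, hFV', q₂, hq₂, v₂, hv₂, hFv₂⟩ := H
    obtain ⟨A', B', -, hB', hAB'⟩ := d.exists_coeff_om_pi hT (fun q hq => hOs (hTP hq).1.1) hFs hFV'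
    refine ⟨T ∩ B' ⁻¹' {0}ᶜ, fun q hq => (hTP hq.1).1.1,
      hB'.isOpen_inter_preimage hT isOpen_compl_singleton, ⟨q₂, hq₂, fun hB0 => hFv₂ ?_⟩, ?_⟩
    · have h1 := hAB' q₂ hq₂ v₂ (by rw [hv₂]; exact zero_mem _)
      have h2 : d.om q₂ v₂ = 0 := (congrArg (d.c.σhat d.i q₂.1.1) hv₂).trans (map_zero _)
      rw [h1, h2, show B' q₂ = 0 from hB0, mul_zero, zero_mul, add_zero]
    · rintro q ⟨hqT, hqB⟩
      have hqP := hTP hqT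
      have hqs := hOs hqP.1.1
      have key : ∀ r t : ℝ, r • (diff (f ∘ base h) q : Cot (E × ℝ × ℝ) q) + t • diff F q ∈
          contact q → r = 0 ∧ t = 0 := by
        intro r t hrt
        rw [mem_contact_iff] at hrt
        have ht : t = 0 := by
          obtain ⟨v, h1, h2, h3⟩ := d.exists_vertical hqs
          have h0 : dbase q v ∈ q.1.2 := by rw [h1]; exact zero_mem _
          have h4 := hrt v h0
          rw [add_apply, smul_apply, smul_apply, hAB q hqP.1 v h0, hAB' q hqT v h0, h2, h3,
            hB q hqP.1] at h4
          simp only [mul_zero, add_zero, smul_eq_mul, mul_one, zero_add] at h4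
          exact (mul_eq_zero.1 h4).resolve_right hqB
        refine ⟨?_, ht⟩
        obtain ⟨v, -, h2, h3, h4⟩ := d.exists_horizontal hqs
        have h5 := hrt v h2
        rw [ht, zero_smul, add_zero, smul_apply, hAB q hqP.1 v h2, h3, h4] at h5
        simp only [mul_zero, add_zero, smul_eq_mul, mul_one] at h5
        exact (mul_eq_zero.1 h5).resolve_right hqP.2
      have hli : LinearIndependent ℝ ![(diff (f ∘ base h) q : Cot (E × ℝ × ℝ) q), diff F q] := by
        rw [LinearIndependent.pair_iff]
        intro r t hrt
        exact key r t (hrt ▸ zero_mem _)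
      have hle : Submodule.span ℝ (Set.range ![(diff (f ∘ base h) q : Cot (E × ℝ × ℝ) q),
          diff F q]) ≤ firstIntegrals d.chart.source d.coframe.hatV q := by
        refine Submodule.span_le.2 ?_
        rintro _ ⟨i, rfl⟩
        fin_cases i
        · exact diff_mem_firstIntegrals d.isOpen_source hP hqs hqP.1 hF hFV
        · exact diff_mem_firstIntegrals d.isOpen_source hT hqs hqT hFs hFV'
      -- Rank two makes these two differentials span all first integrals, so independence modulo
      -- contact forms passes to the whole bundle.
      have heq := Submodule.eq_of_le_of_finrank_eq hle (by
        rw [finrank_span_eq_card hli, hr₂ q hqs]; rfl)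
      rw [← heq, eq_bot_iff]
      rintro β ⟨hβ, hβc⟩
      rw [Matrix.range_cons, Matrix.range_cons, Matrix.range_empty, Set.union_empty,
        Set.singleton_union, SetLike.mem_coe, Submodule.mem_span_pair] at hβ
      obtain ⟨r, t, rfl⟩ := hβ
      obtain ⟨h1, h2⟩ := key r t hβc
      rw [h1, h2, zero_smul, zero_smul, add_zero]
      exact zero_mem _
  -- Here every first integral is constant along the fibres near `q₁` and descends to a first
  -- integral of the base, where the rank is one. All differentials at `q₁` would be multiples of
  -- the pull-back of `df`, contrary to rank two.
  · exfalso
    push Not at H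
    obtain ⟨T, F, hT, hqT, hTs, hFs, hFV', hF'⟩ := exists_firstIntegral_not_mem
      (T := Submodule.span ℝ {(diff (f ∘ base h) q₁ : Cot (E × ℝ × ℝ) q₁)}) (by
        rw [hr₂ q₁ hq₁s]
        exact lt_of_le_of_lt (finrank_span_le_card _) (by simp))
    have hv := H _ F (hT.inter hP₁) Set.inter_subset_right (hFs.mono Set.inter_subset_left)
      fun q hq => hFV' q hq.1
    obtain ⟨x₁, hx₁, a₁, b₁, hφ₁, rfl⟩ := d.exists_elt hq₁s
    obtain ⟨β, hβ, hFβ⟩ := d.exists_descend_firstIntegral hx₁ hφ₁ (hT.inter hP₁) ⟨hqT, hq₁P⟩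
      (hFs.mono Set.inter_subset_left) (fun q hq => hFV' q hq.1) hv
    have hf1 : (diff f x₁ : Cot E x₁) ≠ 0 := fun h0 => hq₁ (by
      have h1 : (diff f (d.elt hx₁ a₁ b₁).1.1 : Cot E (d.elt hx₁ a₁ b₁).1.1) = 0 := h0
      rw [h1]; rfl)
    have hle : Submodule.span ℝ {(diff f x₁ : Cot E x₁)} ≤ firstIntegrals d.U d.c.hatV x₁ := by
      rw [Submodule.span_singleton_le_iff_mem]
      exact diff_mem_firstIntegrals d.isOpen hQ hx₁ hq₁Q hf hfV
    have heq := Submodule.eq_of_le_of_finrank_eq hle (by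
      rw [finrank_span_singleton hf1, hr₁ x₁ hx₁])
    rw [← heq, Submodule.mem_span_singleton] at hβ
    obtain ⟨r, rfl⟩ := hβ
    refine hF' (Submodule.mem_span_singleton.2 ⟨r, ?_⟩)
    refine ContinuousLinearMap.ext fun v => ?_
    rw [hFβ v, smul_apply, hdF _ hq₁P.1]
    rfl

end Prolongation.ChartData

end MongeAmpere

/-! ### The open dense set for the second equation. -/

section OpenDense

variable {E : Type*} [NormedAddCommGroup E] [NormedSpace ℝ E]
  {N : Type*} [TopologicalSpace N] [ChartedSpace E N]
  [IsManifold 𝓘(ℝ, E) ∞ N] [FiniteDimensional ℝ E] {I : FormIdeal E N}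

lemma finrank_cot (x : N) : Module.finrank ℝ (Cot E x) = Module.finrank ℝ E := by
  have h1 : Module.finrank ℝ (E →L[ℝ] ℝ) = Module.finrank ℝ E :=
    (LinearMap.toContinuousLinearMap (𝕜 := ℝ) (E := E) (F' := ℝ)).finrank_eq.symm.trans
      Subspace.dual_finrank_eq
  exact h1

/-- The open set of integral elements where the first integrals are independent of the contact
forms. -/
def Prolongation.genericSet (h : IsHyperbolic 1 I) : Set (Prolongation h) :=
  {q | ∃ (U : Set (Prolongation h)) (c : AdaptedCoframe 3 (system h) U), IsOpen U ∧ q ∈ U ∧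
    ∀ y ∈ U, firstIntegrals U c.hatV y ⊓ contact y = ⊥ ∧ firstIntegrals U c.chkV y ⊓ contact y = ⊥}

lemma Prolongation.isOpen_genericSet (h : IsHyperbolic 1 I) : IsOpen (genericSet h) := by
  rw [isOpen_iff_mem_nhds]
  rintro q ⟨U, c, hU, hq, hc⟩
  filter_upwards [hU.mem_nhds hq] with y hy
  exact ⟨U, c, hU, hy, hc⟩

/-- The hat system is treated first, then the check system inside the resulting open set; the first
condition survives because first integrals are determined by germs. -/
lemma IsHyperbolicMongeAmpere.dense_genericSet (hI : IsHyperbolicMongeAmpere I)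
    (hr₁ : HasFirstIntegralRank 1 I 1)
    (hr₂ : HasFirstIntegralRank 3 (Prolongation.system hI.hyperbolic) 2) :
    Dense (Prolongation.genericSet hI.hyperbolic) := by
  rw [dense_iff_inter_open]
  rintro O hO ⟨q, hq⟩
  obtain ⟨d, hqd⟩ := Prolongation.exists_chartData q
  obtain ⟨O₁, hO₁, hO₁o, hne₁, h1⟩ := d.exists_isOpen_inf_contact hI.contact
    (fun x hx => (hr₁ d.U d.isOpen d.c x hx).1)
    (fun q hq => (hr₂ _ d.isOpen_source d.coframe q hq).1)
    (hO.inter d.isOpen_source) Set.inter_subset_right ⟨q, hq, hqd⟩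
  obtain ⟨O₂, hO₂, hO₂o, ⟨q₂, hq₂⟩, h2⟩ := d.swap.exists_isOpen_inf_contact hI.contact
    (fun x hx => (hr₁ d.U d.isOpen d.c x hx).2)
    (fun q hq => (hr₂ _ d.swap.isOpen_source d.swap.coframe q hq).1)
    hO₁o (fun q hq => d.swap_mem_source (hO₁ hq).2) hne₁
  have hsub : O₂ ⊆ d.chart.source := fun q hq => (hO₁ (hO₂ hq)).2
  refine ⟨q₂, (hO₁ (hO₂ hq₂)).1, O₂, d.coframe.restrict hsub, hO₂o, hq₂, fun y hy => ?_⟩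
  have e1 : firstIntegrals O₂ (d.coframe.restrict hsub).hatV y =
      firstIntegrals d.chart.source d.coframe.hatV y :=
    firstIntegrals_congr hO₂o d.isOpen_source hO₂o hy (hsub hy) hy fun _ _ => rfl
  have e2 : firstIntegrals O₂ (d.coframe.restrict hsub).chkV y =
      firstIntegrals d.chart.source d.coframe.chkV y :=
    firstIntegrals_congr hO₂o d.isOpen_source hO₂o hy (hsub hy) hy fun _ _ => rfl
  rw [e1, e2, ← d.firstIntegrals_swap (hsub hy)]
  exact ⟨h1 y (hO₂ hy), h2 y hy⟩

/-- First integrals of one system that also lie in the other singular system are contact covectors,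
hence zero on the generic set. All three intersection statements follow from this, and the sums from
a dimension count. -/
lemma IsHyperbolicMongeAmpere.isDarbouxIntegrableOn_genericSet (hI : IsHyperbolicMongeAmpere I)
    (hr₂ : HasFirstIntegralRank 3 (Prolongation.system hI.hyperbolic) 2) :
    IsDarbouxIntegrableOn 3 (Prolongation.system hI.hyperbolic)
      (Prolongation.genericSet hI.hyperbolic) := by
  refine isDarbouxIntegrableOn_of_coframe (Prolongation.isHyperbolic_system hI.hyperbolic)
    (Prolongation.isOpen_genericSet _) 2 ?_
  rintro q ⟨U, c, hU, hq, hc⟩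
  have had := c.adapted q hq
  obtain ⟨h1, h2⟩ := hc q hq
  have hcon : c.hatV q ⊓ c.chkV q ≤ Prolongation.contact q := by
    intro β hβ
    rw [← Prolongation.form1_mem_system, had.form1_mem, ← had.hat_inf_chk]
    exact hβ
  -- A singular system has rank `3 + 2 = 5`, the first integrals have rank 2, and the cotangent
  -- space has dimension 7.
  have hsup : ∀ S S' : Submodule ℝ (Cot (E × ℝ × ℝ) q), Module.finrank ℝ S = 5 →
      Module.finrank ℝ S' = 2 → S ⊓ S' = ⊥ → S ⊔ S' = ⊤ := by
    intro S S' hS hS' hSS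
    have h3 := Submodule.finrank_sup_add_finrank_inf_eq S S'
    rw [hSS, finrank_bot, hS, hS'] at h3
    refine Submodule.eq_top_of_finrank_eq ?_
    have h4 : Module.finrank ℝ (E × ℝ × ℝ) = 7 := had.finrank_eq
    rw [finrank_cot, h4]
    exact h3
  obtain ⟨r1, r2⟩ := hr₂ U hU c q hq
  refine ⟨U, c, hU, hq, r1, r2, hsup _ _ had.finrank_hat r2 ?_,
    hsup _ _ had.swap.finrank_hat r1 ?_, ?_⟩
  · rw [eq_bot_iff, ← h2]
    exact fun β hβ => ⟨hβ.2, hcon ⟨hβ.1, firstIntegrals_le hβ.2⟩⟩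
  · rw [eq_bot_iff, ← h1]
    exact fun β hβ => ⟨hβ.2, hcon ⟨firstIntegrals_le hβ.2, hβ.1⟩⟩
  · rw [eq_bot_iff, ← h1]
    exact fun β hβ => ⟨hβ.1, hcon ⟨firstIntegrals_le hβ.1, firstIntegrals_le hβ.2⟩⟩

end OpenDense

end EDS

end

/-! ### The main theorem. -/

theorem mainTheorem8
    {N N₁ N₂ : Type*}
    [TopologicalSpace N] [ChartedSpace (EuclideanSpace ℝ (Fin 6)) N]
    [IsManifold 𝓘(ℝ, EuclideanSpace ℝ (Fin 6)) ∞ N]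
    [TopologicalSpace N₁] [ChartedSpace (EuclideanSpace ℝ (Fin 5)) N₁]
    [IsManifold 𝓘(ℝ, EuclideanSpace ℝ (Fin 5)) ∞ N₁]
    [TopologicalSpace N₂] [ChartedSpace (EuclideanSpace ℝ (Fin 5)) N₂]
    [IsManifold 𝓘(ℝ, EuclideanSpace ℝ (Fin 5)) ∞ N₂]
    (B : EDS.FormIdeal (EuclideanSpace ℝ (Fin 6)) N)
    (I₁ : EDS.FormIdeal (EuclideanSpace ℝ (Fin 5)) N₁)
    (I₂ : EDS.FormIdeal (EuclideanSpace ℝ (Fin 5)) N₂)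
    (p₁ : N → N₁) (p₂ : N → N₂)
    (hI₁ : EDS.IsWaveSystem I₁) (hI₂ : EDS.IsHyperbolicMongeAmpere I₂)
    (hrank : EDS.HasFirstIntegralRank 1 I₂ 1)
    (hrank' : EDS.HasFirstIntegralRank 3 (EDS.Prolongation.system hI₂.hyperbolic) 2)
    (hB : EDS.IsBacklund B I₁ I₂ p₁ p₂) :
    ∃ (hB₂ : EDS.IsHyperbolic 2 B) (hI₁' : EDS.IsHyperbolic 1 I₁)
      (q₁ : EDS.Prolongation hB₂ → EDS.Prolongation hI₁')
      (q₂ : EDS.Prolongation hB₂ → EDS.Prolongation hI₂.hyperbolic),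
      (∀ e, (q₁ e).1 = ⟨p₁ e.1.1, Submodule.map (EDS.dmap (EuclideanSpace ℝ (Fin 6))
        (EuclideanSpace ℝ (Fin 5)) p₁ e.1.1).toLinearMap e.1.2⟩) ∧
      (∀ e, (q₂ e).1 = ⟨p₂ e.1.1, Submodule.map (EDS.dmap (EuclideanSpace ℝ (Fin 6))
        (EuclideanSpace ℝ (Fin 5)) p₂ e.1.1).toLinearMap e.1.2⟩) ∧
      EDS.IsHyperbolic 4 (EDS.Prolongation.system hB₂) ∧
      EDS.IsHyperbolic 3 (EDS.Prolongation.system hI₁') ∧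
      EDS.IsHyperbolic 3 (EDS.Prolongation.system hI₂.hyperbolic) ∧
      EDS.IsBacklund (EDS.Prolongation.system hB₂) (EDS.Prolongation.system hI₁')
        (EDS.Prolongation.system hI₂.hyperbolic) q₁ q₂ ∧
      EDS.IsDarbouxIntegrableOn 3 (EDS.Prolongation.system hI₁') Set.univ ∧
      ∃ W : Set (EDS.Prolongation hI₂.hyperbolic), IsOpen W ∧ Dense W ∧
        EDS.IsDarbouxIntegrableOn 3 (EDS.Prolongation.system hI₂.hyperbolic) W := by
  have hI₁' := hI₁.isHyperbolic
  -- The class is kept in the form `1 + 1` to match the `s + 1` of the extension lemmas.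
  have hB₂ : EDS.IsHyperbolic (1 + 1) B :=
    EDS.isHyperbolic_of_extension hB.closed hI₁' hB.extension₁ hB.fibre₁
  have r₁ := fun e : EDS.Prolongation hB₂ =>
    EDS.isRegular_map_plane hI₁' hB.extension₁ hB.fibre₁ e.2
  have r₂ := fun e : EDS.Prolongation hB₂ =>
    EDS.isRegular_map_plane hI₂.hyperbolic hB.extension₂ hB.fibre₂ e.2
  have hs := EDS.Prolongation.isHyperbolic_system hB₂
  have e₁ := EDS.Prolongation.isIntegrableExtension_prolongMap (hA := hB₂) (hI := hI₁')
    (hreg := r₁) hB.extension₁ hB.fibre₁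
  have e₂ := EDS.Prolongation.isIntegrableExtension_prolongMap (hA := hB₂)
    (hI := hI₂.hyperbolic) (hreg := r₂) hB.extension₂ hB.fibre₂
  exact ⟨hB₂, hI₁', EDS.Prolongation.prolongMap r₁, EDS.Prolongation.prolongMap r₂,
    fun _ => rfl, fun _ => rfl, hs, EDS.Prolongation.isHyperbolic_system hI₁',
    EDS.Prolongation.isHyperbolic_system hI₂.hyperbolic,
    ⟨hs.closed, e₁.1, e₂.1, e₁.2, e₂.2⟩, hI₁.isDarbouxIntegrableOn_system hI₁',
    EDS.Prolongation.genericSet hI₂.hyperbolic, EDS.Prolongation.isOpen_genericSet _,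
    hI₂.dense_genericSet hrank hrank', hI₂.isDarbouxIntegrableOn_genericSet hrank'⟩
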